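/- Work over $\mathbb{C}$. Let $\mathbf{Art}$ be the category of local Artinian $\mathbb{C}$-algebras $A$ with residue field $\mathbb{C}$ and maximal ideal $m_A$, and let $h:L\to M$ and $g:N\to M$ be morphisms of differential graded Lie algebras (DGLAs). For a DGLA $L$, the gauge action of $a\in L^0\otimes m_A$ on $x\in L^1\otimes m_A$ is $e^a*x=x+\sum_{n\ge 0}\frac{[a,-]^n}{(n+1)!}([a,x]-da)$, and $\exp(L^0\otimes m_A)$ is the group $\{e^a\}$ with the Baker–Campbell–Hausdorff product. Put $$\mathrm{MC}_{(h,g)}(A)=\Big\{(x,y,e^p)\ \Big|\ x\in L^1\otimes m_A,\ y\in N^1\otimes m_A,\ p\in M^0\otimes m_A,\ dx+\tfrac12[x,x]=0,\ dy+\tfrac12[y,y]=0,\ g(y)=e^p*h(x)\Big\},$$ and call $(x_1,y_1,e^{p_1})$ and $(x_2,y_2,e^{p_2})$ gauge equivalent if there are $a\in L^0\otimes m_A$, $b\in N^0\otimes m_A$, $c\in M^{-1}\otimes m_A$ with $$x_2=e^a*x_1,\qquad y_2=e^b*y_1,\qquad e^{p_2}=e^{g(b)}e^{T}e^{p_1}e^{-h(a)},\qquad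 T=dc+[g(y_1),c].$$ Let $\mathrm{Def}_{(h,g)}(A)$ be the quotient of $\mathrm{MC}_{(h,g)}(A)$ by gauge equivalence. Let $C=C_{(h,g)}$ be the graded space $C^i=L^i\oplus N^i\oplus M^{i-1}$, and let $$H=\{(l,n,m(t,dt))\in L\times N\times M[t,dt]\ |\ h(l)=m(1),\ g(n)=m(0)\},\qquad q_2(u\odot v)=(-1)^{\deg u}[u,v].$$ Define $\imath:C\to H$, $\pi:H\to C$ and $\kappa:H\to H$ by $\imath(l,n,m)=(l,n,(1-t)g(n)+t\,h(l)+dt\,m)$, $\pi(l,n,m(t,dt))=(l,n,\int_0^1 m(t,dt))$ and $\kappa(l,n,m(t,dt))=(0,0,t\int_0^1 m(t,dt)-\int_0^t m(t,dt))$. The transferred $L_\infty$ structure on $C$ has the brackets $\langle(l,n,m)\rangle_1=(-dl,-dn,dm+g(n)-h(l))$ and, for $k\ge 2$, $$\langle\gamma_1\odot\cdots\odot\gamma_k\rangle_k=\frac{(-1)^{k}}{2}\sum_{\sigma\in\Sigma_k}\varepsilon(\sigma)\,\pi q_2\big(\imath\gamma_{\sigma(1)}\odot \kappa q_2(\imath\gamma_{\sigma(2)}\odot\cdots\odot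 \kappa q_2(\imath\gamma_{\sigma(k-1)}\odot\imath\gamma_{\sigma(k)})\cdots)\big),$$ where $\varepsilon(\sigma)$ is the Koszul sign for the degrees in $C[1]$. Put $\mathrm{MC}^\infty_C(A)=\{\gamma\in C^1\otimes m_A\mid \sum_{j\ge1}\langle\gamma^{\odot j}\rangle_j/j!=0\}$; call $\gamma_0,\gamma_1\in\mathrm{MC}^\infty_C(A)$ homotopy equivalent if there is $\Gamma\in\mathrm{MC}^\infty_{C[s,ds]}(A)$ with $\Gamma(0)=\gamma_0$ and $\Gamma(1)=\gamma_1$, where $C[s,ds]=C\otimes\mathbb{C}[s,ds]$ has the induced $L_\infty$ structure; and let $\mathrm{Def}^\infty_C(A)$ be the quotient of $\mathrm{MC}^\infty_C(A)$ by homotopy equivalence. Then $(l,n,m)\mapsto(l,n,e^m)$ is an isomorphism of functors $\mathrm{MC}^\infty_{C}\cong\mathrm{MC}_{(h,g)}$ on $\mathbf{Art}$; under it, for every $A$, two Maurer–Cartan elements are homotopy equivalent if and only if their images are gauge equivalent; and it induces an isomorphism of functors $$\mathrm{Def}^\infty_{C_{(h,g)}}\ \cong\ \mathrm{Def}_{(h,g)}:\mathbf{Art}\to\mathbf{Set}.$$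 -/

import Mathlib

open CategoryTheory
open scoped TensorProduct Polynomial

universe u v w

noncomputable section

namespace ConeDef

/-! ### Scalar extension -/

section Scalars

variable {K : Type u} [Field K]

/-- For a bilinear map `B : C × H → W` and a multilinear map `m : C × ⋯ × C → H`, the multilinear
map `(c₀, c₁, …, cₙ) ↦ B c₀ (m (c₁, …, cₙ))`. -/
def consMultilinear {C : Type v} {H : Type w} {W : Type*} [AddCommGroup C] [Module K C] [AddCommGroup H] [Module K H]
    [AddCommGroup W] [Module K W] {n : ℕ} (B : C →ₗ[K] H →ₗ[K] W)
    (m : MultilinearMap K (fun _ : Fin n => C) H) :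
    MultilinearMap K (fun _ : Fin (n + 1) => C) W :=
  LinearMap.uncurryLeft (M := fun _ : Fin (n + 1) => C)
    { toFun := fun c => (B c).compMultilinearMap m
      map_add' := fun x y => by ext; simp
      map_smul' := fun a x => by ext; simp }

theorem consMultilinear_apply {C : Type v} {H : Type w} {W : Type*} [AddCommGroup C] [Module K C] [AddCommGroup H]
    [Module K H] [AddCommGroup W] [Module K W] {n : ℕ} (B : C →ₗ[K] H →ₗ[K] W)
    (m : MultilinearMap K (fun _ : Fin n => C) H) (c : Fin (n + 1) → C) :
    consMultilinear B m c = B (c 0) (m (Fin.tail c)) := rfl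

variable (R : Type w) [CommRing R] [Algebra K R]

instance multilinearTower {V : Type v} [AddCommGroup V] [Module K V] (n : ℕ) :
    IsScalarTower K R (MultilinearMap R (fun _ : Fin n => R ⊗[K] V) (R ⊗[K] V)) :=
  ⟨fun a r f => by ext x; simp⟩

/-- The `R`-multilinear extension of a `K`-multilinear map `V × ⋯ × V → V` to `R ⊗ V`; it is
characterised by `extend_tmul` below. -/
def extend {V : Type v} [AddCommGroup V] [Module K V] : (n : ℕ) →
    MultilinearMap K (fun _ : Fin n => V) V →ₗ[K]
      MultilinearMap R (fun _ : Fin n => R ⊗[K] V) (R ⊗[K] V)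
  | 0 =>
    { toFun := fun f => MultilinearMap.constOfIsEmpty R _ (1 ⊗ₜ f 0)
      map_add' := fun f g => by ext; simp [TensorProduct.tmul_add]
      map_smul' := fun a f => by ext; simp }
  | n + 1 =>
    { toFun := fun f => LinearMap.uncurryLeft (M := fun _ : Fin (n + 1) => R ⊗[K] V)
        (LinearMap.liftBaseChange R ((extend n).comp f.curryLeft))
      map_add' := fun f g => by
        have : (extend n).comp (f + g).curryLeft
            = (extend n).comp f.curryLeft + (extend n).comp g.curryLeft := by
          ext x : 1
          have : (f + g).curryLeft x = f.curryLeft x + g.curryLeft x := by ext; simp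
          simp [this]
        rw [this]
        ext x
        simp [LinearMap.liftBaseChange]
      map_smul' := fun a f => by
        have : (extend n).comp (a • f).curryLeft = a • (extend n).comp f.curryLeft := by
          ext x : 1
          have : (a • f).curryLeft x = a • f.curryLeft x := by ext; simp
          simp [this]
        rw [this]
        ext x
        simp only [LinearMap.liftBaseChange, RingHom.id_apply, smul_apply,
          LinearMap.uncurryLeft_apply]
        rw [← LinearEquiv.coe_coe, LinearMap.map_smul_of_tower]
        rfl }

theorem extend_tmul {V : Type v} [AddCommGroup V] [Module K V] (n : ℕ)
    (f : MultilinearMap K (fun _ : Fin n => V) V) (r : Fin n → R) (x : Fin n → V) :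
    extend R n f (fun i => r i ⊗ₜ x i) = (∏ i, r i) ⊗ₜ f x := by
  induction n with
  | zero =>
    have h : extend R 0 f (fun i => r i ⊗ₜ x i) = 1 ⊗ₜ f 0 := rfl
    rw [h, Subsingleton.elim (0 : Fin 0 → V) x]
    simp
  | succ n ih =>
    have h : extend R (n + 1) f (fun i => r i ⊗ₜ x i)
        = (LinearMap.liftBaseChange R ((extend R n).comp f.curryLeft)) (r 0 ⊗ₜ x 0)
          (fun i => r i.succ ⊗ₜ x i.succ) := rfl
    rw [h]
    simp only [LinearMap.liftBaseChange_tmul, LinearMap.comp_apply, smul_apply, ih]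
    rw [Fin.prod_univ_succ, TensorProduct.smul_tmul', smul_eq_mul]
    congr 1
    rw [MultilinearMap.curryLeft_apply]
    congr 1
    ext i
    refine Fin.cases ?_ (fun j => ?_) i <;> simp


/-- `S ⊗ I` inside `R ⊗ V`, for an ideal `I` of `R` and a subspace `S` of `V`. -/
def coeffPart {V : Type v} [AddCommGroup V] [Module K V] (I : Ideal R) (S : Submodule K V) :
    Submodule K (R ⊗[K] V) :=
  Submodule.map₂ (TensorProduct.mk K R V) (I.restrictScalars K) S

end Scalars

/-! ### The category `Art` -/

/-- A local Artinian `K`-algebra with residue field `K`. -/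
structure ArtAlg (K : Type u) [Field K] where
  carrier : Type w
  [commRing : CommRing carrier]
  [algebra : Algebra K carrier]
  [isLocalRing : IsLocalRing carrier]
  [isArtinianRing : IsArtinianRing carrier]
  residue : Function.Bijective (algebraMap K (IsLocalRing.ResidueField carrier))

attribute [instance] ArtAlg.commRing ArtAlg.algebra ArtAlg.isLocalRing ArtAlg.isArtinianRing

instance (K : Type u) [Field K] : CoeSort (ArtAlg.{u, w} K) (Type w) := ⟨ArtAlg.carrier⟩

/-- Morphisms are `K`-algebra maps; they are automatically local. -/
instance (K : Type u) [Field K] : Category (ArtAlg.{u, w} K) where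
  Hom A B := A.carrier →ₐ[K] B.carrier
  id A := AlgHom.id K A.carrier
  comp f g := AlgHom.comp g f

/-- The maximal ideal `m_A`. -/
abbrev ArtAlg.m {K : Type u} [Field K] (A : ArtAlg.{u, w} K) : Ideal A :=
  IsLocalRing.maximalIdeal A

/-- The map `A ⊗ V → B ⊗ V` induced by a morphism `A → B`. -/
def ArtAlg.push {K : Type u} [Field K] {A B : ArtAlg.{u, w} K} (f : A ⟶ B) (V : Type v)
    [AddCommGroup V] [Module K V] : A ⊗[K] V →ₗ[K] B ⊗[K] V :=
  LinearMap.rTensor V (AlgHom.toLinearMap (show A.carrier →ₐ[K] B.carrier from f))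

/-! ### Differential graded Lie algebras -/

/-- A (`ℤ`-graded, cohomological) differential graded Lie algebra over a field `K` of
characteristic zero. -/
structure DGLA (K : Type u) [Field K] where
  carrier : Type v
  [addCommGroup : AddCommGroup carrier]
  [module : Module K carrier]
  /-- the homogeneous components -/
  gr : ℤ → Submodule K carrier
  [decomposition : DirectSum.Decomposition gr]
  d : carrier →ₗ[K] carrier
  br : carrier →ₗ[K] carrier →ₗ[K] carrier
  d_mem : ∀ {i x}, x ∈ gr i → d x ∈ gr (i + 1)
  d_d : ∀ x, d (d x) = 0
  br_mem : ∀ {i j x y}, x ∈ gr i → y ∈ gr j → br x y ∈ gr (i + j)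
  br_symm : ∀ {i j x y}, x ∈ gr i → y ∈ gr j → br x y = -((i * j).negOnePow • br y x)
  jacobi : ∀ {i j x y} (z), x ∈ gr i → y ∈ gr j →
    br x (br y z) = br (br x y) z + (i * j).negOnePow • br y (br x z)
  leibniz : ∀ {i x} (y), x ∈ gr i → d (br x y) = br (d x) y + i.negOnePow • br x (d y)

attribute [instance] DGLA.addCommGroup DGLA.module DGLA.decomposition

instance (K : Type u) [Field K] : CoeSort (DGLA.{u, v} K) (Type v) := ⟨DGLA.carrier⟩

/-- The operator `x ↦ (-1) ^ deg x • x`. -/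
def DGLA.sgn {K : Type u} [Field K] (L : DGLA.{u, v} K) : L →ₗ[K] L :=
  (DirectSum.toModule K ℤ L fun i => i.negOnePow • (L.gr i).subtype) ∘ₗ
    (DirectSum.decomposeLinearEquiv L.gr).toLinearMap

theorem DGLA.sgn_apply {K : Type u} [Field K] (L : DGLA.{u, v} K) {i : ℤ} {x : L}
    (hx : x ∈ L.gr i) : L.sgn x = i.negOnePow • x := by
  simp only [sgn, LinearMap.comp_apply, LinearEquiv.coe_coe,
    DirectSum.decomposeLinearEquiv_apply, DirectSum.decompose_of_mem L.gr hx]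
  exact DirectSum.toModule_lof (φ := fun i => i.negOnePow • (L.gr i).subtype) K i
    (⟨x, hx⟩ : L.gr i)

/-- A morphism of differential graded Lie algebras. -/
structure DGLAHom {K : Type u} [Field K] (L M : DGLA.{u, v} K) where
  toLin : L →ₗ[K] M
  map_gr : ∀ {i x}, x ∈ L.gr i → toLin x ∈ M.gr i
  map_d : ∀ x, toLin (L.d x) = M.d (toLin x)
  map_br : ∀ x y, toLin (L.br x y) = M.br (toLin x) (toLin y)

/-! ### The exponential group and the gauge action

For the nilpotent Lie algebra `𝔫 = M⁰ ⊗ m_A`, the group `exp 𝔫` is the set `𝔫`, the element `p`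
being written `e ^ p`, with the Baker-Campbell-Hausdorff product `e ^ x * e ^ y = e ^ (bch x y)`.
-/

section Exp

variable (K : Type u) [Field K] {V : Type v} [AddCommGroup V] [Module K V]

/-- `[x₁, [x₂, … [xₖ₋₁, xₖ] … ]]` -/
def nestedBracket (b : V → V → V) : List V → V
  | [] => 0
  | [x] => x
  | x :: y :: l => b x (nestedBracket b (y :: l))

/-- The word `x ^ r₁ y ^ s₁ ⋯ x ^ rₙ y ^ sₙ`. -/
def bchWord (x y : V) (w : List (ℕ × ℕ)) : List V :=
  w.flatMap fun e => List.replicate e.1 x ++ List.replicate e.2 y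

/-- `(-1) ^ (n - 1) / n * 1 / ((∑ (rᵢ + sᵢ)) * ∏ rᵢ! sᵢ!)`, for nonempty lists of pairs
`(rᵢ, sᵢ) ≠ (0, 0)`, and `0` for other lists. -/
def bchCoeff (w : List (ℕ × ℕ)) : K :=
  if w ≠ [] ∧ (0, 0) ∉ w then
    (-1) ^ (w.length - 1) / (w.length : K) *
      (((w.map fun e => e.1 + e.2).sum : ℕ) : K)⁻¹ *
      (((w.map fun e => e.1.factorial * e.2.factorial).prod : ℕ) : K)⁻¹
  else 0

/-- The Baker-Campbell-Hausdorff product in Dynkin's form, `log (e ^ x * e ^ y)`; the sum is finite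
in a nilpotent Lie algebra. -/
def bch (b : V → V → V) (x y : V) : V :=
  ∑ᶠ w : List (ℕ × ℕ), bchCoeff K w • nestedBracket b (bchWord x y w)

/-- The gauge action `e ^ a * x = x + ∑ₙ [a, -] ^ n / (n + 1)! ([a, x] - d a)`. -/
def gauge (d : V → V) (b : V → V → V) (a x : V) : V :=
  x + ∑ᶠ n : ℕ, ((n + 1).factorial : K)⁻¹ • (b a)^[n] (b a x - d a)

end Exp

/-! ### The Maurer-Cartan and deformation functors of a pair of morphisms -/

namespace DGLA

variable {K : Type u} [Field K] (L : DGLA.{u, v} K) (A : ArtAlg.{u, w} K)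

/-- `L ^ i ⊗ m_A` -/
def part (i : ℤ) : Submodule K (A ⊗[K] L) := coeffPart A A.m (L.gr i)

/-- the differential of `L ⊗ A` -/
def dA : A ⊗[K] L → A ⊗[K] L := L.d.baseChange A

/-- the bracket of `L ⊗ A` (no sign occurs, as `A` has degree zero) -/
def brA : A ⊗[K] L → A ⊗[K] L → A ⊗[K] L := fun x y => LinearMap.BilinMap.baseChange A L.br x y

/-- `x ∈ L¹ ⊗ m_A` and `d x + 1/2 [x, x] = 0` -/
def IsMC (x : A ⊗[K] L) : Prop :=
  x ∈ L.part A 1 ∧ L.dA A x + (2⁻¹ : K) • L.brA A x x = 0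

/-- the gauge action on `L¹ ⊗ m_A` -/
def gaugeA (a x : A ⊗[K] L) : A ⊗[K] L := gauge K (L.dA A) (L.brA A) a x

/-- the product of the group `exp (L⁰ ⊗ m_A)` -/
def mulA (p q : A ⊗[K] L) : A ⊗[K] L := bch K (L.brA A) p q

end DGLA

section Pair

variable {K : Type u} [Field K] {L M N : DGLA.{u, v} K} (h : DGLAHom L M) (g : DGLAHom N M)
  (A : ArtAlg.{u, w} K)

/-- The map `L ⊗ A → M ⊗ A` induced by a morphism. -/
def DGLAHom.mapA (h : DGLAHom L M) : A ⊗[K] L → A ⊗[K] M := h.toLin.baseChange A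

/-- `MC_(h,g)(A)`: triples `(x, y, e ^ p)` with `x`, `y` Maurer-Cartan, `p ∈ M⁰ ⊗ m_A` and
`g(y) = e ^ p * h(x)`. -/
abbrev MCPair : Type (max v w) :=
  {z : (A ⊗[K] L) × (A ⊗[K] N) × (A ⊗[K] M) //
    L.IsMC A z.1 ∧ N.IsMC A z.2.1 ∧ z.2.2 ∈ M.part A 0 ∧
      g.mapA A z.2.1 = M.gaugeA A z.2.2 (h.mapA A z.1)}

/-- The gauge relation: `x₂ = e ^ a * x₁`, `y₂ = e ^ b * y₁` and
`e ^ p₂ = e ^ g(b) e ^ T e ^ p₁ e ^ (-h(a))` with `T = d c + [g(y₁), c]`. -/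
def GaugeEquiv (z₁ z₂ : MCPair h g A) : Prop :=
  ∃ a ∈ L.part A 0, ∃ b ∈ N.part A 0, ∃ c ∈ M.part A (-1),
    z₂.1.1 = L.gaugeA A a z₁.1.1 ∧
    z₂.1.2.1 = N.gaugeA A b z₁.1.2.1 ∧
    z₂.1.2.2 = M.mulA A (M.mulA A (M.mulA A (g.mapA A b)
      (M.dA A c + M.brA A (g.mapA A z₁.1.2.1) c)) z₁.1.2.2) (-h.mapA A a)

end Pair

/-! ### `L∞` data -/

/-- The data of an `L∞` structure on a graded vector space `V`: its multibrackets, which are maps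
of degree one on `V[1]`, together with the operator `x ↦ (-1) ^ deg x • x` on `V`. -/
structure LInftyData (K : Type u) [Field K] where
  carrier : Type v
  [addCommGroup : AddCommGroup carrier]
  [module : Module K carrier]
  /-- the homogeneous components of `V` (not of `V[1]`) -/
  gr : ℤ → Submodule K carrier
  sgn : carrier →ₗ[K] carrier
  sgn_apply : ∀ {i x}, x ∈ gr i → sgn x = i.negOnePow • x
  /-- the unary bracket `⟨x⟩₁` -/
  q₁ : carrier →ₗ[K] carrier
  /-- `q n` is the bracket `⟨x₀ ⊙ ⋯ ⊙ xₙ₊₁⟩` with `n + 2` entries -/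
  q : (n : ℕ) → MultilinearMap K (fun _ : Fin (n + 2) => carrier) carrier

attribute [instance] LInftyData.addCommGroup LInftyData.module

instance (K : Type u) [Field K] : CoeSort (LInftyData.{u, v} K) (Type v) := ⟨LInftyData.carrier⟩

namespace LInftyData

variable {K : Type u} [Field K] (T : LInftyData.{u, v} K)

/-- `∑ⱼ ⟨γ ⊙ ⋯ ⊙ γ⟩ⱼ / j!` for `γ ∈ T ⊗ A`; the sum is finite if `γ ∈ T ⊗ m_A`. -/
def curvature (A : ArtAlg.{u, w} K) (γ : A ⊗[K] T) : A ⊗[K] T :=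
  T.q₁.baseChange A γ +
    ∑ᶠ n : ℕ, ((n + 2).factorial : K)⁻¹ • extend A (n + 2) (T.q n) (fun _ => γ)

/-- `MC^∞_T(A)` -/
abbrev MC (A : ArtAlg.{u, w} K) : Type (max v w) :=
  {γ : A ⊗[K] T // γ ∈ coeffPart A A.m (T.gr 1) ∧ T.curvature A γ = 0}

/-- The `L∞` structure on `T[s, ds] = T ⊗ K[s, ds]`. The pair `(p, q)` stands for
`p(s) + q(s) ds`, with the form `ds` on the right of the coefficients. The unary bracket is the
suspension of the differential `D(p + q ds) = D p + (D q) ds + (-1) ^ deg(p) p' ds`, where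
`D = -⟨ ⟩₁`; in the higher brackets a sign `(-1) ^ (deg(pⱼ) - 1)` arises when `ds` is moved to the
right past `pⱼ ∈ T[1]`. -/
def path : LInftyData.{u, max u v} K where
  carrier := (K[X] ⊗[K] T) × (K[X] ⊗[K] T)
  gr i := (coeffPart K[X] ⊤ (T.gr i)).prod (coeffPart K[X] ⊤ (T.gr (i - 1)))
  sgn := (T.sgn.lTensor K[X]).prodMap (-(T.sgn.lTensor K[X]))
  sgn_apply := by
    have key : ∀ (i : ℤ) (x : K[X] ⊗[K] T), x ∈ coeffPart K[X] ⊤ (T.gr i) →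
        T.sgn.lTensor K[X] x = i.negOnePow • x := by
      intro i x hx
      have hle : coeffPart K[X] ⊤ (T.gr i) ≤ LinearMap.eqLocus (T.sgn.lTensor K[X])
          (i.negOnePow • (LinearMap.id : K[X] ⊗[K] T →ₗ[K] K[X] ⊗[K] T)) :=
        Submodule.map₂_le.2 fun r _ y hy => by
          rw [LinearMap.mem_eqLocus, TensorProduct.mk_apply, LinearMap.lTensor_tmul,
            T.sgn_apply hy]
          rcases Int.even_or_odd i with hi | hi
          · simp [Int.negOnePow_even i hi]
          · simp [Int.negOnePow_odd i hi, TensorProduct.tmul_neg]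
      exact hle hx
    rintro i ⟨p, q⟩ ⟨hp, hq⟩
    refine Prod.ext ?_ ?_
    · simpa using key i p hp
    · have := key (i - 1) q hq
      simp [this, Int.negOnePow_sub]
  q₁ := ((T.q₁.lTensor K[X]) ∘ₗ LinearMap.fst K _ _).prod
    ((T.q₁.lTensor K[X]) ∘ₗ LinearMap.snd K _ _ -
      (TensorProduct.map Polynomial.derivative T.sgn) ∘ₗ LinearMap.fst K _ _)
  q n := ((extend K[X] (n + 2) (T.q n)).restrictScalars K |>.compLinearMap
      fun _ => LinearMap.fst K _ _).prod
    (∑ i : Fin (n + 2), ((extend K[X] (n + 2) (T.q n)).restrictScalars K).compLinearMap fun j =>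
      if j < i then LinearMap.fst K _ _
      else if j = i then LinearMap.snd K _ _
      else -((T.sgn.lTensor K[X]) ∘ₗ LinearMap.fst K _ _))

/-- The evaluation `T[s, ds] → T` at `s = a`. -/
def evalPath (a : K) : T.path →ₗ[K] T :=
  (TensorProduct.lid K T).toLinearMap ∘ₗ ((Polynomial.leval a).rTensor T) ∘ₗ
    LinearMap.fst K (K[X] ⊗[K] T) (K[X] ⊗[K] T)

/-- Homotopy equivalence of Maurer-Cartan elements. -/
def Homotopic (A : ArtAlg.{u, w} K) (γ₀ γ₁ : T.MC A) : Prop :=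
  ∃ Γ : T.path.MC A, (T.evalPath 0).baseChange A Γ.1 = γ₀.1 ∧
    (T.evalPath 1).baseChange A Γ.1 = γ₁.1

end LInftyData

/-! ### The `L∞` structure on the cone -/

section Cone

variable {K : Type u} [Field K]

/-- `f ↦ ∫₀ᵗ f(s) ds` -/
def antideriv (K : Type u) [Field K] : K[X] →ₗ[K] K[X] :=
  Polynomial.lsum fun n => ((n : K) + 1)⁻¹ • Polynomial.monomial (n + 1)

/-- `f ↦ t ∫₀¹ f(s) ds - ∫₀ᵗ f(s) ds` -/
def homotopyPoly (K : Type u) [Field K] : K[X] →ₗ[K] K[X] :=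
  (LinearMap.toSpanSingleton K K[X] Polynomial.X) ∘ₗ (Polynomial.leval 1) ∘ₗ antideriv K
    - antideriv K

variable {L M N : DGLA.{u, v} K} (h : DGLAHom L M) (g : DGLAHom N M)

/-- `L × N × M[t, dt]`; the quadruple `(l, n, p, q)` stands for `(l, n, p(t) + dt q(t))`, with the
form `dt` on the left. -/
abbrev PathAmbient (L M N : DGLA.{u, v} K) : Type (max u v) :=
  L × N × (K[X] ⊗[K] M) × (K[X] ⊗[K] M)

/-- The differential graded Lie algebra `H_(h,g)` inside `L × N × M[t, dt]`: the elements
`(l, n, m(t, dt))` with `h(l) = m(1)` and `g(n) = m(0)`. The maps below that are defined on all of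
`L × N × M[t, dt]` restrict to it. -/
def pathObject : Submodule K (PathAmbient L M N) where
  carrier := {z | h.toLin z.1 = TensorProduct.lid K M ((Polynomial.leval 1).rTensor M z.2.2.1) ∧
    g.toLin z.2.1 = TensorProduct.lid K M ((Polynomial.leval 0).rTensor M z.2.2.1)}
  add_mem' := by rintro x y ⟨h1, h2⟩ ⟨h3, h4⟩; simp [h1, h2, h3, h4]
  zero_mem' := by simp
  smul_mem' := by rintro a x ⟨h1, h2⟩; simp [h1, h2]

/-- The sign `(-1) ^ deg` on `L × N × M[t, dt]`. -/
def ambientSgn : PathAmbient L M N →ₗ[K] PathAmbient L M N :=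
  L.sgn.prodMap (N.sgn.prodMap ((M.sgn.lTensor K[X]).prodMap (-(M.sgn.lTensor K[X]))))

/-- The bracket of `L × N × M[t, dt]`; on the last factor
`[p + dt q, p' + dt q'] = [p, p'] + dt ([q, p'] + (-1) ^ deg(p) [p, q'])`. -/
def ambientBr : PathAmbient L M N →ₗ[K] PathAmbient L M N →ₗ[K] PathAmbient L M N :=
  LinearMap.mk₂ K (fun x y =>
    (L.br x.1 y.1, N.br x.2.1 y.2.1,
      LinearMap.BilinMap.baseChange K[X] M.br x.2.2.1 y.2.2.1,
      LinearMap.BilinMap.baseChange K[X] M.br x.2.2.2 y.2.2.1 +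
        LinearMap.BilinMap.baseChange K[X] M.br (M.sgn.lTensor K[X] x.2.2.1) y.2.2.2))
    (fun x x' y => by ext <;> simp; abel)
    (fun a x y => by ext <;> simp [LinearMap.map_smul_of_tower])
    (fun x y y' => by ext <;> simp; abel)
    (fun a x y => by ext <;> simp [LinearMap.map_smul_of_tower])

/-- `q₂(u ⊙ v) = (-1) ^ deg(u) [u, v]` on `H_(h,g)` -/
def ambientQ₂ : PathAmbient L M N →ₗ[K] PathAmbient L M N →ₗ[K] PathAmbient L M N :=
  ambientBr ∘ₗ ambientSgn

/-- `ι(l, n, m) = (l, n, (1 - t) g(n) + t h(l) + dt m)` -/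
def iota : (L × N × M) →ₗ[K] PathAmbient L M N :=
  (LinearMap.fst K _ _).prod (((LinearMap.fst K _ _) ∘ₗ LinearMap.snd K _ _).prod
    (((TensorProduct.mk K K[X] M (1 - Polynomial.X)) ∘ₗ g.toLin ∘ₗ
        (LinearMap.fst K _ _) ∘ₗ LinearMap.snd K _ _ +
      (TensorProduct.mk K K[X] M Polynomial.X) ∘ₗ h.toLin ∘ₗ LinearMap.fst K _ _).prod
      ((TensorProduct.mk K K[X] M 1) ∘ₗ (LinearMap.snd K _ _) ∘ₗ LinearMap.snd K _ _)))

/-- `π(l, n, m(t, dt)) = (l, n, ∫₀¹ m(t, dt))` -/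
def proj : PathAmbient L M N →ₗ[K] L × N × M :=
  LinearMap.prodMap LinearMap.id (LinearMap.prodMap LinearMap.id
    ((TensorProduct.lid K M).toLinearMap ∘ₗ
      (((Polynomial.leval 1) ∘ₗ antideriv K).rTensor M) ∘ₗ LinearMap.snd K _ _))

/-- `K(l, n, m(t, dt)) = (0, 0, t ∫₀¹ m(t, dt) - ∫₀ᵗ m(t, dt))` -/
def homotopyK : PathAmbient L M N →ₗ[K] PathAmbient L M N :=
  LinearMap.prodMap 0 (LinearMap.prodMap 0
    ((((homotopyPoly K).rTensor M) ∘ₗ LinearMap.snd K _ _).prod 0))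

theorem iota_mem (x : L × N × M) : iota h g x ∈ pathObject h g := by
  constructor <;> simp [iota]

theorem homotopyK_mem (z : PathAmbient L M N) : homotopyK z ∈ pathObject h g := by
  have h0 : ∀ f : K[X], (homotopyPoly K f).eval 1 = 0 ∧ (homotopyPoly K f).eval 0 = 0 := by
    intro f
    simp [homotopyPoly, antideriv, Polynomial.sum_def, Polynomial.eval_finsetSum,
      Polynomial.eval_monomial]
  have h1 : Polynomial.leval (1 : K) ∘ₗ homotopyPoly K = 0 :=
    LinearMap.ext fun f => (h0 f).1
  have h2 : Polynomial.leval (0 : K) ∘ₗ homotopyPoly K = 0 :=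
    LinearMap.ext fun f => (h0 f).2
  constructor
  · simp only [homotopyK, LinearMap.prodMap_apply, LinearMap.zero_apply, map_zero,
      LinearMap.prod_apply, Function.prod_apply, LinearMap.comp_apply]
    rw [← LinearMap.rTensor_comp_apply, h1]
    simp
  · simp only [homotopyK, LinearMap.prodMap_apply, LinearMap.zero_apply, map_zero,
      LinearMap.prod_apply, Function.prod_apply, LinearMap.comp_apply]
    rw [← LinearMap.rTensor_comp_apply, h2]
    simp

theorem ambientBr_mem {y z : PathAmbient L M N} (hy : y ∈ pathObject h g)
    (hz : z ∈ pathObject h g) : ambientBr y z ∈ pathObject h g := by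
  have key : ∀ (a : K) (p q : K[X] ⊗[K] M),
      TensorProduct.lid K M ((Polynomial.leval a).rTensor M
        (LinearMap.BilinMap.baseChange K[X] M.br p q)) =
      M.br (TensorProduct.lid K M ((Polynomial.leval a).rTensor M p))
        (TensorProduct.lid K M ((Polynomial.leval a).rTensor M q)) := by
    intro a p q
    induction p using TensorProduct.induction_on with
    | zero => simp
    | add p p' hp hp' => simp only [map_add, LinearMap.add_apply, hp, hp']
    | tmul r x =>
      induction q using TensorProduct.induction_on with
      | zero => simp
      | add p p' hp hp' => simp only [map_add, hp, hp']
      | tmul r' x' =>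
        simp only [LinearMap.BilinMap.baseChange_tmul, LinearMap.rTensor_tmul,
          TensorProduct.lid_tmul, Polynomial.leval_apply, Polynomial.eval_mul, map_smul,
          LinearMap.smul_apply, mul_smul]
        rw [smul_comm]
  refine ⟨Eq.trans ?_ (key 1 y.2.2.1 z.2.2.1).symm, Eq.trans ?_ (key 0 y.2.2.1 z.2.2.1).symm⟩
  · rw [← hy.1, ← hz.1]
    exact h.map_br _ _
  · rw [← hy.2, ← hz.2]
    exact g.map_br _ _

/-- `K q₂(ι(γ₀) ⊙ K q₂(ι(γ₁) ⊙ ⋯ K q₂(ι(γₙ₋₁) ⊙ ι(γₙ)) ⋯ ))` -/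
def nestedK : (n : ℕ) → MultilinearMap K (fun _ : Fin (n + 1) => L × N × M) (PathAmbient L M N)
  | 0 => (iota h g).compMultilinearMap
      (MultilinearMap.ofSubsingleton K (L × N × M) (L × N × M) (0 : Fin 1) LinearMap.id)
  | n + 1 => homotopyK.compMultilinearMap (consMultilinear (ambientQ₂ ∘ₗ iota h g) (nestedK n))

/-- `π q₂(ι(γ₀) ⊙ K q₂(ι(γ₁) ⊙ ⋯ K q₂(ι(γₙ) ⊙ ι(γₙ₊₁)) ⋯ ))` -/
def tree (n : ℕ) : MultilinearMap K (fun _ : Fin (n + 2) => L × N × M) (L × N × M) :=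
  proj.compMultilinearMap (consMultilinear (ambientQ₂ ∘ₗ iota h g) (nestedK h g n))

/-- The sign `(-1) ^ deg` on the cone `C ^ i = L ^ i ⊕ N ^ i ⊕ M ^ (i - 1)`. -/
def coneSgn : (L × N × M) →ₗ[K] L × N × M :=
  L.sgn.prodMap (N.sgn.prodMap (-M.sgn))

/-- The projection of the cone to its part of even (`e = 0`) or odd (`e = 1`) degree in `C[1]`. -/
def shiftedPart (e : Fin 2) : (L × N × M) →ₗ[K] L × N × M :=
  (2⁻¹ : K) • (LinearMap.id - (-1 : K) ^ (e : ℕ) • coneSgn)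

/-- The Koszul sign `ε(σ; v₀, …, vₙ₋₁)`, with `v₀ ⊙ ⋯ ⊙ vₙ₋₁ = ε v_σ(0) ⊙ ⋯ ⊙ v_σ(n-1)`, for
elements with parities `e i`. -/
def koszulSign {n : ℕ} (σ : Equiv.Perm (Fin n)) (e : Fin n → Fin 2) : ℤ :=
  ∏ i : Fin n, ∏ j : Fin n,
    if i < j ∧ σ j < σ i then (-1) ^ ((e (σ i) : ℕ) * (e (σ j) : ℕ)) else 1

/-- The multibracket of the cone with `n + 2` entries,
`(-1) ^ n / 2 * ∑_σ ε(σ) π q₂(ι(γ_σ(0)) ⊙ K q₂(ι(γ_σ(1)) ⊙ ⋯ K q₂(ι(γ_σ(n)) ⊙ ι(γ_σ(n+1))) ⋯ ))`,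
for homogeneous entries, extended by linearity. -/
def coneBracket (n : ℕ) : MultilinearMap K (fun _ : Fin (n + 2) => L × N × M) (L × N × M) :=
  ((-1 : K) ^ n / 2) • ∑ e : Fin (n + 2) → Fin 2, ∑ σ : Equiv.Perm (Fin (n + 2)),
    koszulSign σ e •
      ((tree h g n).compLinearMap fun i => shiftedPart (e (σ i))).domDomCongr σ

/-- The suspended mapping cone `C_(h,g)`, `C ^ i = L ^ i ⊕ N ^ i ⊕ M ^ (i - 1)`, with the `L∞`
structure transferred from `H_(h,g)` along `ι`, `π` and `K`. -/
def cone : LInftyData.{u, v} K where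
  carrier := L × N × M
  gr i := (L.gr i).prod ((N.gr i).prod (M.gr (i - 1)))
  sgn := coneSgn
  sgn_apply := by
    rintro i ⟨l, n, m⟩ ⟨hl, hn, hm⟩
    simp [coneSgn, L.sgn_apply hl, N.sgn_apply hn, M.sgn_apply hm, Int.negOnePow_sub]
  q₁ := (-(L.d ∘ₗ LinearMap.fst K _ _)).prod
    ((-(N.d ∘ₗ (LinearMap.fst K _ _) ∘ₗ LinearMap.snd K _ _)).prod
      (M.d ∘ₗ (LinearMap.snd K _ _) ∘ₗ LinearMap.snd K _ _ +
        g.toLin ∘ₗ (LinearMap.fst K _ _) ∘ₗ LinearMap.snd K _ _ -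
        h.toLin ∘ₗ LinearMap.fst K _ _))
  q := coneBracket h g

end Cone

/-! ### Functoriality -/

section Functoriality

variable {K : Type u} [Field K] {A B : ArtAlg.{u, w} K} (f : A ⟶ B)

/-- The underlying algebra map of a morphism. -/
abbrev ArtAlg.alg (f : A ⟶ B) : A.carrier →ₐ[K] B.carrier := f

theorem ArtAlg.exists_m_pow (A : ArtAlg.{u, w} K) : ∃ n, A.m ^ n = ⊥ := by
  obtain ⟨n, hn⟩ := IsArtinianRing.isNilpotent_jacobson_bot (R := A.carrier)
  rw [IsLocalRing.jacobson_eq_maximalIdeal _ bot_ne_top] at hn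
  exact ⟨n, hn⟩

theorem ArtAlg.map_m {a : A} (ha : a ∈ A.m) : ArtAlg.alg f a ∈ B.m := by
  obtain ⟨n, hn⟩ := A.exists_m_pow
  have h0 : a ^ n = 0 := by
    have := Ideal.pow_mem_pow ha n
    rw [hn] at this
    simpa using this
  have h1 : (ArtAlg.alg f a) ^ n = 0 := by rw [← map_pow, h0, map_zero]
  rw [IsLocalRing.mem_maximalIdeal, mem_nonunits_iff]
  intro hu
  exact not_isUnit_zero (h1 ▸ hu.pow n)

section Push

variable {V : Type v} [AddCommGroup V] [Module K V] {W : Type*} [AddCommGroup W] [Module K W]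

theorem push_tmul (a : A) (x : V) : ArtAlg.push f V (a ⊗ₜ x) = ArtAlg.alg f a ⊗ₜ x := rfl

theorem push_smul (a : A) (z : A ⊗[K] V) :
    ArtAlg.push f V (a • z) = ArtAlg.alg f a • ArtAlg.push f V z := by
  induction z using TensorProduct.induction_on with
  | zero => simp
  | tmul b x => simp [TensorProduct.smul_tmul', push_tmul]
  | add y z hy hz => simp [hy, hz]

theorem push_baseChange (ψ : V →ₗ[K] W) (z : A ⊗[K] V) :
    ArtAlg.push f W (ψ.baseChange A z) = ψ.baseChange B (ArtAlg.push f V z) := by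
  induction z using TensorProduct.induction_on with
  | zero => simp
  | tmul b x => simp [push_tmul]
  | add y z hy hz => simp [hy, hz]

theorem push_bilin (ψ : V →ₗ[K] V →ₗ[K] V) (y z : A ⊗[K] V) :
    ArtAlg.push f V (LinearMap.BilinMap.baseChange A ψ y z) =
      LinearMap.BilinMap.baseChange B ψ (ArtAlg.push f V y) (ArtAlg.push f V z) := by
  induction y using TensorProduct.induction_on with
  | zero => simp
  | add y y' hy hy' => simp [hy, hy']
  | tmul a x =>
    induction z using TensorProduct.induction_on with
    | zero => simp
    | tmul b x => simp [push_tmul]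
    | add y z hy hz => simp [hy, hz]

theorem extend_succ (n : ℕ) (ψ : MultilinearMap K (fun _ : Fin (n + 1) => V) V)
    (z : Fin (n + 1) → A ⊗[K] V) :
    extend A (n + 1) ψ z =
      LinearMap.liftBaseChange A ((extend A n).comp ψ.curryLeft) (z 0) (Fin.tail z) := rfl

theorem push_extend (n : ℕ) (ψ : MultilinearMap K (fun _ : Fin n => V) V)
    (z : Fin n → A ⊗[K] V) :
    ArtAlg.push f V (extend A n ψ z) = extend B n ψ (fun i => ArtAlg.push f V (z i)) := by
  induction n with
  | zero =>
    change ArtAlg.push f V (1 ⊗ₜ ψ 0) = 1 ⊗ₜ ψ 0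
    rw [push_tmul, map_one]
  | succ n ih =>
    rw [extend_succ, extend_succ]
    change _ = (LinearMap.liftBaseChange B ((extend B n).comp ψ.curryLeft))
      (ArtAlg.push f V (z 0)) (fun i => ArtAlg.push f V (Fin.tail z i))
    generalize z 0 = y
    induction y using TensorProduct.induction_on with
    | zero => simp
    | tmul a x => simp [push_tmul, push_smul, ih]
    | add y y' hy hy' => simp [hy, hy']

theorem push_mem_coeffPart {S : Submodule K V} {z : A ⊗[K] V} (hz : z ∈ coeffPart A A.m S) :
    ArtAlg.push f V z ∈ coeffPart B B.m S := by
  have hle : coeffPart A A.m S ≤ (coeffPart B B.m S).comap (ArtAlg.push f V) :=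
    Submodule.map₂_le.2 fun a ha x hx =>
      Submodule.apply_mem_map₂ _ (ArtAlg.map_m f ha) hx
  exact hle hz

theorem coeffPart_mono {I J : Ideal A} {S S' : Submodule K V} (hI : I ≤ J) (hS : S ≤ S') :
    coeffPart A I S ≤ coeffPart A J S' :=
  Submodule.map₂_le_map₂ hI hS

theorem coeffPart_bot (S : Submodule K V) : coeffPart A.carrier ⊥ S = ⊥ := by
  rw [eq_bot_iff]
  refine Submodule.map₂_le.2 fun a ha x hx => ?_
  have : a = 0 := by simpa using ha
  simp [this]

theorem baseChange_mem_coeffPart (ψ : V →ₗ[K] W) {I : Ideal A} {S : Submodule K V}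
    {z : A ⊗[K] V} (hz : z ∈ coeffPart A I S) : ψ.baseChange A z ∈ coeffPart A I ⊤ := by
  have hle : coeffPart A I S ≤ (coeffPart A I ⊤).comap ((ψ.baseChange A).restrictScalars K) :=
    Submodule.map₂_le.2 fun a ha x hx =>
      Submodule.apply_mem_map₂ (TensorProduct.mk K A.carrier W) ha trivial
  exact hle hz

theorem smul_mem_coeffPart {I J : Ideal A} {S : Submodule K V} {a : A} (ha : a ∈ I)
    {z : A ⊗[K] V} (hz : z ∈ coeffPart A J S) : a • z ∈ coeffPart A (I * J) S := by
  have hle : coeffPart A J S ≤ (coeffPart A (I * J) S).comap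
      ((LinearMap.lsmul A (A ⊗[K] V) a).restrictScalars K) :=
    Submodule.map₂_le.2 fun b hb x hx => by
      have := Submodule.apply_mem_map₂ (TensorProduct.mk K A.carrier V)
        (p := (I * J).restrictScalars K) (Ideal.mul_mem_mul ha hb) hx
      exact this
  exact hle hz

theorem bilin_tmul_left (ψ : V →ₗ[K] V →ₗ[K] V) (a : A) (x : V) (z : A ⊗[K] V) :
    LinearMap.BilinMap.baseChange A ψ (a ⊗ₜ x) z = a • (ψ x).baseChange A z := by
  induction z using TensorProduct.induction_on with
  | zero => simp
  | tmul b x => simp [TensorProduct.smul_tmul']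
  | add y z hy hz => rw [map_add, map_add, smul_add, hy, hz]

theorem bilin_mem_coeffPart (ψ : V →ₗ[K] V →ₗ[K] V) {I J : Ideal A} {S S' : Submodule K V}
    {y z : A ⊗[K] V} (hy : y ∈ coeffPart A I S) (hz : z ∈ coeffPart A J S') :
    LinearMap.BilinMap.baseChange A ψ y z ∈ coeffPart A (I * J) ⊤ := by
  have hle : coeffPart A I S ≤ (coeffPart A (I * J) ⊤).comap
      (((LinearMap.BilinMap.baseChange A ψ).flip z).restrictScalars K) :=
    Submodule.map₂_le.2 fun a ha x hx => by
      have h2 := smul_mem_coeffPart ha (baseChange_mem_coeffPart (ψ x) hz)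
      have h3 := bilin_tmul_left ψ a x z
      simpa [h3] using h2
  exact hle hy

theorem extend_mem_coeffPart (n : ℕ) (ψ : MultilinearMap K (fun _ : Fin n => V) V)
    {I : Ideal A} {S : Submodule K V} {z : Fin n → A ⊗[K] V} (hz : ∀ i, z i ∈ coeffPart A I S) :
    extend A n ψ z ∈ coeffPart A (I ^ n) ⊤ := by
  induction n with
  | zero =>
    exact Submodule.apply_mem_map₂ (TensorProduct.mk K A.carrier V)
      (p := (I ^ 0).restrictScalars K) (by simp) trivial
  | succ n ih =>
    rw [extend_succ]
    have hle : coeffPart A I S ≤ (coeffPart A (I ^ (n + 1)) ⊤).comap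
        (({ toFun := fun y =>
              LinearMap.liftBaseChange A ((extend A n).comp ψ.curryLeft) y (Fin.tail z)
            map_add' := fun y y' => by simp
            map_smul' := fun a y => by simp } :
            A ⊗[K] V →ₗ[A] A ⊗[K] V).restrictScalars K) :=
      Submodule.map₂_le.2 fun a ha x hx => by
        have h2 := smul_mem_coeffPart ha (ih (ψ.curryLeft x) (z := Fin.tail z) fun i => hz i.succ)
        rw [← pow_succ'] at h2
        simpa using h2
    exact hle (hz 0)

end Push

theorem part_filt {L : DGLA.{u, v} K} {i : ℤ} {x : A ⊗[K] L} (hx : x ∈ L.part A i) :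
    x ∈ coeffPart A (A.m ^ 1) (⊤ : Submodule K L) :=
  coeffPart_mono (by simp) le_top hx

theorem eq_zero_of_filt {V : Type v} [AddCommGroup V] [Module K V] {k n : ℕ}
    (hn : A.m ^ n = ⊥) (hk : n ≤ k) {z : A ⊗[K] V} (hz : z ∈ coeffPart A (A.m ^ k) ⊤) :
    z = 0 := by
  have h := coeffPart_mono (S := (⊤ : Submodule K V)) (S' := ⊤)
    (show A.m ^ k ≤ ⊥ from hn ▸ Ideal.pow_le_pow_right hk) le_rfl hz
  rw [coeffPart_bot] at h
  simpa using h

theorem push_finsum {V : Type v} [AddCommGroup V] [Module K V] {ι : Type*}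
    {F : ι → A ⊗[K] V} (hF : F.support.Finite) :
    ArtAlg.push f V (∑ᶠ i, F i) = ∑ᶠ i, ArtAlg.push f V (F i) :=
  (ArtAlg.push f V).toAddMonoidHom.map_finsum hF

namespace LInftyData

variable (T : LInftyData.{u, v} K)

theorem push_curvature {γ : A ⊗[K] T} (hγ : γ ∈ coeffPart A A.m (T.gr 1)) :
    ArtAlg.push f T (T.curvature A γ) = T.curvature B (ArtAlg.push f T γ) := by
  obtain ⟨N, hN⟩ := A.exists_m_pow
  have hfin : (fun n : ℕ => ((n + 2).factorial : K)⁻¹ •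
      extend A (n + 2) (T.q n) (fun _ => γ)).support.Finite := by
    refine (Set.finite_lt_nat N).subset fun n hn => ?_
    by_contra hlt
    refine hn ?_
    have := eq_zero_of_filt (k := n + 2) hN (by simp at hlt; omega)
      (extend_mem_coeffPart (n + 2) (T.q n) (z := fun _ => γ) (fun _ => hγ))
    simp [this]
  rw [curvature, curvature, map_add, push_finsum f hfin, push_baseChange]
  congr 1
  refine finsum_congr fun n => ?_
  rw [map_smul, push_extend]

/-- The map `MC^∞_T(A) → MC^∞_T(B)`. -/
def MC.map (γ : T.MC A) : T.MC B :=
  ⟨ArtAlg.push f T γ.1, push_mem_coeffPart f γ.2.1, by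
    rw [← push_curvature f T γ.2.1, γ.2.2, map_zero]⟩

theorem Homotopic.map {γ₀ γ₁ : T.MC A} (H : T.Homotopic A γ₀ γ₁) :
    T.Homotopic B (MC.map f T γ₀) (MC.map f T γ₁) := by
  obtain ⟨Γ, h0, h1⟩ := H
  exact ⟨MC.map f T.path Γ,
    (push_baseChange f (T.evalPath 0) Γ.1).symm.trans (congrArg _ h0),
    (push_baseChange f (T.evalPath 1) Γ.1).symm.trans (congrArg _ h1)⟩

end LInftyData

theorem push_id {V : Type v} [AddCommGroup V] [Module K V] (z : A ⊗[K] V) :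
    ArtAlg.push (𝟙 A) V z = z :=
  LinearMap.rTensor_id_apply V A.carrier z

theorem push_comp {C : ArtAlg.{u, w} K} (f : A ⟶ B) (f' : B ⟶ C) {V : Type v} [AddCommGroup V]
    [Module K V] (z : A ⊗[K] V) :
    ArtAlg.push (f ≫ f') V z = ArtAlg.push f' V (ArtAlg.push f V z) :=
  LinearMap.rTensor_comp_apply V (ArtAlg.alg f').toLinearMap (ArtAlg.alg f).toLinearMap z

namespace DGLA

variable (L : DGLA.{u, v} K)

theorem push_dA (x : A ⊗[K] L) : ArtAlg.push f L (L.dA A x) = L.dA B (ArtAlg.push f L x) :=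
  push_baseChange f L.d x

theorem push_brA (x y : A ⊗[K] L) : ArtAlg.push f L (L.brA A x y) =
    L.brA B (ArtAlg.push f L x) (ArtAlg.push f L y) :=
  push_bilin f L.br x y

theorem brA_filt {m n : ℕ} {x y : A ⊗[K] L} (hx : x ∈ coeffPart A (A.m ^ m) (⊤ : Submodule K L))
    (hy : y ∈ coeffPart A (A.m ^ n) (⊤ : Submodule K L)) :
    L.brA A x y ∈ coeffPart A (A.m ^ (m + n)) (⊤ : Submodule K L) := by
  rw [pow_add]
  exact bilin_mem_coeffPart L.br hx hy

theorem dA_filt {m : ℕ} {x : A ⊗[K] L} (hx : x ∈ coeffPart A (A.m ^ m) (⊤ : Submodule K L)) :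
    L.dA A x ∈ coeffPart A (A.m ^ m) (⊤ : Submodule K L) :=
  baseChange_mem_coeffPart L.d hx

theorem iterate_brA_filt {a z : A ⊗[K] L}
    (ha : a ∈ coeffPart A (A.m ^ 1) (⊤ : Submodule K L)) (n : ℕ) :
    (L.brA A a)^[n] z ∈ coeffPart A (A.m ^ n) (⊤ : Submodule K L) := by
  induction n with
  | zero =>
    have hle : (⊤ : Submodule K (A ⊗[K] L)) ≤ coeffPart A (A.m ^ 0) (⊤ : Submodule K L) := by
      rw [← TensorProduct.map₂_mk_top_top_eq_top]
      exact Submodule.map₂_le_map₂ (by simp) le_rfl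
    exact hle trivial
  | succ n ih =>
    rw [Function.iterate_succ_apply', add_comm]
    exact L.brA_filt ha ih

theorem push_iterate (a z : A ⊗[K] L) (n : ℕ) : ArtAlg.push f L ((L.brA A a)^[n] z) =
    (L.brA B (ArtAlg.push f L a))^[n] (ArtAlg.push f L z) := by
  induction n with
  | zero => rfl
  | succ n ih => rw [Function.iterate_succ_apply', Function.iterate_succ_apply', push_brA, ih]

theorem push_gaugeA {a : A ⊗[K] L} (x : A ⊗[K] L)
    (ha : a ∈ coeffPart A (A.m ^ 1) (⊤ : Submodule K L)) :
    ArtAlg.push f L (L.gaugeA A a x) =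
      L.gaugeA B (ArtAlg.push f L a) (ArtAlg.push f L x) := by
  obtain ⟨N, hN⟩ := A.exists_m_pow
  rw [gaugeA, gaugeA, gauge, gauge, map_add, push_finsum f]
  · congr 1
    refine finsum_congr fun n => ?_
    rw [map_smul, push_iterate, map_sub, push_brA, push_dA]
  · refine (Set.finite_lt_nat N).subset fun n hn => ?_
    by_contra hlt
    refine hn ?_
    have := eq_zero_of_filt hN (not_lt.1 hlt)
      (L.iterate_brA_filt (z := L.brA A a x - L.dA A a) ha n)
    simp [this]

theorem nestedBracket_filt (l : List (A ⊗[K] L))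
    (hl : ∀ x ∈ l, x ∈ coeffPart A (A.m ^ 1) (⊤ : Submodule K L)) :
    nestedBracket (L.brA A) l ∈ coeffPart A (A.m ^ l.length) (⊤ : Submodule K L) := by
  match l with
  | [] => exact Submodule.zero_mem _
  | [x] => simpa [nestedBracket] using hl x (by simp)
  | x :: y :: l =>
    have := nestedBracket_filt (y :: l) fun z hz => hl z (List.mem_cons_of_mem _ hz)
    rw [nestedBracket, List.length_cons, add_comm]
    exact L.brA_filt (hl x (by simp)) this

theorem push_nestedBracket (l : List (A ⊗[K] L)) :
    ArtAlg.push f L (nestedBracket (L.brA A) l) =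
      nestedBracket (L.brA B) (l.map (ArtAlg.push f L)) := by
  match l with
  | [] => simp [nestedBracket]
  | [x] => simp [nestedBracket]
  | x :: y :: l =>
    have := push_nestedBracket (y :: l)
    rw [List.map_cons, List.map_cons, nestedBracket, nestedBracket, push_brA, this, List.map_cons]

theorem length_bchWord {V : Type*} (x y : V) (w : List (ℕ × ℕ)) :
    (bchWord x y w).length = (w.map fun e => e.1 + e.2).sum := by
  simp [bchWord, List.length_flatMap]

theorem finite_bch (N : ℕ) :
    {w : List (ℕ × ℕ) | (0, 0) ∉ w ∧ (w.map fun e => e.1 + e.2).sum < N}.Finite := by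
  have hfin : ((fun l : List (Fin N × Fin N) => l.map fun e => ((e.1 : ℕ), (e.2 : ℕ))) ''
      {l | l.length < N}).Finite := (List.finite_length_lt _ N).image _
  refine hfin.subset ?_
  rintro w ⟨h0, hs⟩
  have hlen : w.length ≤ (w.map fun e => e.1 + e.2).sum := by
    have := List.card_nsmul_le_sum (w.map fun e => e.1 + e.2) 1 (by
      intro k hk
      obtain ⟨⟨r, s⟩, he, rfl⟩ := List.mem_map.1 hk
      by_contra hlt
      have : r = 0 ∧ s = 0 := by simp at hlt; omega
      rw [this.1, this.2] at he
      exact h0 he)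
    simpa using this
  have hlt : ∀ e ∈ w, e.1 < N ∧ e.2 < N := fun e he => by
    have := List.single_le_sum (l := w.map fun e => e.1 + e.2) (by simp) _
      (List.mem_map_of_mem he)
    omega
  refine ⟨w.attach.map fun e => (⟨e.1.1, (hlt e.1 e.2).1⟩, ⟨e.1.2, (hlt e.1 e.2).2⟩), ?_, ?_⟩
  · simp; omega
  · refine (List.map_map ..).trans ?_
    exact w.attach_map_subtype_val

theorem push_mulA {x y : A ⊗[K] L} (hx : x ∈ coeffPart A (A.m ^ 1) (⊤ : Submodule K L))
    (hy : y ∈ coeffPart A (A.m ^ 1) (⊤ : Submodule K L)) :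
    ArtAlg.push f L (L.mulA A x y) = L.mulA B (ArtAlg.push f L x) (ArtAlg.push f L y) := by
  obtain ⟨N, hN⟩ := A.exists_m_pow
  have hmem : ∀ w, ∀ z ∈ bchWord x y w, z ∈ coeffPart A (A.m ^ 1) (⊤ : Submodule K L) := by
    intro w z hz
    simp only [bchWord, List.mem_flatMap, List.mem_append, List.mem_replicate] at hz
    obtain ⟨e, -, ⟨-, rfl⟩ | ⟨-, rfl⟩⟩ := hz
    exacts [hx, hy]
  rw [mulA, mulA, bch, bch, push_finsum f]
  · refine finsum_congr fun w => ?_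
    rw [map_smul, push_nestedBracket]
    simp [bchWord, List.map_flatMap]
  · refine (finite_bch N).subset fun w hw => ?_
    have hc : bchCoeff K w ≠ 0 := fun hc => hw (by simp [hc])
    refine ⟨fun h0 => hc (by simp [bchCoeff, h0]), ?_⟩
    by_contra hlt
    refine hw ?_
    have := eq_zero_of_filt hN (by rw [length_bchWord]; exact not_lt.1 hlt)
      (L.nestedBracket_filt (bchWord x y w) (hmem w))
    simp [this]

theorem mulA_filt {x y : A ⊗[K] L} (hx : x ∈ coeffPart A (A.m ^ 1) (⊤ : Submodule K L))
    (hy : y ∈ coeffPart A (A.m ^ 1) (⊤ : Submodule K L)) :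
    L.mulA A x y ∈ coeffPart A (A.m ^ 1) (⊤ : Submodule K L) := by
  refine finsum_induction (· ∈ coeffPart A (A.m ^ 1) (⊤ : Submodule K L))
    (Submodule.zero_mem _) (fun _ _ => Submodule.add_mem _) fun w => ?_
  refine Submodule.smul_mem _ _ ?_
  have hmem : ∀ z ∈ bchWord x y w, z ∈ coeffPart A (A.m ^ 1) (⊤ : Submodule K L) := by
    intro z hz
    simp only [bchWord, List.mem_flatMap, List.mem_append, List.mem_replicate] at hz
    obtain ⟨e, -, ⟨-, rfl⟩ | ⟨-, rfl⟩⟩ := hz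
    exacts [hx, hy]
  have h := L.nestedBracket_filt (bchWord x y w) hmem
  rcases hl : bchWord x y w with _ | ⟨z, l⟩
  · exact Submodule.zero_mem _
  · rw [hl] at h
    exact coeffPart_mono (Ideal.pow_le_pow_right (by simp)) le_rfl h

theorem IsMC.map {x : A ⊗[K] L} (hx : L.IsMC A x) : L.IsMC B (ArtAlg.push f L x) :=
  ⟨push_mem_coeffPart f hx.1, by
    rw [← push_dA, ← push_brA, ← map_smul, ← map_add, hx.2, map_zero]⟩

end DGLA

section PairMap

variable {L M N : DGLA.{u, v} K} (h : DGLAHom L M) (g : DGLAHom N M)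

theorem push_mapA (x : A ⊗[K] L) :
    ArtAlg.push f M (h.mapA A x) = h.mapA B (ArtAlg.push f L x) :=
  push_baseChange f h.toLin x

theorem mapA_filt {x : A ⊗[K] L} (hx : x ∈ coeffPart A (A.m ^ 1) (⊤ : Submodule K L)) :
    h.mapA A x ∈ coeffPart A (A.m ^ 1) (⊤ : Submodule K M) :=
  baseChange_mem_coeffPart h.toLin hx

/-- The map `MC_(h,g)(A) → MC_(h,g)(B)`. -/
def MCPair.map (z : MCPair h g A) : MCPair h g B :=
  ⟨(ArtAlg.push f L z.1.1, ArtAlg.push f N z.1.2.1, ArtAlg.push f M z.1.2.2),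
    z.2.1.map f L, z.2.2.1.map f N, push_mem_coeffPart f z.2.2.2.1, by
      rw [← push_mapA, ← push_mapA, z.2.2.2.2, DGLA.push_gaugeA f M _ (part_filt z.2.2.2.1)]⟩

theorem GaugeEquiv.map {z₁ z₂ : MCPair h g A} (H : GaugeEquiv h g A z₁ z₂) :
    GaugeEquiv h g B (MCPair.map f h g z₁) (MCPair.map f h g z₂) := by
  obtain ⟨a, ha, b, hb, c, hc, h1, h2, h3⟩ := H
  refine ⟨_, push_mem_coeffPart f ha, _, push_mem_coeffPart f hb, _, push_mem_coeffPart f hc,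
    ?_, ?_, ?_⟩
  · simp only [MCPair.map]
    rw [h1, DGLA.push_gaugeA f L _ (part_filt ha)]
  · simp only [MCPair.map]
    rw [h2, DGLA.push_gaugeA f N _ (part_filt hb)]
  · simp only [MCPair.map]
    have hgb := mapA_filt g (part_filt hb)
    have hT : M.dA A c + M.brA A (g.mapA A z₁.1.2.1) c ∈
        coeffPart A (A.m ^ 1) (⊤ : Submodule K M) :=
      Submodule.add_mem _ (M.dA_filt (part_filt hc))
        (coeffPart_mono (Ideal.pow_le_pow_right (by simp)) le_rfl
          (M.brA_filt (mapA_filt g (part_filt z₁.2.2.1.1)) (part_filt hc)))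
    have hp := part_filt z₁.2.2.2.1
    have hha := Submodule.neg_mem _ (mapA_filt h (part_filt ha))
    rw [h3, M.push_mulA f (M.mulA_filt (M.mulA_filt hgb hT) hp) hha,
      M.push_mulA f (M.mulA_filt hgb hT) hp, M.push_mulA f hgb hT, map_add, M.push_dA, M.push_brA,
      map_neg, push_mapA, push_mapA, push_mapA]

end PairMap

end Functoriality

/-! ### The functors -/

section Functors

variable {K : Type u} [Field K]

/-- The Maurer-Cartan functor `MC^∞_T : Art → Set`. -/
def LInftyData.MCFunctor (T : LInftyData.{u, v} K) : ArtAlg.{u, w} K ⥤ Type (max v w) where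
  obj A := T.MC A
  map f := ↾(LInftyData.MC.map f T)
  map_id A := ConcreteCategory.hom_ext _ _ fun γ => Subtype.ext (push_id γ.1)
  map_comp f f' := ConcreteCategory.hom_ext _ _ fun γ => Subtype.ext (push_comp f f' γ.1)

/-- The deformation functor `Def^∞_T = MC^∞_T / homotopy`. -/
def LInftyData.Def (T : LInftyData.{u, v} K) : ArtAlg.{u, w} K ⥤ Type (max v w) where
  obj A := Quot (T.Homotopic A)
  map f := ↾(Quot.map (LInftyData.MC.map f T) fun _ _ H => H.map f T)
  map_id _ := by
    ext γ
    induction γ using Quot.ind with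
    | mk γ => exact congrArg (Quot.mk _) (Subtype.ext (push_id γ.1))
  map_comp f f' := by
    ext γ
    induction γ using Quot.ind with
    | mk γ => exact congrArg (Quot.mk _) (Subtype.ext (push_comp f f' γ.1))

variable {L M N : DGLA.{u, v} K} (h : DGLAHom L M) (g : DGLAHom N M)

/-- The Maurer-Cartan functor `MC_(h,g) : Art → Set`. -/
def MCPairFunctor : ArtAlg.{u, w} K ⥤ Type (max v w) where
  obj A := MCPair h g A
  map f := ↾(MCPair.map f h g)
  map_id A := ConcreteCategory.hom_ext _ _ fun z =>
    Subtype.ext (Prod.ext (push_id z.1.1) (Prod.ext (push_id z.1.2.1) (push_id z.1.2.2)))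
  map_comp f f' := ConcreteCategory.hom_ext _ _ fun z =>
    Subtype.ext (Prod.ext (push_comp f f' z.1.1)
      (Prod.ext (push_comp f f' z.1.2.1) (push_comp f f' z.1.2.2)))

/-- The deformation functor `Def_(h,g) = MC_(h,g) / gauge`. -/
def DefPair : ArtAlg.{u, w} K ⥤ Type (max v w) where
  obj A := Quot (GaugeEquiv h g A)
  map f := ↾(Quot.map (MCPair.map f h g) fun _ _ H => H.map f h g)
  map_id _ := by
    ext z
    induction z using Quot.ind with
    | mk z =>
      exact congrArg (Quot.mk _) (Subtype.ext
        (Prod.ext (push_id z.1.1) (Prod.ext (push_id z.1.2.1) (push_id z.1.2.2))))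
  map_comp f f' := by
    ext z
    induction z using Quot.ind with
    | mk z =>
      exact congrArg (Quot.mk _) (Subtype.ext (Prod.ext (push_comp f f' z.1.1)
        (Prod.ext (push_comp f f' z.1.2.1) (push_comp f f' z.1.2.2))))

/-- The components `(l, n, m)` of an element of `C_(h,g) ⊗ A`. -/
def components (A : ArtAlg.{u, w} K) (γ : A ⊗[K] (cone h g)) :
    (A ⊗[K] L) × (A ⊗[K] N) × (A ⊗[K] M) :=
  ((LinearMap.fst K L (N × M)).baseChange A γ,
    ((LinearMap.fst K N M) ∘ₗ (LinearMap.snd K L (N × M))).baseChange A γ,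
    ((LinearMap.snd K N M) ∘ₗ (LinearMap.snd K L (N × M))).baseChange A γ)

end Functors

end ConeDef
end

/-!
The theorem compares two descriptions of the homotopy fibre product of `h` and `g`: one by the
transferred `L∞` structure on the cone, one by the gauge action. Everything takes place in the
nilpotent algebras `L ⊗ A`, `M ⊗ A`, `N ⊗ A` (`DGLA.nil`), where all series are finite.

For `γ = (x, y, m) ∈ C¹ ⊗ m_A` all entries of the brackets are even in `C[1]`, so the
symmetrisation in the `n`-th bracket only cancels a factorial, and the curvature is a sum over the
trees `q₂(ιγ ⊙ κ q₂(ιγ ⊙ ⋯))`. The components in `L` and `N` are those of the Maurer-Cartan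
equations of `x` and `y`. In the component in `M` the trees are the iterates of
`p ↦ κ [m, p]` on `(1 - t) g(y) + t h(x)` (`ambQ_preTree`). Their sum `P` is the solution of the
differential equation `P' = c - [m, P]` with `P(0) = g(y)` and `P(1) = h(x)`, for a certain constant
`c`, and the curvature vanishes if and only if `c = d m`. On the other hand the solution of this
equation with `c = d m` transports `P(1)` to `e ^ m * P(1)`; hence the curvature vanishes if and
only if `g(y) = e ^ m * h(x)` (`integral_iterP_eq_zero_iff`, `cone_curvature_iff`). So the
Maurer-Cartan elements on both sides are the same triples.

A Maurer-Cartan element `P(s) + Q(s) ds` of `C[s, ds]` consists of Maurer-Cartan elements `P(s)`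
together with a linear equation for `P'(s)`, the first variation of the curvature at `P(s)` in the
direction `Q(s)` (`LInftyData.path_curvature_iff`). The same computation, applied to the operator
`(v, w) ↦ ([m, v], [m, w] - [c, v])` instead of `[m, -]`, identifies these paths with the
Maurer-Cartan triples of the pair over `K[s, ds]`, called `PathMC`. It remains to see that the
endpoints of such paths are exactly the gauge equivalent triples.

* Given a path, `x + a ds` and `y + b ds` are gauge transforms of constants by paths `α` and `β`
  starting at zero (`NilDGLA.exists_gauge_path`). Comparing the transports in `M`, one finds a path
  in the group which stabilises `g(y(0))`; being unipotent, its logarithm `u₀ + u₁ ds` annihilates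
  `g(y(0))` in the affine action, and integrating the `ds`-component of this equation gives
  `u₀(1) = d c + [g(y(0)), c]` (`PathMC.gaugeEquiv`).
* Conversely, the gauge transformations by `s a`, `s b` and `s T - c ds` form a path from a triple
  to a gauge equivalent one (`exists_pathMC`).

Both steps use that the Baker-Campbell-Hausdorff product in Dynkin's form computes the product of
exponentials in every nilpotent representation (`NilpotentRep.nexp_bch`). This is applied to the
affine action of the degree zero part of `M[s, ds]` on `M[s, ds] × K` that defines the gauge action;
it is faithful on paths starting at zero, which also yields the group laws.
-/

set_option linter.unusedSectionVars false

noncomputable section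

namespace ConeDef

/-! ### Exponentials and logarithms of nilpotent elements -/

section NilpotentExp

variable (K : Type u) [Field K] {U : Type*} [Ring U] [Algebra K U]

/-- The exponential `∑ᵢ aⁱ / i!` of a nilpotent element of a `K`-algebra; it has no meaning for
other elements. -/
def nexp (a : U) : U := ∑ᶠ i : ℕ, (i.factorial : K)⁻¹ • a ^ i

/-- The truncation below degree `n` of the exponential series. -/
def expPoly (n : ℕ) : K[X] := ∑ i ∈ Finset.range n, Polynomial.C (i.factorial : K)⁻¹ *
    Polynomial.X ^ i

/-- The truncation of the series of `log (1 + X)` to its first `n` nonzero terms. -/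
def logPoly (n : ℕ) : K[X] :=
  ∑ i ∈ Finset.range n, Polynomial.C ((-1) ^ i / ((i : K) + 1)) * Polynomial.X ^ (i + 1)

theorem nexp_eq_sum {a : U} {n : ℕ} (h : a ^ n = 0) :
    nexp K a = ∑ i ∈ Finset.range n, (i.factorial : K)⁻¹ • a ^ i := by
  refine finsum_eq_sum_of_support_subset _ fun i hi => ?_
  by_contra hlt
  refine hi ?_
  simp only [Finset.coe_range, Set.mem_Iio, not_lt] at hlt
  simp [pow_eq_zero_of_le hlt h]

theorem nexp_eq_aeval {a : U} {n : ℕ} (h : a ^ n = 0) :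
    nexp K a = Polynomial.aeval a (expPoly K n) := by
  rw [nexp_eq_sum K h, expPoly, map_sum]
  refine Finset.sum_congr rfl fun i _ => ?_
  rw [← Polynomial.smul_eq_C_mul, map_smul, map_pow, Polynomial.aeval_X]

theorem nexp_zero : nexp K (0 : U) = 1 := by
  rw [nexp_eq_sum K (n := 1) (by simp)]
  simp

theorem aeval_eq_of_X_pow_dvd {p q : K[X]} {n : ℕ} (h : Polynomial.X ^ n ∣ p - q) {a : U}
    (ha : a ^ n = 0) : Polynomial.aeval a p = Polynomial.aeval a q := by
  obtain ⟨r, hr⟩ := h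
  rw [← sub_eq_zero, ← map_sub, hr, map_mul, map_pow, Polynomial.aeval_X, ha, zero_mul]

theorem map_nexp {U' : Type*} [Ring U'] [Algebra K U'] (f : U →ₐ[K] U') {a : U}
    (ha : IsNilpotent a) : f (nexp K a) = nexp K (f a) := by
  obtain ⟨n, hn⟩ := ha
  rw [nexp_eq_sum K hn, nexp_eq_sum K (a := f a) (n := n)
      (by rw [← map_pow, hn, map_zero]), map_sum]
  simp

theorem X_dvd_expPoly_sub_one (n : ℕ) : Polynomial.X ∣ expPoly K (n + 1) - 1 := by
  rw [expPoly, Finset.sum_range_succ']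
  simp only [Nat.factorial_zero, Nat.cast_one, inv_one, map_one, pow_zero, mul_one,
      add_sub_cancel_right]
  exact Finset.dvd_sum fun i _ => Dvd.dvd.mul_left (dvd_pow_self _ (by simp)) _

/-- `log (1 + ν)` for `νⁿ = 0`, the bound being part of the notation. -/
def nlog (n : ℕ) (ν : U) : U := Polynomial.aeval ν (logPoly K n)

theorem nlog_pow {ν : U} {n : ℕ} (hν : ν ^ n = 0) (k : ℕ) : nlog K k ν ^ n = 0 := by
  obtain ⟨q, hq⟩ : (Polynomial.X : K[X]) ∣ logPoly K k :=
    Finset.dvd_sum fun i _ => Dvd.dvd.mul_left (dvd_pow_self _ (by simp)) _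
  have : (logPoly K k) ^ n = Polynomial.X ^ n * q ^ n := by rw [hq, mul_pow]
  rw [nlog, ← map_pow, this, map_mul, map_pow, Polynomial.aeval_X, hν, zero_mul]

variable [CharZero K]

theorem nexp_add_of_commute {a b : U} (hab : Commute a b) (ha : IsNilpotent a)
    (hb : IsNilpotent b) : nexp K (a + b) = nexp K a * nexp K b := by
  let _ : Module ℚ U := Module.compHom U (algebraMap ℚ K)
  have key : ∀ a : U, IsNilpotent a → nexp K a = IsNilpotent.exp a := by
    rintro a ⟨n, hn⟩
    rw [nexp_eq_sum K hn, IsNilpotent.exp_eq_sum hn]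
    refine Finset.sum_congr rfl fun i _ => ?_
    change _ = (algebraMap ℚ K (i.factorial : ℚ)⁻¹) • a ^ i
    simp
  rw [key _ ha, key _ hb, key _ (hab.isNilpotent_add ha hb),
      IsNilpotent.exp_add_of_commute hab ha hb]

theorem nexp_mul_nexp_neg {a : U} (ha : IsNilpotent a) : nexp K a * nexp K (-a) = 1 := by
  rw [← nexp_add_of_commute K (Commute.neg_right rfl) ha ha.neg, add_neg_cancel, nexp_zero]

theorem nexp_neg_mul_nexp {a : U} (ha : IsNilpotent a) : nexp K (-a) * nexp K a = 1 := by
  rw [← nexp_add_of_commute K (Commute.neg_left rfl) ha.neg ha, neg_add_cancel, nexp_zero]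

theorem derivative_expPoly (n : ℕ) : Polynomial.derivative (expPoly K (n + 1)) = expPoly K n := by
  rw [expPoly, Finset.sum_range_succ', map_add, map_sum, expPoly]
  simp only [Nat.factorial_zero, pow_zero, mul_one, Polynomial.derivative_C, add_zero]
  refine Finset.sum_congr rfl fun i _ => ?_
  rw [Polynomial.derivative_C_mul_X_pow, Nat.factorial_succ, Nat.add_sub_cancel]
  congr 2
  have h1 : ((i : K) + 1) ≠ 0 := by exact_mod_cast i.succ_ne_zero
  have h2 : ((i.factorial : ℕ) : K) ≠ 0 := by exact_mod_cast i.factorial_ne_zero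
  push_cast
  field_simp

theorem derivative_logPoly (n : ℕ) :
    Polynomial.derivative (logPoly K n) * (1 + Polynomial.X) = 1 - (-Polynomial.X) ^ n := by
  have : Polynomial.derivative (logPoly K n) = ∑ i ∈ Finset.range n,
      (-Polynomial.X : K[X]) ^ i := by
    rw [logPoly, map_sum]
    refine Finset.sum_congr rfl fun i _ => ?_
    rw [Polynomial.derivative_C_mul_X_pow, Nat.add_sub_cancel, neg_pow (Polynomial.X : K[X])]
    have h1 : ((i : K) + 1) ≠ 0 := by exact_mod_cast i.succ_ne_zero
    push_cast
    rw [div_mul_cancel₀ _ h1]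
    simp
  rw [this]
  have := mul_neg_geom_sum (-Polynomial.X : K[X]) n
  rw [sub_neg_eq_add] at this
  rw [mul_comm, this]

/-- A polynomial is determined modulo `Xⁿ⁺¹` by its constant term and its derivative modulo
`Xⁿ`. -/
theorem X_pow_succ_dvd_of_derivative {p : K[X]} {n : ℕ} (h0 : p.coeff 0 = 0)
    (h : Polynomial.X ^ n ∣ Polynomial.derivative p) : Polynomial.X ^ (n + 1) ∣ p := by
  rw [Polynomial.X_pow_dvd_iff] at h ⊢
  rintro (_ | d) hd
  · exact h0
  · have := h d (by omega)
    rw [Polynomial.coeff_derivative, mul_eq_zero] at this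
    exact this.resolve_right (by exact_mod_cast d.succ_ne_zero)

theorem X_pow_dvd_logPoly_comp (n : ℕ) :
    Polynomial.X ^ (n + 1) ∣ (logPoly K n).comp (expPoly K (n + 1) - 1) - Polynomial.X := by
  have hd := X_dvd_expPoly_sub_one K n
  refine X_pow_succ_dvd_of_derivative K ?_ ?_
  · have h0 : (expPoly K (n + 1) - 1).eval 0 = 0 := by
      obtain ⟨r, hr⟩ := hd
      simp [hr]
    rw [Polynomial.coeff_zero_eq_eval_zero, Polynomial.eval_sub, Polynomial.eval_comp, h0]
    simp [logPoly, Polynomial.eval_finsetSum]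
  · rw [Polynomial.derivative_sub, Polynomial.derivative_comp, Polynomial.derivative_X]
    have h1 := congrArg (fun p => Polynomial.comp p (expPoly K (n + 1) - 1))
        (derivative_logPoly K n)
    simp only [Polynomial.mul_comp, Polynomial.add_comp, Polynomial.one_comp, Polynomial.X_comp,
      Polynomial.sub_comp, Polynomial.pow_comp, Polynomial.neg_comp, add_sub_cancel] at h1
    have h2 : Polynomial.derivative (expPoly K (n + 1) - 1) =
        expPoly K (n + 1) - Polynomial.C (n.factorial : K)⁻¹ * Polynomial.X ^ n := by
      rw [Polynomial.derivative_sub, Polynomial.derivative_one, derivative_expPoly, sub_zero,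
        expPoly, expPoly, Finset.sum_range_succ, add_sub_cancel_right]
    set D := (Polynomial.derivative (logPoly K n)).comp (expPoly K (n + 1) - 1)
    have h3 : Polynomial.derivative (expPoly K (n + 1) - 1) * D - 1 =
        -(-(expPoly K (n + 1) - 1)) ^ n -
          Polynomial.C (n.factorial : K)⁻¹ * D * Polynomial.X ^ n := by
      rw [h2]
      linear_combination h1
    rw [h3]
    exact dvd_sub (dvd_neg.2 (pow_dvd_pow_of_dvd (dvd_neg.2 hd) n)) (dvd_mul_left _ _)

theorem X_pow_dvd_expPoly_comp (n : ℕ) :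
    Polynomial.X ^ (n + 1) ∣ (expPoly K (n + 1)).comp (logPoly K n) - (1 + Polynomial.X) := by
  set r := (expPoly K (n + 1)).comp (logPoly K n) - (1 + Polynomial.X) with hr
  have hX : Polynomial.X ∣ logPoly K n :=
    Finset.dvd_sum fun i _ => Dvd.dvd.mul_left (dvd_pow_self _ (by simp)) _
  have h0 : r.coeff 0 = 0 := by
    obtain ⟨q, hq⟩ := hX
    have : (logPoly K n).eval 0 = 0 := by simp [hq]
    rw [hr, Polynomial.coeff_zero_eq_eval_zero, Polynomial.eval_sub, Polynomial.eval_comp, this,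
      expPoly, Finset.sum_range_succ']
    simp [Polynomial.eval_finsetSum]
  have h1 : Polynomial.X ^ n ∣ (1 + Polynomial.X) * Polynomial.derivative r - r := by
    have h2 : expPoly K n = expPoly K (n + 1) - Polynomial.C (n.factorial : K)⁻¹ *
        Polynomial.X ^ n := by
      rw [expPoly, expPoly, Finset.sum_range_succ, add_sub_cancel_right]
    have h3 : (1 + Polynomial.X) * Polynomial.derivative r - r =
        -(Polynomial.C (n.factorial : K)⁻¹ * (logPoly K n) ^ n * (1 - (-Polynomial.X) ^ n)) -
          (expPoly K (n + 1)).comp (logPoly K n) * (-Polynomial.X) ^ n := by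
      rw [hr, Polynomial.derivative_sub, Polynomial.derivative_comp, derivative_expPoly, h2,
        Polynomial.sub_comp, Polynomial.mul_comp, Polynomial.C_comp, Polynomial.pow_comp,
        Polynomial.X_comp, Polynomial.derivative_add, Polynomial.derivative_one,
        Polynomial.derivative_X]
      linear_combination ((expPoly K (n + 1)).comp (logPoly K n) -
        Polynomial.C (n.factorial : K)⁻¹ * logPoly K n ^ n) * derivative_logPoly K n
    rw [h3]
    refine dvd_sub (dvd_neg.2 ?_) ?_
    · exact Dvd.dvd.mul_right (Dvd.dvd.mul_left (pow_dvd_pow_of_dvd hX n) _) _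
    · exact Dvd.dvd.mul_left (pow_dvd_pow_of_dvd (dvd_neg.2 dvd_rfl) n) _
  rw [Polynomial.X_pow_dvd_iff] at h1 ⊢
  intro d hd
  induction d with
  | zero => exact h0
  | succ d ih =>
    have h2 := h1 d (by omega)
    have h3 : ((1 + Polynomial.X) * Polynomial.derivative r).coeff d =
        r.coeff (d + 1) * (d + 1) + d * r.coeff d := by
      rw [add_mul, one_mul, Polynomial.coeff_add, Polynomial.coeff_derivative]
      cases d with
      | zero => simp
      | succ e => rw [Polynomial.coeff_X_mul, Polynomial.coeff_derivative]; push_cast; ring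
    rw [Polynomial.coeff_sub, h3, ih (by omega), mul_zero, add_zero, sub_zero, mul_eq_zero] at h2
    exact h2.resolve_right (by exact_mod_cast d.succ_ne_zero)

theorem nlog_nexp {a : U} {n : ℕ} (ha : a ^ (n + 1) = 0) : nlog K n (nexp K a - 1) = a := by
  have h := aeval_eq_of_X_pow_dvd K (X_pow_dvd_logPoly_comp K n) ha
  rw [Polynomial.aeval_comp, Polynomial.aeval_X, map_sub, map_one, ← nexp_eq_aeval K ha] at h
  exact h

theorem nexp_nlog {ν : U} {n : ℕ} (hν : ν ^ (n + 1) = 0) : nexp K (nlog K n ν) = 1 + ν := by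
  have h := aeval_eq_of_X_pow_dvd K (X_pow_dvd_expPoly_comp K n) hν
  rw [Polynomial.aeval_comp] at h
  rw [nexp_eq_aeval K (nlog_pow K hν n), nlog, h]
  simp

theorem nexp_injective {a b : U} (ha : IsNilpotent a) (hb : IsNilpotent b)
    (h : nexp K a = nexp K b) : a = b := by
  obtain ⟨m, hm⟩ := ha
  obtain ⟨n, hn⟩ := hb
  have ha : a ^ (max m n + 1) = 0 := pow_eq_zero_of_le (by omega) hm
  have hb : b ^ (max m n + 1) = 0 := pow_eq_zero_of_le (by omega) hn
  rw [← nlog_nexp K ha, h, nlog_nexp K hb]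

end NilpotentExp

section NilpotentEnd

variable (K : Type u) [Field K] {W W' : Type*} [AddCommGroup W] [Module K W]
  [AddCommGroup W'] [Module K W']

theorem nexp_apply_eq_sum {N : Module.End K W} {n : ℕ} (h : N ^ n = 0) (z : W) :
    nexp K N z = ∑ i ∈ Finset.range n, (i.factorial : K)⁻¹ • (N ^ i) z := by
  rw [nexp_eq_sum K h, LinearMap.sum_apply]
  rfl

/-- A linear map that intertwines two nilpotent operators at all points of a stable set
intertwines their exponentials there. -/
theorem nexp_intertwine {N : Module.End K W} {N' : Module.End K W'} (hN : IsNilpotent N)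
    (hN' : IsNilpotent N') (f : W →ₗ[K] W') (S : Submodule K W) (hS : ∀ z ∈ S, N z ∈ S)
    (h : ∀ z ∈ S, f (N z) = N' (f z)) {z : W} (hz : z ∈ S) :
    f (nexp K N z) = nexp K N' (f z) := by
  obtain ⟨m, hm⟩ := hN
  obtain ⟨n, hn⟩ := hN'
  have h1 : ∀ i, ∀ z ∈ S, f ((N ^ i) z) = (N' ^ i) (f z) := by
    intro i
    induction i with
    | zero => intro z _; rfl
    | succ i ih =>
      intro z hz
      rw [pow_succ, pow_succ, Module.End.mul_apply, Module.End.mul_apply, ih _ (hS z hz), h z hz]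
  rw [nexp_apply_eq_sum K (pow_eq_zero_of_le (le_max_left m n) hm),
    nexp_apply_eq_sum K (pow_eq_zero_of_le (le_max_right m n) hn), map_sum]
  exact Finset.sum_congr rfl fun i _ => by rw [map_smul, h1 i z hz]

theorem nexp_mem {N : Module.End K W} (hN : IsNilpotent N) {S : Submodule K W}
    (hS : ∀ z ∈ S, N z ∈ S) {z : W} (hz : z ∈ S) : nexp K N z ∈ S := by
  obtain ⟨n, hn⟩ := hN
  rw [nexp_apply_eq_sum K hn]
  refine Submodule.sum_mem _ fun i hi => Submodule.smul_mem _ _ ?_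
  clear hi
  induction i with
  | zero => exact hz
  | succ i ih => rw [pow_succ', Module.End.mul_apply]; exact hS _ ih

theorem nexp_apply_of_apply_eq_zero {N : Module.End K W} (hN : IsNilpotent N) {z : W}
    (h : N z = 0) : nexp K N z = z := by
  obtain ⟨n, hn⟩ := hN
  have hn : N ^ (n + 1) = 0 := pow_eq_zero_of_le (by omega) hn
  rw [nexp_apply_eq_sum K hn, Finset.sum_range_succ', Finset.sum_eq_zero]
  · simp
  · intro i _
    rw [pow_succ, Module.End.mul_apply, h, map_zero, smul_zero]

variable [CharZero K]

/-- The vectors fixed by the exponential of a nilpotent operator are those in its kernel. -/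
theorem apply_eq_zero_of_nexp_apply {N : Module.End K W} (hN : IsNilpotent N) {z : W}
    (h : nexp K N z = z) : N z = 0 := by
  obtain ⟨n, hn⟩ := hN
  have hn : N ^ (n + 1) = 0 := pow_eq_zero_of_le (by omega) hn
  have h1 := nlog_nexp K hn
  have h2 : (nexp K N - 1) z = 0 := by simp [h]
  rw [← h1, nlog, logPoly, map_sum, LinearMap.sum_apply]
  refine Finset.sum_eq_zero fun i _ => ?_
  rw [map_mul, Polynomial.aeval_C, map_pow, Polynomial.aeval_X, pow_succ, Module.End.mul_apply,
    Module.End.mul_apply, h2, map_zero, map_zero]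

/-- If a bilinear map `B` satisfies the Leibniz rule `B (N z) z' + B z (N z') = N' (B z z')` on an
`N`-stable subspace, it is equivariant for the exponentials. -/
theorem bilin_nexp {N : Module.End K W} {N' : Module.End K W'} (hN : IsNilpotent N)
    (hN' : IsNilpotent N') (B : W →ₗ[K] W →ₗ[K] W') (S : Submodule K W) (hS : ∀ z ∈ S, N z ∈ S)
    (h : ∀ z ∈ S, ∀ z' ∈ S, B (N z) z' + B z (N z') = N' (B z z')) {z z' : W} (hz : z ∈ S)
    (hz' : z' ∈ S) : B (nexp K N z) (nexp K N z') = nexp K N' (B z z') := by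
  set b := TensorProduct.lift B
  set N₁ : Module.End K (W ⊗[K] W) := N.rTensor W
  set N₂ : Module.End K (W ⊗[K] W) := N.lTensor W
  have hN₁ : IsNilpotent N₁ := hN.map (Module.End.rTensorAlgHom K W W)
  have hN₂ : IsNilpotent N₂ := hN.map (Module.End.lTensorAlgHom K W W)
  have hc : Commute N₁ N₂ := by ext; simp [N₁, N₂]
  have hn := hc.isNilpotent_add hN₁ hN₂
  have h1 : nexp K N₁ = (nexp K N).rTensor W :=
    (map_nexp K (Module.End.rTensorAlgHom K W W) hN).symm
  have h2 : nexp K N₂ = (nexp K N).lTensor W :=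
    (map_nexp K (Module.End.lTensorAlgHom K W W) hN).symm
  have h3 := nexp_intertwine K hn hN' b (Submodule.map₂ (TensorProduct.mk K W W) S S)
    (fun t ht => by
      have hle : Submodule.map₂ (TensorProduct.mk K W W) S S ≤
          (Submodule.map₂ (TensorProduct.mk K W W) S S).comap (N₁ + N₂) :=
        Submodule.map₂_le.2 fun x hx y hy => Submodule.add_mem _
          (Submodule.apply_mem_map₂ (TensorProduct.mk K W W) (hS x hx) hy)
          (Submodule.apply_mem_map₂ (TensorProduct.mk K W W) hx (hS y hy))
      exact hle ht)
    (fun t ht => by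
      have hle : Submodule.map₂ (TensorProduct.mk K W W) S S ≤
          LinearMap.eqLocus (b ∘ₗ (N₁ + N₂)) (N' ∘ₗ b) :=
        Submodule.map₂_le.2 fun x hx y hy => by
          rw [LinearMap.mem_eqLocus]
          simpa [b, N₁, N₂] using h x hx y hy
      exact hle ht)
    (Submodule.apply_mem_map₂ (TensorProduct.mk K W W) hz hz')
  rw [nexp_add_of_commute K hc hN₁ hN₂, h1, h2] at h3
  simpa [b] using h3

end NilpotentEnd

/-! ### Dynkin's form of the Baker-Campbell-Hausdorff formula -/

section Words

/-- The pairs `(r, s) ≠ (0, 0)` with `r, s < k`. -/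
def bchPairs (k : ℕ) : Finset (ℕ × ℕ) := (Finset.range k ×ˢ Finset.range k).erase (0, 0)

/-- The lists of length `j` with entries in `bchPairs k`. -/
def bchLists (k : ℕ) : ℕ → Finset (List (ℕ × ℕ))
  | 0 => {[]}
  | j + 1 => (bchPairs k ×ˢ bchLists k j).image fun p => p.1 :: p.2

/-- The nonempty lists of length at most `k` with entries in `bchPairs k`. -/
def bchIndex (k : ℕ) : Finset (List (ℕ × ℕ)) :=
  (Finset.range k).biUnion fun i => bchLists k (i + 1)

theorem mem_bchLists {k j : ℕ} {w : List (ℕ × ℕ)} :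
    w ∈ bchLists k j ↔ w.length = j ∧ ∀ e ∈ w, e ∈ bchPairs k := by
  induction j generalizing w with
  | zero =>
    simp only [bchLists, Finset.mem_singleton, List.length_eq_zero_iff]
    constructor
    · rintro rfl; simp
    · exact fun h => h.1
  | succ j ih =>
    simp only [bchLists, Finset.mem_image, Finset.mem_product]
    constructor
    · rintro ⟨⟨e, l⟩, ⟨he, hl⟩, rfl⟩
      have := ih.1 hl
      simp only [List.length_cons, this.1, true_and, List.mem_cons]
      rintro e' (rfl | he')
      exacts [he, this.2 _ he']
    · rintro ⟨h1, h2⟩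
      rcases w with _ | ⟨e, l⟩
      · simp at h1
      · refine ⟨(e, l), ⟨h2 e (by simp), ih.2 ⟨by simpa using h1,
          fun e' he' => h2 e' (by simp [he'])⟩⟩, rfl⟩

theorem mem_bchIndex {k : ℕ} {w : List (ℕ × ℕ)} :
    w ∈ bchIndex k ↔ w ≠ [] ∧ w.length ≤ k ∧ ∀ e ∈ w, e ∈ bchPairs k := by
  simp only [bchIndex, Finset.mem_biUnion, Finset.mem_range, mem_bchLists]
  constructor
  · rintro ⟨i, hi, h1, h2⟩
    exact ⟨fun h => by simp [h] at h1, by omega, h2⟩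
  · rintro ⟨h0, h1, h2⟩
    have := List.length_pos_iff.2 h0
    exact ⟨w.length - 1, by omega, by omega, h2⟩

/-- The coefficient `(-1) ^ (n - 1) / n * 1 / ∏ rᵢ! sᵢ!` of the word of `w` in
`log (e ^ x * e ^ y)`. -/
def logCoeff (K : Type u) [Field K] (w : List (ℕ × ℕ)) : K :=
  (-1) ^ (w.length - 1) / (w.length : K) *
    (((w.map fun e => e.1.factorial * e.2.factorial).prod : ℕ) : K)⁻¹

theorem bchWord_cons {V : Type*} (x y : V) (e : ℕ × ℕ) (w : List (ℕ × ℕ)) :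
    bchWord x y (e :: w) = List.replicate e.1 x ++ List.replicate e.2 y ++ bchWord x y w := rfl

theorem map_bchWord {V V' : Type*} (f : V → V') (x y : V) (w : List (ℕ × ℕ)) :
    (bchWord x y w).map f = bchWord (f x) (f y) w := by
  simp [bchWord, List.map_flatMap]

theorem mem_bchWord {V : Type*} {x y z : V} {w : List (ℕ × ℕ)} (h : z ∈ bchWord x y w) :
    z = x ∨ z = y := by
  simp only [bchWord, List.mem_flatMap, List.mem_append, List.mem_replicate] at h
  obtain ⟨e, -, ⟨-, rfl⟩ | ⟨-, rfl⟩⟩ := h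
  exacts [Or.inl rfl, Or.inr rfl]

theorem length_le_length_bchWord {V : Type*} (x y : V) {w : List (ℕ × ℕ)} (h : (0, 0) ∉ w) :
    w.length ≤ (bchWord x y w).length := by
  induction w with
  | nil => simp
  | cons e w ih =>
    rw [List.mem_cons, not_or] at h
    have h1 := ih h.2
    have h2 : e.1 + e.2 ≠ 0 := fun h0 => h.1 (Prod.ext (by simp; omega) (by simp; omega))
    rw [bchWord_cons]
    simp only [List.length_cons, List.length_append, List.length_replicate]
    omega

end Words

section Log

variable (K : Type u) [Field K] {U : Type*} [Ring U] [Algebra K U]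

theorem sum_bchLists (x y : U) (k j : ℕ) :
    ∑ w ∈ bchLists k j, (((w.map fun e => e.1.factorial * e.2.factorial).prod : ℕ) : K)⁻¹ •
        (bchWord x y w).prod =
      (∑ e ∈ bchPairs k, ((e.1.factorial * e.2.factorial : ℕ) : K)⁻¹ • (x ^ e.1 * y ^ e.2))
          ^ j := by
  induction j with
  | zero => simp [bchLists, bchWord]
  | succ j ih =>
    rw [pow_succ', ← ih, bchLists, Finset.sum_image (by
      rintro ⟨e, l⟩ - ⟨e', l'⟩ - h; simpa using h), Finset.sum_product, Finset.sum_mul_sum]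
    refine Finset.sum_congr rfl fun e _ => Finset.sum_congr rfl fun l _ => ?_
    rw [bchWord_cons, List.map_cons, List.prod_cons, List.prod_append, List.prod_append,
      List.prod_replicate, List.prod_replicate, Nat.cast_mul, mul_inv, smul_mul_smul_comm]

theorem sum_bchPairs {x y : U} {k : ℕ} (hk : 0 < k) (hx : x ^ k = 0) (hy : y ^ k = 0) :
    ∑ e ∈ bchPairs k, ((e.1.factorial * e.2.factorial : ℕ) : K)⁻¹ • (x ^ e.1 * y ^ e.2) =
      nexp K x * nexp K y - 1 := by
  rw [nexp_eq_sum K hx, nexp_eq_sum K hy, Finset.sum_mul_sum, ← Finset.sum_product',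
      eq_sub_iff_add_eq,
    bchPairs, ← Finset.sum_erase_add (Finset.range k ×ˢ Finset.range k) _
        (a := (0, 0)) (by simp [hk])]
  congr 1
  · refine Finset.sum_congr rfl fun e _ => ?_
    rw [smul_mul_smul_comm, Nat.cast_mul, mul_inv]
  · simp

/-- The logarithm of `e ^ x * e ^ y` as a sum of words. -/
theorem sum_logCoeff {x y : U} {k : ℕ} (hx : x ^ k = 0) (hy : y ^ k = 0) :
    ∑ w ∈ bchIndex k, logCoeff K w • (bchWord x y w).prod =
      nlog K k (nexp K x * nexp K y - 1) := by
  rcases Nat.eq_zero_or_pos k with rfl | hk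
  · simp [bchIndex, nlog, logPoly]
  rw [← sum_bchPairs K hk hx hy, bchIndex, Finset.sum_biUnion, nlog, logPoly, map_sum]
  · refine Finset.sum_congr rfl fun i _ => ?_
    rw [← Polynomial.smul_eq_C_mul, map_smul, map_pow, Polynomial.aeval_X, ← sum_bchLists,
      Finset.smul_sum]
    refine Finset.sum_congr rfl fun w hw => ?_
    rw [logCoeff, (mem_bchLists.1 hw).1, smul_smul]
    simp
  · intro i _ j _ hij
    refine Finset.disjoint_left.2 fun w hw hw' => hij ?_
    have h1 := (mem_bchLists.1 hw).1
    have h2 := (mem_bchLists.1 hw').1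
    omega

/-- The commutator of an associative algebra. -/
def comm (x y : U) : U := x * y - y * x

/-- The operator `[x, -]` on an associative algebra. -/
def adj (x : U) : Module.End K U := LinearMap.mulLeft K x - LinearMap.mulRight K x

theorem adj_apply (x y : U) : adj K x y = x * y - y * x := rfl

theorem commute_mulLeft_neg_mulRight (x : U) :
    Commute (LinearMap.mulLeft K x) (-LinearMap.mulRight K x) :=
  (LinearMap.commute_mulLeft_right (A := U) (R := K) x x).neg_right

theorem isNilpotent_adj {x : U} (hx : IsNilpotent x) : IsNilpotent (adj K x) := by
  rw [adj, sub_eq_add_neg]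
  refine (commute_mulLeft_neg_mulRight K x).isNilpotent_add ?_ ?_
  · exact (LinearMap.isNilpotent_mulLeft_iff K x).2 hx
  · exact ((LinearMap.isNilpotent_mulRight_iff K x).2 hx).neg

theorem nexp_adj [CharZero K] {x : U} (hx : IsNilpotent x) :
    nexp K (adj K x) = LinearMap.mulLeft K (nexp K x) * LinearMap.mulRight K (nexp K (-x)) := by
  have h1 : nexp K (LinearMap.mulLeft K x) = LinearMap.mulLeft K (nexp K x) :=
    (map_nexp K (Algebra.lmul K U) hx).symm
  have h2 : nexp K (LinearMap.mulRight K (-x)) = LinearMap.mulRight K (nexp K (-x)) := by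
    obtain ⟨n, hn⟩ := hx.neg
    have h3 : LinearMap.mulRight K (-x) ^ n = 0 := by
      rw [LinearMap.pow_mulRight, hn, LinearMap.mulRight_zero_eq_zero]
    ext z
    simp [nexp_eq_sum K hn, nexp_eq_sum K h3, LinearMap.pow_mulRight, Finset.mul_sum]
  have h3 : -LinearMap.mulRight K x = LinearMap.mulRight K (-x) := by ext; simp
  rw [adj, sub_eq_add_neg, nexp_add_of_commute K (commute_mulLeft_neg_mulRight K x)
    ((LinearMap.isNilpotent_mulLeft_iff K x).2 hx)
    ((LinearMap.isNilpotent_mulRight_iff K x).2 hx).neg, h1, h3, h2]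

/-- If `[θ, x] = x` for the entries `x` of a word, its nested commutator is
`[x₁, [x₂, …[xₖ, -θ]…]]`, the value at `-θ` of the product of the operators `[xᵢ, -]`. -/
theorem nestedBracket_eq_adj {θ : U} {l : List U} (h0 : l ≠ []) (h : ∀ x ∈ l, θ * x - x * θ = x) :
    nestedBracket comm l = (l.map (adj K)).prod (-θ) := by
  match l with
  | [] => exact absurd rfl h0
  | [x] =>
    have := h x (by simp)
    simp only [nestedBracket, List.map_cons, List.map_nil, List.prod_cons, List.prod_nil, mul_one,
      adj_apply]
    rw [neg_mul, mul_neg, sub_neg_eq_add, neg_add_eq_sub, this]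
  | x :: y :: l =>
    have := nestedBracket_eq_adj (l := y :: l) (by simp) fun z hz => h z (List.mem_cons_of_mem _ hz)
    rw [nestedBracket, this, List.map_cons (f := adj K) (a := x), List.prod_cons,
      Module.End.mul_apply, adj_apply, comm]

/-- The derivation `[θ, -]` multiplies a word by its length. -/
theorem commutator_list_prod {θ : U} {l : List U} (h : ∀ x ∈ l, θ * x - x * θ = x) :
    θ * l.prod - l.prod * θ = (l.length : K) • l.prod := by
  induction l with
  | nil => simp
  | cons x l ih =>
    have h1 := ih fun z hz => h z (List.mem_cons_of_mem _ hz)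
    have h2 := h x (by simp)
    rw [sub_eq_iff_eq_add] at h1 h2
    rw [List.prod_cons, List.length_cons, ← mul_assoc, h2, add_mul, mul_assoc x θ, h1, Nat.cast_add,
      Nat.cast_one, add_smul, one_smul, mul_add, mul_smul_comm, mul_assoc]
    abel

theorem pow_eq_zero_of_words {x y : U} {n : ℕ}
    (h : ∀ w, n ≤ (bchWord x y w).length → (bchWord x y w).prod = 0) : x ^ n = 0 ∧ y ^ n = 0 := by
  constructor
  · simpa [bchWord] using h [(n, 0)] (by simp [bchWord])
  · simpa [bchWord] using h [(0, n)] (by simp [bchWord])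

/-- A product of `n` factors `e ^ x * e ^ y - 1` is a sum of words of length at least `n`. -/
theorem nexp_mul_sub_one_pow {x y : U} {n : ℕ}
    (h : ∀ w, n ≤ (bchWord x y w).length → (bchWord x y w).prod = 0) :
    (nexp K x * nexp K y - 1) ^ n = 0 := by
  obtain ⟨hx, hy⟩ := pow_eq_zero_of_words h
  rw [← sum_bchPairs K n.succ_pos (pow_eq_zero_of_le n.le_succ hx)
    (pow_eq_zero_of_le n.le_succ hy), ← sum_bchLists]
  refine Finset.sum_eq_zero fun w hw => ?_
  obtain ⟨h1, h2⟩ := mem_bchLists.1 hw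
  rw [h, smul_zero]
  rw [← h1]
  exact length_le_length_bchWord x y fun h0 => by simpa [bchPairs] using h2 _ h0

variable [CharZero K]

/-- `log (e ^ [x, -] * e ^ [y, -]) = [log (e ^ x * e ^ y), -]`, the logarithms being written as sums
of words. -/
theorem sum_logCoeff_adj {x y : U} {n : ℕ}
    (h : ∀ w, n ≤ (bchWord x y w).length → (bchWord x y w).prod = 0) :
    ∃ k₀, ∀ k ≥ k₀, ∑ w ∈ bchIndex k, logCoeff K w • (bchWord (adj K x) (adj K y) w).prod =
      adj K (nlog K k (nexp K x * nexp K y - 1)) := by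
  obtain ⟨hx, hy⟩ := pow_eq_zero_of_words h
  have hν := nexp_mul_sub_one_pow K h
  have hZ : ∀ k, n ≤ k → nlog K k (nexp K x * nexp K y - 1) =
      nlog K n (nexp K x * nexp K y - 1) := by
    intro k hk
    rw [nlog, nlog, logPoly, logPoly, map_sum, map_sum]
    refine (Finset.sum_subset (Finset.range_mono hk) fun i _ hi => ?_).symm
    rw [map_mul, map_pow, Polynomial.aeval_X, pow_eq_zero_of_le (m := n) (by simp at hi; omega) hν,
      mul_zero]
  set Z := nlog K n (nexp K x * nexp K y - 1) with hZdef
  have hZn : IsNilpotent Z := ⟨n, nlog_pow K hν n⟩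
  have hexpZ : nexp K Z = nexp K x * nexp K y := by
    rw [hZdef, nexp_nlog K (pow_eq_zero_of_le n.le_succ hν), add_sub_cancel]
  have hexpZ' : nexp K (-Z) = nexp K (-y) * nexp K (-x) := by
    have h1 := nexp_mul_nexp_neg K hZn
    rw [hexpZ] at h1
    have h2 : (nexp K (-y) * nexp K (-x)) * (nexp K x * nexp K y) = 1 := by
      rw [mul_assoc, ← mul_assoc (nexp K (-x)), nexp_neg_mul_nexp K ⟨n, hx⟩, one_mul,
        nexp_neg_mul_nexp K ⟨n, hy⟩]
    exact (left_inv_eq_right_inv h2 h1).symm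
  -- `e ^ [z, -]` is conjugation by `e ^ z`
  have hAd : nexp K (adj K Z) = nexp K (adj K x) * nexp K (adj K y) := by
    rw [nexp_adj K hZn, nexp_adj K ⟨n, hx⟩, nexp_adj K ⟨n, hy⟩, hexpZ, hexpZ']
    ext z
    simp [mul_assoc]
  obtain ⟨k₁, h₁⟩ := isNilpotent_adj K (x := x) ⟨n, hx⟩
  obtain ⟨k₂, h₂⟩ := isNilpotent_adj K (x := y) ⟨n, hy⟩
  obtain ⟨k₃, h₃⟩ := isNilpotent_adj K hZn
  refine ⟨max (max k₁ k₂) (max k₃ n), fun k hk => ?_⟩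
  rw [sum_logCoeff K (pow_eq_zero_of_le (by omega) h₁) (pow_eq_zero_of_le (by omega) h₂), ← hAd,
    nlog_nexp K (pow_eq_zero_of_le (by omega) h₃), hZ k (by omega)]

/-- The formula of Dynkin-Specht-Wever for `log (e ^ x * e ^ y)`: in the presence of an element `θ`
with `[θ, x] = x` and `[θ, y] = y`, evaluate `sum_logCoeff_adj` at `-θ`. -/
theorem sum_logCoeff_nestedBracket {x y θ : U} {n : ℕ} (hθx : θ * x - x * θ = x)
    (hθy : θ * y - y * θ = y)
    (h : ∀ w, n ≤ (bchWord x y w).length → (bchWord x y w).prod = 0) :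
    ∃ k₀, ∀ k ≥ k₀, ∑ w ∈ bchIndex k, logCoeff K w • nestedBracket comm (bchWord x y w) =
      ∑ w ∈ bchIndex k, logCoeff K w • ((bchWord x y w).length : K) • (bchWord x y w).prod := by
  obtain ⟨hx, hy⟩ := pow_eq_zero_of_words h
  obtain ⟨k₀, hk₀⟩ := sum_logCoeff_adj K h
  have hθ : ∀ w, ∀ z ∈ bchWord x y w, θ * z - z * θ = z := by
    intro w z hz
    rcases mem_bchWord hz with rfl | rfl
    exacts [hθx, hθy]
  refine ⟨max k₀ n, fun k hk => ?_⟩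
  have h1 := LinearMap.congr_fun (hk₀ k (by omega)) (-θ)
  rw [← sum_logCoeff K (pow_eq_zero_of_le (by omega) hx) (pow_eq_zero_of_le (by omega) hy),
      adj_apply,
    LinearMap.sum_apply] at h1
  calc _ = ∑ w ∈ bchIndex k, (logCoeff K w • (bchWord (adj K x) (adj K y) w).prod) (-θ) := by
        refine Finset.sum_congr rfl fun w hw => ?_
        obtain ⟨hw0, -, hw2⟩ := mem_bchIndex.1 hw
        have hne : bchWord x y w ≠ [] := by
          have := length_le_length_bchWord x y (w := w)
            fun h0 => by simpa [bchPairs] using hw2 _ h0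
          have h3 := List.length_pos_iff.2 hw0
          exact List.length_pos_iff.1 (by omega)
        rw [nestedBracket_eq_adj K hne (hθ w), map_bchWord, LinearMap.smul_apply]
    _ = _ := by
        rw [h1, mul_neg, neg_mul, sub_neg_eq_add, neg_add_eq_sub, Finset.mul_sum, Finset.sum_mul,
          ← Finset.sum_sub_distrib]
        refine Finset.sum_congr rfl fun w _ => ?_
        rw [mul_smul_comm, smul_mul_assoc, ← smul_sub, commutator_list_prod K (hθ w)]

end Log

section Dynkin

variable (K : Type u) [Field K] {U : Type*} [Ring U] [Algebra K U]

theorem map_nestedBracket {V V' : Type*} [AddCommGroup V] [AddCommGroup V']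
    {b : V → V → V} {b' : V' → V' → V'}
    (f : V → V') (h0 : f 0 = 0) (h : ∀ x y, f (b x y) = b' (f x) (f y)) (l : List V) :
    f (nestedBracket b l) = nestedBracket b' (l.map f) := by
  match l with
  | [] => exact h0
  | [x] => rfl
  | x :: y :: l =>
    have := map_nestedBracket f h0 h (y :: l)
    rw [List.map_cons, List.map_cons, nestedBracket, nestedBracket, h, this, List.map_cons]

/-- The degree-one copy `u X` of an element `u` in the polynomial ring over an algebra. -/
def degOne (u : U) : U[X] := Polynomial.C u * Polynomial.X

theorem list_prod_degOne (l : List U) :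
    (l.map degOne).prod = Polynomial.C l.prod * Polynomial.X ^ l.length := by
  induction l with
  | nil => simp
  | cons u l ih =>
    rw [List.map_cons, List.prod_cons, ih, List.prod_cons, List.length_cons, degOne, map_mul,
      pow_succ', mul_assoc, mul_assoc, ← mul_assoc Polynomial.X, Polynomial.X_mul_C, mul_assoc]

theorem nestedBracket_degOne (l : List U) :
    nestedBracket comm (l.map degOne) =
      Polynomial.C (nestedBracket comm l) * Polynomial.X ^ l.length := by
  match l with
  | [] => simp [nestedBracket]
  | [x] => simp [nestedBracket, degOne]
  | x :: y :: l =>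
    have := nestedBracket_degOne (y :: l)
    rw [List.map_cons, List.map_cons, nestedBracket, ← List.map_cons, this, nestedBracket,
      List.length_cons (as := y :: l), comm, comm, degOne, map_sub, map_mul, map_mul, sub_mul]
    congr 1
    · rw [pow_succ', mul_assoc, mul_assoc, ← mul_assoc Polynomial.X, Polynomial.X_mul_C, mul_assoc]
    · rw [pow_succ, mul_assoc, mul_assoc, ← mul_assoc (Polynomial.X ^ _), Polynomial.X_pow_mul_C,
        mul_assoc]

variable [CharZero K]

/-- Dynkin's formula `log (e ^ x * e ^ y) = ∑ c_w / |w| [w]` in an associative algebra. The element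
`θ` required by `sum_logCoeff_nestedBracket` is the operator `X d/dX` on `U[X]`, for the operators
of multiplication by `x X` and `y X`; comparing coefficients of the powers of `X` then separates
the words by length. -/
theorem sum_bchCoeff_nestedBracket {x y : U} {n : ℕ}
    (h : ∀ w, n ≤ (bchWord x y w).length → (bchWord x y w).prod = 0) :
    ∃ k₀, ∀ k ≥ k₀, ∑ w ∈ bchIndex k, bchCoeff K w • nestedBracket comm (bchWord x y w) =
      nlog K k (nexp K x * nexp K y - 1) := by
  obtain ⟨hx, hy⟩ := pow_eq_zero_of_words h
  let f : U → Module.End K U[X] := fun u => Algebra.lmul K U[X] (degOne u)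
  let θ : Module.End K U[X] :=
    LinearMap.mulLeft K Polynomial.X ∘ₗ Polynomial.derivative.restrictScalars K
  -- `[X d/dX, u X] = u X`
  have hθ : ∀ u, θ * f u - f u * θ = f u := by
    intro u
    refine LinearMap.ext fun p => ?_
    simp only [θ, f, LinearMap.sub_apply, Module.End.mul_apply, LinearMap.comp_apply, degOne,
      Algebra.coe_lmul_eq_mul, LinearMap.mul_apply', LinearMap.mulLeft_apply,
      LinearMap.restrictScalars_apply, Polynomial.derivative_mul, Polynomial.derivative_C,
      Polynomial.derivative_X, zero_mul, zero_add, mul_one, mul_add]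
    rw [← mul_assoc, Polynomial.X_mul_C, ← mul_assoc Polynomial.X, ← mul_assoc Polynomial.X,
      Polynomial.X_mul_C]
    simp only [mul_assoc]
    abel
  have hprod : ∀ w, (bchWord (f x) (f y) w).prod =
      Algebra.lmul K U[X] (Polynomial.C (bchWord x y w).prod * Polynomial.X ^
          (bchWord x y w).length) := by
    intro w
    rw [← list_prod_degOne, map_list_prod, List.map_map, map_bchWord]
    rfl
  obtain ⟨k₀, hk₀⟩ := sum_logCoeff_nestedBracket K (hθ x) (hθ y) (n := n) (by
    intro w hw
    rw [hprod, h w (by simpa [← map_bchWord f] using hw)]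
    simp)
  refine ⟨max k₀ n, fun k hk => ?_⟩
  -- the functional `∑ uᵢ Xⁱ ↦ ∑ uᵢ / i` inserts the factors `1 / |w|`
  let Λ : U[X] →ₗ[K] U := Polynomial.lsum fun n => (n : K)⁻¹ • LinearMap.id
  have hΛ : ∀ (u : U) (n : ℕ), Λ (Polynomial.C u * Polynomial.X ^ n) = (n : K)⁻¹ • u := by
    intro u n
    simp only [Λ, Polynomial.lsum_apply, Polynomial.C_mul_X_pow_eq_monomial]
    rw [Polynomial.sum_monomial_index _ _ (by simp)]
    rfl
  have h1 := congrArg Λ (LinearMap.congr_fun (hk₀ k (by omega)) 1)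
  rw [← sum_logCoeff K (pow_eq_zero_of_le (by omega) hx) (pow_eq_zero_of_le (by omega) hy)]
  simp only [LinearMap.sum_apply, map_sum, LinearMap.smul_apply, map_smul] at h1
  have hlen : ∀ w, (bchWord x y w).length = (w.map fun e => e.1 + e.2).sum :=
    DGLA.length_bchWord x y
  have hvalid : ∀ w ∈ bchIndex k, (0, 0) ∉ w ∧ w ≠ [] := fun w hw =>
    ⟨fun h0 => by simpa [bchPairs] using (mem_bchIndex.1 hw).2.2 _ h0, (mem_bchIndex.1 hw).1⟩
  calc _ = ∑ w ∈ bchIndex k, logCoeff K w •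
        Λ (nestedBracket comm (bchWord (f x) (f y) w) 1) := by
        refine Finset.sum_congr rfl fun w hw => ?_
        have h2 : nestedBracket comm (bchWord (f x) (f y) w) =
            Algebra.lmul K U[X] (nestedBracket comm ((bchWord x y w).map degOne)) := by
          rw [map_nestedBracket (b' := comm) (Algebra.lmul K U[X]) (map_zero _)
            (fun p q => by simp only [comm, map_sub, map_mul]), List.map_map, map_bchWord]
          rfl
        rw [h2, nestedBracket_degOne]
        simp only [Algebra.coe_lmul_eq_mul, LinearMap.mul_apply', mul_one, hΛ]
        rw [smul_smul, bchCoeff, if_pos ⟨(hvalid w hw).2, (hvalid w hw).1⟩, logCoeff, hlen]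
        congr 1
        ring
    _ = _ := by
        rw [h1]
        refine Finset.sum_congr rfl fun w hw => ?_
        rw [hprod]
        simp only [Algebra.coe_lmul_eq_mul, LinearMap.mul_apply', mul_one, hΛ]
        have h3 : ((bchWord (f x) (f y) w).length : K) = ((bchWord x y w).length : K) := by
          rw [← map_bchWord f, List.length_map]
        have h4 : ((bchWord x y w).length : K) ≠ 0 := by
          have := length_le_length_bchWord x y (hvalid w hw).1
          have := List.length_pos_iff.2 (hvalid w hw).2
          exact_mod_cast (by omega : (bchWord x y w).length ≠ 0)
        rw [h3, smul_smul _ _ (bchWord x y w).prod, mul_inv_cancel₀ h4, one_smul]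

end Dynkin

section Bch

variable (K : Type u) [Field K] {V : Type*} [AddCommGroup V] [Module K V]

/-- A subspace `G` is nilpotent for the bracket `b`: it is closed under `b`, and the long iterated
brackets of its elements vanish. -/
structure NilpotentFor (b : V → V → V) (G : Submodule K V) : Prop where
  closed : ∀ {x y}, x ∈ G → y ∈ G → b x y ∈ G
  nil : ∃ n, ∀ l : List V, (∀ x ∈ l, x ∈ G) → n ≤ l.length → nestedBracket b l = 0

variable {K} {b : V → V → V} {G : Submodule K V}

theorem NilpotentFor.nestedBracket_mem (hG : NilpotentFor K b G) {l : List V}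
    (hl : ∀ x ∈ l, x ∈ G) : nestedBracket b l ∈ G := by
  match l with
  | [] => exact G.zero_mem
  | [x] => exact hl x (by simp)
  | x :: y :: l =>
    exact hG.closed (hl x (by simp)) (hG.nestedBracket_mem
        (l := y :: l) fun z hz => hl z (by simp [hz]))

theorem bchWord_subset {x y : V} (hx : x ∈ G) (hy : y ∈ G) (w : List (ℕ × ℕ)) :
    ∀ z ∈ bchWord x y w, z ∈ G := fun z hz => by
  rcases mem_bchWord hz with rfl | rfl
  exacts [hx, hy]

theorem NilpotentFor.bch_eq_sum (hG : NilpotentFor K b G) {x y : V} (hx : x ∈ G) (hy : y ∈ G) :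
    ∃ n, ∀ k ≥ n, bch K b x y = ∑ w ∈ bchIndex k, bchCoeff K w •
        nestedBracket b (bchWord x y w) := by
  obtain ⟨n, hn⟩ := hG.nil
  refine ⟨n, fun k hk => finsum_eq_sum_of_support_subset _ fun w hw => ?_⟩
  have hc : bchCoeff K w ≠ 0 := fun hc => hw (by simp [hc])
  have hv : w ≠ [] ∧ (0, 0) ∉ w := by
    by_contra hv
    exact hc (by rw [bchCoeff, if_neg hv])
  have hlt : (bchWord x y w).length < n := by
    by_contra hlt
    exact hw (by simp [hn _ (bchWord_subset hx hy w) (not_lt.1 hlt)])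
  have hle := length_le_length_bchWord x y hv.2
  refine mem_bchIndex.2 ⟨hv.1, by omega, fun e he => ?_⟩
  have h1 : e.1 + e.2 ≤ (bchWord x y w).length := by
    rw [DGLA.length_bchWord]
    exact List.single_le_sum (by simp) _ (List.mem_map_of_mem (f := fun e : ℕ × ℕ => e.1 + e.2) he)
  simp only [bchPairs, Finset.mem_erase, Finset.mem_product, Finset.mem_range]
  exact ⟨fun h0 => hv.2 (h0 ▸ he), by omega, by omega⟩

theorem NilpotentFor.bch_mem (hG : NilpotentFor K b G) {x y : V} (hx : x ∈ G) (hy : y ∈ G) :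
    bch K b x y ∈ G := by
  obtain ⟨n, hn⟩ := hG.bch_eq_sum hx hy
  rw [hn n le_rfl]
  exact G.sum_mem fun w _ => G.smul_mem _ (hG.nestedBracket_mem (bchWord_subset hx hy w))

/-- Morphisms of nilpotent Lie algebras respect the Baker-Campbell-Hausdorff product. -/
theorem NilpotentFor.map_bch (hG : NilpotentFor K b G) {V' : Type*} [AddCommGroup V'] [Module K V']
    {b' : V' → V' → V'} {G' : Submodule K V'} (hG' : NilpotentFor K b' G') (f : V →ₗ[K] V')
    (hf : ∀ x y, f (b x y) = b' (f x) (f y)) (hfG : ∀ x ∈ G, f x ∈ G') {x y : V} (hx : x ∈ G)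
    (hy : y ∈ G) : f (bch K b x y) = bch K b' (f x) (f y) := by
  obtain ⟨n, hn⟩ := hG.bch_eq_sum hx hy
  obtain ⟨n', hn'⟩ := hG'.bch_eq_sum (hfG x hx) (hfG y hy)
  rw [hn _ (le_max_left n n'), hn' _ (le_max_right n n'), map_sum]
  refine Finset.sum_congr rfl fun w _ => ?_
  rw [map_smul, map_nestedBracket f (map_zero f) hf, map_bchWord]

/-- A nilpotent representation of `G`: a linear map to an associative algebra which sends brackets
of elements of `G` to commutators and long products of elements of `G` to zero. -/
structure NilpotentRep {U : Type*} [Ring U] [Algebra K U] (b : V → V → V) (G : Submodule K V)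
    (ρ : V →ₗ[K] U) : Prop where
  map_br : ∀ {x y}, x ∈ G → y ∈ G → ρ (b x y) = ρ x * ρ y - ρ y * ρ x
  nil : ∃ n, ∀ l : List V, (∀ x ∈ l, x ∈ G) → n ≤ l.length → (l.map ρ).prod = 0

variable {U : Type*} [Ring U] [Algebra K U] {ρ : V →ₗ[K] U}

theorem NilpotentRep.isNilpotent (hρ : NilpotentRep b G ρ) {x : V} (hx : x ∈ G) :
    IsNilpotent (ρ x) := by
  obtain ⟨n, hn⟩ := hρ.nil
  refine ⟨n, ?_⟩
  simpa using hn (List.replicate n x) (by simp +contextual [hx]) (by simp)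

theorem NilpotentRep.map_nestedBracket (hρ : NilpotentRep b G ρ) (hG : NilpotentFor K b G)
    {l : List V} (hl : ∀ x ∈ l, x ∈ G) : ρ (nestedBracket b l) = nestedBracket comm (l.map ρ) := by
  match l with
  | [] => exact map_zero ρ
  | [x] => rfl
  | x :: y :: l =>
    have h1 : ∀ z ∈ y :: l, z ∈ G := fun z hz => hl z (List.mem_cons_of_mem _ hz)
    have := hρ.map_nestedBracket hG h1
    rw [List.map_cons, List.map_cons, nestedBracket, nestedBracket,
      hρ.map_br (hl x (by simp)) (hG.nestedBracket_mem h1), this, List.map_cons, comm]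

/-- The Baker-Campbell-Hausdorff formula `e ^ ρ(x ∗ y) = e ^ ρ(x) * e ^ ρ(y)`. -/
theorem NilpotentRep.nexp_bch [CharZero K] (hρ : NilpotentRep b G ρ) (hG : NilpotentFor K b G)
    {x y : V} (hx : x ∈ G) (hy : y ∈ G) :
    nexp K (ρ (bch K b x y)) = nexp K (ρ x) * nexp K (ρ y) := by
  obtain ⟨n, hn⟩ := hρ.nil
  have h : ∀ w, n ≤ (bchWord (ρ x) (ρ y) w).length → (bchWord (ρ x) (ρ y) w).prod = 0 := by
    intro w hw
    rw [← map_bchWord ρ] at hw ⊢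
    exact hn _ (bchWord_subset hx hy w) (by simpa using hw)
  obtain ⟨k₁, h₁⟩ := hG.bch_eq_sum hx hy
  obtain ⟨k₂, h₂⟩ := sum_bchCoeff_nestedBracket K h
  have hk := h₂ (max (max k₁ k₂) n) (by omega)
  have hlog : ρ (bch K b x y) = nlog K (max (max k₁ k₂) n) (nexp K (ρ x) * nexp K (ρ y) - 1) := by
    rw [← hk, h₁ (max (max k₁ k₂) n) (by omega), map_sum]
    refine Finset.sum_congr rfl fun w _ => ?_
    rw [map_smul, hρ.map_nestedBracket hG (bchWord_subset hx hy w), map_bchWord]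
  rw [hlog, nexp_nlog K (pow_eq_zero_of_le (by omega) (nexp_mul_sub_one_pow K h)), add_sub_cancel]

end Bch

/-! ### Polynomials with coefficients in a vector space -/

section PolyVec

variable {K : Type u} [Field K] {V W : Type*} [AddCommGroup V] [Module K V] [AddCommGroup W]
  [Module K W]

/-- Evaluation `V[s] → V` at `s = a`, where `V[s] = K[s] ⊗ V`. -/
def evP (a : K) : K[X] ⊗[K] V →ₗ[K] V :=
  (TensorProduct.lid K V).toLinearMap ∘ₗ (Polynomial.leval a).rTensor V

/-- The derivative `d/ds` on `V[s]`. -/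
def derP : K[X] ⊗[K] V →ₗ[K] K[X] ⊗[K] V := (Polynomial.derivative (R := K)).rTensor V

/-- The primitive `∫₀ˢ` on `V[s]`. -/
def intP : K[X] ⊗[K] V →ₗ[K] K[X] ⊗[K] V := (antideriv K).rTensor V

/-- The constant polynomials. -/
def constP : V →ₗ[K] K[X] ⊗[K] V := TensorProduct.mk K K[X] V 1

/-- The extension of a bilinear map to polynomials. -/
def brP (b : V →ₗ[K] V →ₗ[K] V) : K[X] ⊗[K] V →ₗ[K] K[X] ⊗[K] V →ₗ[K] K[X] ⊗[K] V :=
  LinearMap.mk₂ K (fun p q => LinearMap.BilinMap.baseChange K[X] b p q) (by simp)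
    (fun a x y => by simp [LinearMap.map_smul_of_tower]) (by simp)
    (fun a x y => by simp [LinearMap.map_smul_of_tower])

@[simp] theorem evP_tmul (a : K) (r : K[X]) (v : V) : evP a (r ⊗ₜ[K] v) = r.eval a • v := by
  simp [evP]

@[simp] theorem derP_tmul (r : K[X]) (v : V) :
    derP (r ⊗ₜ[K] v) = (Polynomial.derivative r) ⊗ₜ[K] v := rfl

@[simp] theorem intP_tmul (r : K[X]) (v : V) : intP (r ⊗ₜ[K] v) = (antideriv K r) ⊗ₜ[K] v := rfl

theorem constP_apply (v : V) : constP v = (1 : K[X]) ⊗ₜ[K] v := rfl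

@[simp] theorem brP_tmul (b : V →ₗ[K] V →ₗ[K] V) (r r' : K[X]) (v v' : V) :
    brP b (r ⊗ₜ[K] v) (r' ⊗ₜ[K] v') = (r * r') ⊗ₜ[K] b v v' := by
  simp [brP]

theorem antideriv_monomial (n : ℕ) (a : K) :
    antideriv K (Polynomial.monomial n a) = Polynomial.monomial (n + 1) (((n : K) + 1)⁻¹ * a) := by
  rw [antideriv, Polynomial.lsum_apply, Polynomial.sum_monomial_index _ _ (by simp)]
  simp [Polynomial.smul_monomial]

theorem eval_zero_antideriv (r : K[X]) : (antideriv K r).eval 0 = 0 := by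
  induction r using Polynomial.induction_on' with
  | add p q hp hq => simp [hp, hq]
  | monomial n a => simp [antideriv_monomial, Polynomial.eval_monomial]

@[simp] theorem evP_zero_intP (z : K[X] ⊗[K] V) : evP 0 (intP z) = 0 := by
  induction z using TensorProduct.induction_on with
  | zero => simp
  | tmul r v => simp [eval_zero_antideriv]
  | add x y hx hy => simp [hx, hy]

@[simp] theorem evP_constP (a : K) (v : V) : evP a (constP v) = v := by simp [constP]

@[simp] theorem derP_constP (v : V) : derP (constP v : K[X] ⊗[K] V) = 0 := by simp [constP]

theorem evP_brP (b : V →ₗ[K] V →ₗ[K] V) (a : K) (p q : K[X] ⊗[K] V) :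
    evP a (brP b p q) = b (evP a p) (evP a q) := by
  induction p using TensorProduct.induction_on with
  | zero => simp
  | add x y hx hy => simp [hx, hy]
  | tmul r v =>
    induction q using TensorProduct.induction_on with
    | zero => simp
    | add x y hx hy => simp [hx, hy]
    | tmul r' v' => simp [mul_smul, smul_comm (r'.eval a)]

theorem derP_brP (b : V →ₗ[K] V →ₗ[K] V) (p q : K[X] ⊗[K] V) :
    derP (brP b p q) = brP b (derP p) q + brP b p (derP q) := by
  induction p using TensorProduct.induction_on with
  | zero => simp
  | add x y hx hy => simp only [map_add, LinearMap.add_apply, hx, hy]; abel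
  | tmul r v =>
    induction q using TensorProduct.induction_on with
    | zero => simp
    | add x y hx hy => simp only [map_add, hx, hy]; abel
    | tmul r' v' => simp [TensorProduct.add_tmul]

theorem evP_lTensor (f : V →ₗ[K] W) (a : K) (z : K[X] ⊗[K] V) :
    evP a (f.lTensor K[X] z) = f (evP a z) := by
  induction z using TensorProduct.induction_on with
  | zero => simp
  | tmul r v => simp
  | add x y hx hy => simp [hx, hy]

theorem derP_lTensor (f : V →ₗ[K] W) (z : K[X] ⊗[K] V) :
    derP (f.lTensor K[X] z) = f.lTensor K[X] (derP z) := by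
  induction z using TensorProduct.induction_on with
  | zero => simp
  | tmul r v => simp
  | add x y hx hy => simp [hx, hy]

theorem intP_lTensor (f : V →ₗ[K] W) (z : K[X] ⊗[K] V) :
    intP (f.lTensor K[X] z) = f.lTensor K[X] (intP z) := by
  induction z using TensorProduct.induction_on with
  | zero => simp
  | tmul r v => simp
  | add x y hx hy => simp [hx, hy]

theorem lTensor_brP {b : V →ₗ[K] V →ₗ[K] V} {b' : W →ₗ[K] W →ₗ[K] W} (f : V →ₗ[K] W)
    (hf : ∀ x y, f (b x y) = b' (f x) (f y)) (p q : K[X] ⊗[K] V) :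
    f.lTensor K[X] (brP b p q) = brP b' (f.lTensor K[X] p) (f.lTensor K[X] q) := by
  induction p using TensorProduct.induction_on with
  | zero => simp
  | add x y hx hy => simp only [map_add, LinearMap.add_apply, hx, hy]
  | tmul r v =>
    induction q using TensorProduct.induction_on with
    | zero => simp
    | add x y hx hy => simp only [map_add, hx, hy]
    | tmul r' v' => simp [hf]

theorem brP_constP (b : V →ₗ[K] V →ₗ[K] V) (x y : V) :
    brP b (constP x) (constP y) = constP (b x y) := by
  simp [constP]

theorem lTensor_constP (f : V →ₗ[K] W) (x : V) : f.lTensor K[X] (constP x) = constP (f x) := rfl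

/-- The coefficient of `sⁿ`. -/
def coeffP (n : ℕ) : K[X] ⊗[K] V →ₗ[K] V :=
  (TensorProduct.lid K V).toLinearMap ∘ₗ (Polynomial.lcoeff K n).rTensor V

@[simp] theorem coeffP_tmul (n : ℕ) (r : K[X]) (v : V) :
    coeffP n (r ⊗ₜ[K] v) = r.coeff n • v := by simp [coeffP]

theorem exists_eq_sum_coeffP (z : K[X] ⊗[K] V) : ∃ N, ∀ n ≥ N,
    coeffP n z = 0 ∧ z = ∑ i ∈ Finset.range n, (Polynomial.X ^ i : K[X]) ⊗ₜ[K] coeffP i z := by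
  induction z using TensorProduct.induction_on with
  | zero => exact ⟨0, by simp⟩
  | tmul r v =>
    refine ⟨r.natDegree + 1, fun n hn => ⟨?_, ?_⟩⟩
    · rw [coeffP_tmul, Polynomial.coeff_eq_zero_of_natDegree_lt (by omega), zero_smul]
    · conv_lhs => rw [r.as_sum_range_C_mul_X_pow' (n := n) (by omega)]
      rw [TensorProduct.sum_tmul]
      refine Finset.sum_congr rfl fun i _ => ?_
      rw [coeffP_tmul, TensorProduct.tmul_smul, ← Polynomial.smul_eq_C_mul,
          TensorProduct.smul_tmul']
  | add x y hx hy =>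
    obtain ⟨m, hm⟩ := hx
    obtain ⟨n, hn⟩ := hy
    refine ⟨max m n, fun k hk => ?_⟩
    have h1 := hm k (by omega)
    have h2 := hn k (by omega)
    refine ⟨by rw [map_add, h1.1, h2.1, add_zero], ?_⟩
    conv_lhs => rw [h1.2, h2.2]
    rw [← Finset.sum_add_distrib]
    exact Finset.sum_congr rfl fun i _ => by rw [map_add, TensorProduct.tmul_add]

theorem evP_eq_sum {z : K[X] ⊗[K] V} {n : ℕ}
    (h : z = ∑ i ∈ Finset.range n, (Polynomial.X ^ i : K[X]) ⊗ₜ[K] coeffP i z) (a : K) :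
    evP a z = ∑ i ∈ Finset.range n, a ^ i • coeffP i z := by
  conv_lhs => rw [h]
  rw [map_sum]
  exact Finset.sum_congr rfl fun i _ => by simp

theorem coeffP_zero (z : K[X] ⊗[K] V) : coeffP 0 z = evP 0 z := by
  induction z using TensorProduct.induction_on with
  | zero => simp
  | tmul r v => simp [Polynomial.coeff_zero_eq_eval_zero]
  | add x y hx hy => simp [hx, hy]

theorem coeffP_derP (n : ℕ) (z : K[X] ⊗[K] V) :
    coeffP n (derP z) = ((n : K) + 1) • coeffP (n + 1) z := by
  induction z using TensorProduct.induction_on with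
  | zero => simp
  | tmul r v => simp [Polynomial.coeff_derivative, mul_smul, smul_comm (r.coeff (n + 1))]
  | add x y hx hy => simp [hx, hy]

theorem coeffP_lTensor (f : V →ₗ[K] W) (n : ℕ) (z : K[X] ⊗[K] V) :
    coeffP n (f.lTensor K[X] z) = f (coeffP n z) := by
  induction z using TensorProduct.induction_on with
  | zero => simp
  | tmul r v => simp
  | add x y hx hy => simp [hx, hy]

/-- The polynomials with coefficients in a subspace. -/
def partP (P : Submodule K V) : Submodule K (K[X] ⊗[K] V) := coeffPart K[X] ⊤ P

theorem partP_le {P : Submodule K V} {Q : Submodule K (K[X] ⊗[K] V)}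
    (h : ∀ (r : K[X]), ∀ v ∈ P, r ⊗ₜ[K] v ∈ Q) : partP P ≤ Q :=
  Submodule.map₂_le.2 fun r _ v hv => h r v hv

theorem tmul_mem_partP {P : Submodule K V} (r : K[X]) {v : V} (hv : v ∈ P) :
    r ⊗ₜ[K] v ∈ partP P :=
  Submodule.apply_mem_map₂ (TensorProduct.mk K K[X] V) (p := (⊤ : Ideal K[X]).restrictScalars K)
    trivial hv

theorem partP_bot : partP (⊥ : Submodule K V) = ⊥ := by
  rw [eq_bot_iff]
  refine partP_le fun r v hv => ?_
  simp [(Submodule.mem_bot K).1 hv]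

theorem partP_top : partP (⊤ : Submodule K V) = ⊤ := by
  rw [← top_le_iff, ← TensorProduct.map₂_mk_top_top_eq_top]
  exact Submodule.map₂_le.2 fun r _ v _ => tmul_mem_partP r trivial

theorem partP_mono {P Q : Submodule K V} (h : P ≤ Q) : partP P ≤ partP Q :=
  partP_le fun r _ hv => tmul_mem_partP r (h hv)

theorem constP_mem {P : Submodule K V} {v : V} (hv : v ∈ P) : constP v ∈ partP P :=
  tmul_mem_partP 1 hv

theorem evP_mem {P : Submodule K V} {z : K[X] ⊗[K] V} (hz : z ∈ partP P) (a : K) : evP a z ∈ P :=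
  partP_le (Q := P.comap (evP a)) (fun r v hv => by simpa using P.smul_mem _ hv) hz

theorem derP_mem {P : Submodule K V} {z : K[X] ⊗[K] V} (hz : z ∈ partP P) : derP z ∈ partP P :=
  partP_le (Q := (partP P).comap derP) (fun _ _ hv => tmul_mem_partP _ hv) hz

theorem intP_mem {P : Submodule K V} {z : K[X] ⊗[K] V} (hz : z ∈ partP P) : intP z ∈ partP P :=
  partP_le (Q := (partP P).comap intP) (fun _ _ hv => tmul_mem_partP _ hv) hz

theorem lTensor_mem {P : Submodule K V} {Q : Submodule K W} {f : V →ₗ[K] W}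
    (hf : ∀ v ∈ P, f v ∈ Q) {z : K[X] ⊗[K] V} (hz : z ∈ partP P) : f.lTensor K[X] z ∈ partP Q :=
  partP_le (Q := (partP Q).comap (f.lTensor K[X])) (fun _ v hv => tmul_mem_partP _ (hf v hv)) hz

theorem brP_mem {b : V →ₗ[K] V →ₗ[K] V} {P Q R : Submodule K V}
    (h : ∀ x ∈ P, ∀ y ∈ Q, b x y ∈ R) {p q : K[X] ⊗[K] V} (hp : p ∈ partP P) (hq : q ∈ partP Q) :
    brP b p q ∈ partP R := by
  refine partP_le (Q := (partP R).comap ((brP b).flip q)) (fun r x hx => ?_) hp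
  refine partP_le (Q := (partP R).comap (brP b (r ⊗ₜ x))) (fun r' y hy => ?_) hq
  rw [Submodule.mem_comap, brP_tmul]
  exact tmul_mem_partP _ (h x hx y hy)

variable [CharZero K]

theorem derivative_antideriv (r : K[X]) : Polynomial.derivative (antideriv K r) = r := by
  induction r using Polynomial.induction_on' with
  | add p q hp hq => simp [hp, hq]
  | monomial n a =>
    have : (n : K) + 1 ≠ 0 := by exact_mod_cast n.succ_ne_zero
    rw [antideriv_monomial, Polynomial.derivative_monomial]
    simp only [Nat.cast_add, Nat.cast_one, add_tsub_cancel_right]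
    congr 1
    field_simp

theorem antideriv_derivative (r : K[X]) :
    antideriv K (Polynomial.derivative r) = r - Polynomial.C (r.eval 0) := by
  induction r using Polynomial.induction_on' with
  | add p q hp hq => simp only [map_add, hp, hq, Polynomial.eval_add]; ring
  | monomial n a =>
    rcases n with _ | n
    · simp [Polynomial.monomial_zero_left]
    · have : (n : K) + 1 ≠ 0 := by exact_mod_cast n.succ_ne_zero
      rw [Polynomial.derivative_monomial, antideriv_monomial]
      simp [Polynomial.eval_monomial]
      congr 1
      field_simp

@[simp] theorem derP_intP (z : K[X] ⊗[K] V) : derP (intP z) = z := by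
  induction z using TensorProduct.induction_on with
  | zero => simp
  | tmul r v => simp [derivative_antideriv]
  | add x y hx hy => simp [hx, hy]

theorem intP_derP (z : K[X] ⊗[K] V) : intP (derP z) = z - constP (evP 0 z) := by
  induction z using TensorProduct.induction_on with
  | zero => simp
  | tmul r v =>
    simp only [derP_tmul, intP_tmul, antideriv_derivative, evP_tmul, map_smul, constP_apply]
    rw [TensorProduct.sub_tmul, TensorProduct.smul_tmul', Polynomial.smul_eq_C_mul, mul_one]
  | add x y hx hy => simp only [map_add, hx, hy]; abel

/-- Polynomials over an infinite field are determined by their values. -/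
theorem ext_evP {z z' : K[X] ⊗[K] V} (h : ∀ a, evP a z = evP a z') : z = z' := by
  rw [← sub_eq_zero]
  set y := z - z' with hy
  have hy0 : ∀ a, evP a y = 0 := fun a => by rw [hy, map_sub, h, sub_self]
  obtain ⟨n, hn⟩ := exists_eq_sum_coeffP y
  have hs := (hn n le_rfl).2
  rw [hs]
  refine Finset.sum_eq_zero fun i hi => ?_
  suffices coeffP i y = 0 by rw [this, TensorProduct.tmul_zero]
  rw [← Module.forall_dual_apply_eq_zero_iff K]
  intro φ
  have hp : (∑ j ∈ Finset.range n, Polynomial.C (φ (coeffP j y)) * Polynomial.X ^ j : K[X])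
      = 0 := by
    refine Polynomial.funext fun a => ?_
    have := congrArg φ (evP_eq_sum hs a)
    rw [hy0, map_zero, map_sum] at this
    rw [Polynomial.eval_finsetSum, Polynomial.eval_zero, this]
    exact Finset.sum_congr rfl fun j _ => by
      rw [map_smul, smul_eq_mul, Polynomial.eval_mul, Polynomial.eval_C, Polynomial.eval_pow,
        Polynomial.eval_X, mul_comm]
  have := congrArg (fun p => Polynomial.coeff p i) hp
  simpa [Polynomial.finsetSum_coeff, Polynomial.coeff_C_mul, Polynomial.coeff_X_pow,
    Finset.mem_range.1 hi] using this

/-- Uniqueness of solutions of linear differential equations whose operator raises a finite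
filtration. -/
theorem eq_zero_of_derP_eq (F : ℕ → Submodule K V) (h0 : F 0 = ⊤) {n : ℕ} (hn : F n = ⊥)
    (T : K[X] ⊗[K] V → K[X] ⊗[K] V) (hT : ∀ k, ∀ z ∈ partP (F k), T z ∈ partP (F (k + 1)))
    {z : K[X] ⊗[K] V} (hz : derP z = T z) (hz0 : evP 0 z = 0) : z = 0 := by
  have h : ∀ k, z ∈ partP (F k) := by
    intro k
    induction k with
    | zero => rw [h0, partP_top]; trivial
    | succ k ih =>
      have h1 := intP_derP z
      rw [hz0, map_zero, sub_zero] at h1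
      rw [← h1, hz]
      exact intP_mem (hT k z ih)
  have := h n
  rwa [hn, partP_bot, Submodule.mem_bot] at this

end PolyVec

/-! ### Nilpotent differential graded Lie algebras and their affine representations -/

/-- An abstract version of `M ⊗ m_A` inside `M ⊗ A`: a space with a differential, a bracket and a
finite filtration `F` compatible with them, and subspaces `P i` of `F 1` (the pieces `Mⁱ ⊗ m_A`) on
which the laws of a differential graded Lie algebra hold. -/
structure NilDGLA (K : Type u) [Field K] where
  carrier : Type v
  [addCommGroup : AddCommGroup carrier]
  [module : Module K carrier]
  d : carrier →ₗ[K] carrier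
  br : carrier →ₗ[K] carrier →ₗ[K] carrier
  P : ℤ → Submodule K carrier
  F : ℕ → Submodule K carrier
  F_zero : F 0 = ⊤
  F_anti : ∀ {i j}, i ≤ j → F j ≤ F i
  F_nil : ∃ n, F n = ⊥
  P_le : ∀ i, P i ≤ F 1
  d_F : ∀ {k x}, x ∈ F k → d x ∈ F k
  br_F : ∀ {j k x y}, x ∈ F j → y ∈ F k → br x y ∈ F (j + k)
  d_mem : ∀ {i x}, x ∈ P i → d x ∈ P (i + 1)
  d_d : ∀ x, d (d x) = 0
  br_mem : ∀ {i j x y}, x ∈ P i → y ∈ P j → br x y ∈ P (i + j)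
  br_symm : ∀ {i j x y}, x ∈ P i → y ∈ P j → br x y = -((i * j).negOnePow • br y x)
  jacobi : ∀ {i j x y} (z), x ∈ P i → y ∈ P j →
    br x (br y z) = br (br x y) z + (i * j).negOnePow • br y (br x z)
  leibniz : ∀ {i x} (y), x ∈ P i → d (br x y) = br (d x) y + i.negOnePow • br x (d y)

attribute [instance] NilDGLA.addCommGroup NilDGLA.module

instance (K : Type u) [Field K] : CoeSort (NilDGLA.{u, v} K) (Type v) := ⟨NilDGLA.carrier⟩

/-- Subspaces closed under the bracket and contained in the first step of a filtration. -/
theorem NilpotentFor.of_filtration {K : Type u} [Field K] {V : Type*} [AddCommGroup V] [Module K V]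
    {b : V → V → V} {G : Submodule K V} (hb : ∀ {x y}, x ∈ G → y ∈ G → b x y ∈ G)
    (F : ℕ → Submodule K V) {n : ℕ} (hn : ∀ k ≥ n, F k = ⊥) (h1 : G ≤ F 1)
    (hF : ∀ {k x y}, x ∈ G → y ∈ F k → b x y ∈ F (k + 1)) : NilpotentFor K b G where
  closed := hb
  nil := by
    have key : ∀ l : List V, (∀ x ∈ l, x ∈ G) → nestedBracket b l ∈ F l.length := by
      intro l
      induction l with
      | nil => intro _; exact Submodule.zero_mem _
      | cons x l ih =>
        intro hl
        rcases l with _ | ⟨y, l⟩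
        · exact h1 (hl x (by simp))
        · exact hF (hl x (by simp)) (ih fun z hz => hl z (List.mem_cons_of_mem _ hz))
    refine ⟨n, fun l hl hle => ?_⟩
    have := key l hl
    rwa [hn _ hle, Submodule.mem_bot] at this

theorem NilpotentRep.of_filtration {K : Type u} [Field K] {V W : Type*} [AddCommGroup V]
    [Module K V]
    [AddCommGroup W] [Module K W] {b : V → V → V} {G : Submodule K V} {ρ : V →ₗ[K] Module.End K W}
    (hρ : ∀ {x y}, x ∈ G → y ∈ G → ρ (b x y) = ρ x * ρ y - ρ y * ρ x)
    (F : ℕ → Submodule K W) {n : ℕ} (hn : ∀ k ≥ n, F k = ⊥) (h0 : F 0 = ⊤)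
    (hF : ∀ {k x z}, x ∈ G → z ∈ F k → ρ x z ∈ F (k + 1)) : NilpotentRep b G ρ where
  map_br := hρ
  nil := by
    have key : ∀ l : List V, (∀ x ∈ l, x ∈ G) → ∀ z, (l.map ρ).prod z ∈ F l.length := by
      intro l
      induction l with
      | nil => intro _ z; rw [List.length_nil, h0]; trivial
      | cons x l ih =>
        intro hl z
        rw [List.map_cons, List.prod_cons, Module.End.mul_apply]
        exact hF (hl x (by simp)) (ih (fun z hz => hl z (List.mem_cons_of_mem _ hz)) z)
    refine ⟨n, fun l hl hle => LinearMap.ext fun z => ?_⟩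
    have := key l hl z
    rwa [hn _ hle, Submodule.mem_bot] at this

namespace NilDGLA

variable {K : Type u} [Field K] (D : NilDGLA.{u, v} K)

/-- The bracket as a function of two variables. -/
abbrev bra : D → D → D := fun x y => D.br x y

/-- The Baker-Campbell-Hausdorff product. -/
abbrev mul (x y : D) : D := bch K D.bra x y

variable {D}

theorem F_le (k : ℕ) {x y : D} (hx : x ∈ D.F 1) (hy : y ∈ D.F k) : D.br x y ∈ D.F (k + 1) := by
  rw [add_comm]; exact D.br_F hx hy

theorem exists_F_eq_bot : ∃ n, ∀ k ≥ n, D.F k = ⊥ := by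
  obtain ⟨n, hn⟩ := D.F_nil
  exact ⟨n, fun k hk => le_bot_iff.1 (hn ▸ D.F_anti hk)⟩

theorem P_F {i : ℤ} {x : D} (hx : x ∈ D.P i) : x ∈ D.F 1 := D.P_le i hx

theorem br00 {x y : D} (hx : x ∈ D.P 0) (hy : y ∈ D.P 0) : D.br x y ∈ D.P 0 := D.br_mem hx hy

theorem br01 {x y : D} (hx : x ∈ D.P 0) (hy : y ∈ D.P 1) : D.br x y ∈ D.P 1 := by
  simpa using D.br_mem hx hy

theorem br0n {x y : D} (hx : x ∈ D.P 0) (hy : y ∈ D.P (-1)) : D.br x y ∈ D.P (-1) := by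
  simpa using D.br_mem hx hy

theorem brn1 {x y : D} (hx : x ∈ D.P (-1)) (hy : y ∈ D.P 1) : D.br x y ∈ D.P 0 := by
  simpa using D.br_mem hx hy

theorem br1n {x y : D} (hx : x ∈ D.P 1) (hy : y ∈ D.P (-1)) : D.br x y ∈ D.P 0 := by
  simpa using D.br_mem hx hy

theorem d0 {x : D} (hx : x ∈ D.P 0) : D.d x ∈ D.P 1 := D.d_mem hx

theorem dn {x : D} (hx : x ∈ D.P (-1)) : D.d x ∈ D.P 0 := D.d_mem hx

theorem symm0 {j : ℤ} {x y : D} (hx : x ∈ D.P 0) (hy : y ∈ D.P j) : D.br x y = -D.br y x := by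
  simpa using D.br_symm hx hy

theorem symm0' {i : ℤ} {x y : D} (hx : x ∈ D.P i) (hy : y ∈ D.P 0) : D.br x y = -D.br y x := by
  simpa using D.br_symm hx hy

theorem symm11 {x y : D} (hx : x ∈ D.P 1) (hy : y ∈ D.P 1) : D.br x y = D.br y x := by
  simpa using D.br_symm hx hy

theorem symmn1 {x y : D} (hx : x ∈ D.P (-1)) (hy : y ∈ D.P 1) : D.br x y = D.br y x := by
  simpa using D.br_symm hx hy

theorem jac0 {j : ℤ} {x y : D} (hx : x ∈ D.P 0) (hy : y ∈ D.P j) (z : D) :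
    D.br x (D.br y z) = D.br (D.br x y) z + D.br y (D.br x z) := by
  simpa using D.jacobi z hx hy

theorem leib0 {x : D} (hx : x ∈ D.P 0) (y : D) :
    D.d (D.br x y) = D.br (D.d x) y + D.br x (D.d y) := by
  simpa using D.leibniz y hx

theorem leib1 {x : D} (hx : x ∈ D.P 1) (y : D) :
    D.d (D.br x y) = D.br (D.d x) y - D.br x (D.d y) := by
  simpa [sub_eq_add_neg] using D.leibniz y hx

variable (D)

theorem nilpotentFor : NilpotentFor K D.bra (D.P 0) := by
  obtain ⟨n, hn⟩ := D.exists_F_eq_bot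
  exact .of_filtration br00 D.F hn (D.P_le 0) fun hx hy => F_le _ (P_F hx) hy

/-- The affine action of degree zero elements on `V × K` that gives the gauge action: `m` acts as
`(v, κ) ↦ ([m, v] - κ d m, 0)`. -/
def rho : D →ₗ[K] Module.End K (D × K) :=
  LinearMap.mk₂ K (fun m z => (D.br m z.1 - z.2 • D.d m, 0))
    (fun m m' z => by ext <;> simp; abel) (fun a m z => by ext <;> simp [smul_sub, smul_comm z.2 a])
    (fun m z z' => by ext <;> simp [add_smul]; abel)
    (fun a m z => by ext <;> simp [smul_sub, mul_smul])

@[simp] theorem rho_apply (m : D) (z : D × K) : D.rho m z = (D.br m z.1 - z.2 • D.d m, 0) := rfl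

/-- The filtration of `V × K` by `F k × 0`, starting with the full space. -/
def affF : ℕ → Submodule K (D × K)
  | 0 => ⊤
  | k + 1 => (D.F (k + 1)).prod ⊥

theorem rho_affF {m : D} (hm : m ∈ D.F 1) (k : ℕ) {z : D × K} (hz : z ∈ D.affF k) :
    D.rho m z ∈ D.affF (k + 1) := by
  rcases k with _ | k
  · refine ⟨Submodule.sub_mem _ ?_ (Submodule.smul_mem _ _ (D.d_F hm)), Submodule.zero_mem _⟩
    exact F_le 0 hm (by rw [D.F_zero]; trivial)
  · obtain ⟨h1, h2⟩ := hz
    refine ⟨?_, Submodule.zero_mem _⟩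
    rw [SetLike.mem_coe, Submodule.mem_bot] at h2
    simpa [h2] using F_le (k + 1) hm h1

theorem rho_nilpotentRep : NilpotentRep D.bra (D.P 0) D.rho := by
  obtain ⟨n, hn⟩ := D.exists_F_eq_bot
  refine .of_filtration ?_ D.affF (n := n + 1) ?_ rfl fun hx hz => D.rho_affF (P_F hx) _ hz
  · intro x y hx hy
    refine LinearMap.ext fun z => Prod.ext ?_ (by simp)
    simp only [rho_apply, LinearMap.sub_apply, Module.End.mul_apply, Prod.fst_sub, zero_smul,
      sub_zero, map_sub, map_smul, leib0 hx, jac0 hx hy, symm0' (d0 hx) hy]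
    rw [smul_add, smul_neg]
    abel
  · rintro (_ | k) hk
    · omega
    · rw [affF, hn _ (by omega), Submodule.prod_bot]

/-! ### The path object -/

/-- The bracket `[m + c ds, m' + c' ds] = [m, m'] + ([m, c'] - [m', c]) ds` of the degree zero part
of `V[s, ds]`, with `m`, `m'` of degree `0` and `c`, `c'` of degree `-1` in `V`. -/
def pathBr : ((K[X] ⊗[K] D) × (K[X] ⊗[K] D)) → ((K[X] ⊗[K] D) × (K[X] ⊗[K] D)) →
    ((K[X] ⊗[K] D) × (K[X] ⊗[K] D)) :=
  fun u u' => (brP D.br u.1 u'.1, brP D.br u.1 u'.2 - brP D.br u'.1 u.2)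

/-- The degree zero part of `V[s, ds]`. -/
def pathP : Submodule K ((K[X] ⊗[K] D) × (K[X] ⊗[K] D)) := (partP (D.P 0)).prod (partP (D.P (-1)))

/-- The Baker-Campbell-Hausdorff product of `V[s, ds]`. -/
abbrev pathMul (x y : (K[X] ⊗[K] D) × (K[X] ⊗[K] D)) : (K[X] ⊗[K] D) × (K[X] ⊗[K] D) :=
  bch K D.pathBr x y

theorem brP_F {j k : ℕ} {x y : K[X] ⊗[K] D} (hx : x ∈ partP (D.F j)) (hy : y ∈ partP (D.F k)) :
    brP D.br x y ∈ partP (D.F (k + j)) :=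
  brP_mem (fun _ ha _ hb => add_comm j k ▸ D.br_F ha hb) hx hy

theorem partP_F {i : ℤ} {x : K[X] ⊗[K] D} (hx : x ∈ partP (D.P i)) : x ∈ partP (D.F 1) :=
  partP_mono (D.P_le i) hx

theorem path_nilpotentFor : NilpotentFor K D.pathBr D.pathP := by
  obtain ⟨n, hn⟩ := D.exists_F_eq_bot
  refine .of_filtration ?_ (fun k => (partP (D.F k)).prod (partP (D.F k))) (n := n) ?_ ?_ ?_
  · rintro x y ⟨h1, h2⟩ ⟨h3, h4⟩
    exact ⟨brP_mem (fun _ ha _ hb => br00 ha hb) h1 h3,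
      Submodule.sub_mem _ (brP_mem (fun _ ha _ hb => br0n ha hb) h1 h4)
        (brP_mem (fun _ ha _ hb => br0n ha hb) h3 h2)⟩
  · intro k hk
    rw [hn k hk, partP_bot, Submodule.prod_bot]
  · exact Submodule.prod_mono (partP_mono (D.P_le _)) (partP_mono (D.P_le _))
  · rintro k x y ⟨h1, h2⟩ ⟨h3, h4⟩
    refine ⟨D.brP_F (D.partP_F h1) h3, Submodule.sub_mem _ (D.brP_F (D.partP_F h1) h4) ?_⟩
    have := D.brP_F h3 (D.partP_F h2)
    rwa [add_comm] at this

/-- The affine action of `m + c ds` on `V[s, ds] × K` that gives the gauge action; here `(v, w, κ)`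
stands for `v + w ds`. -/
def pathRho : ((K[X] ⊗[K] D) × (K[X] ⊗[K] D)) →ₗ[K]
    Module.End K ((K[X] ⊗[K] D) × (K[X] ⊗[K] D) × K) :=
  LinearMap.mk₂ K (fun u z => (brP D.br u.1 z.1 - z.2.2 • D.d.lTensor K[X] u.1,
      brP D.br u.1 z.2.1 - brP D.br u.2 z.1 - z.2.2 • (D.d.lTensor K[X] u.2 + derP u.1), 0))
    (fun m m' z => by ext <;> simp <;> abel)
    (fun a m z => by ext <;> simp [smul_sub, smul_comm z.2.2 a])
    (fun m z z' => by ext <;> simp [add_smul] <;> abel)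
    (fun a m z => by ext <;> simp [smul_sub, mul_smul])

@[simp] theorem pathRho_apply (u : (K[X] ⊗[K] D) × (K[X] ⊗[K] D))
    (z : (K[X] ⊗[K] D) × (K[X] ⊗[K] D) × K) : D.pathRho u z =
      (brP D.br u.1 z.1 - z.2.2 • D.d.lTensor K[X] u.1,
      brP D.br u.1 z.2.1 - brP D.br u.2 z.1 - z.2.2 • (D.d.lTensor K[X] u.2 + derP u.1), 0) := rfl

/-- The filtration of `V[s, ds] × K`. -/
def pathAffF : ℕ → Submodule K ((K[X] ⊗[K] D) × (K[X] ⊗[K] D) × K)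
  | 0 => ⊤
  | k + 1 => (partP (D.F (k + 1))).prod ((partP (D.F (k + 1))).prod ⊥)

theorem pathRho_affF {m : (K[X] ⊗[K] D) × (K[X] ⊗[K] D)} (hm : m.1 ∈ partP (D.F 1))
    (hm' : m.2 ∈ partP (D.F 1)) (k : ℕ) {z : (K[X] ⊗[K] D) × (K[X] ⊗[K] D) × K}
    (hz : z ∈ D.pathAffF k) : D.pathRho m z ∈ D.pathAffF (k + 1) := by
  have hd : ∀ {x : K[X] ⊗[K] D}, x ∈ partP (D.F 1) → D.d.lTensor K[X] x ∈ partP (D.F 1) :=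
    fun hx => lTensor_mem (fun _ hv => D.d_F hv) hx
  rcases k with _ | k
  · have h0 : ∀ x : K[X] ⊗[K] D, x ∈ partP (D.F 0) := fun x => by
      rw [D.F_zero, partP_top]; trivial
    refine ⟨Submodule.sub_mem _ (D.brP_F hm (h0 _)) (Submodule.smul_mem _ _ (hd hm)),
      Submodule.sub_mem _ (Submodule.sub_mem _ (D.brP_F hm (h0 _)) (D.brP_F hm' (h0 _)))
        (Submodule.smul_mem _ _ (Submodule.add_mem _ (hd hm') (derP_mem hm))),
      Submodule.zero_mem _⟩
  · obtain ⟨h1, h2, h3⟩ := hz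
    rw [SetLike.mem_coe, Submodule.mem_bot] at h3
    refine ⟨?_, ?_, Submodule.zero_mem _⟩
    · simpa [h3] using D.brP_F hm h1
    · simpa [h3] using Submodule.sub_mem _ (D.brP_F hm h2) (D.brP_F hm' h1)

variable {D} in
theorem path_d0 {x : K[X] ⊗[K] D} (hx : x ∈ partP (D.P 0)) :
    D.d.lTensor K[X] x ∈ partP (D.P 1) :=
  lTensor_mem (fun _ hv => d0 hv) hx

section PathLaws

variable {D} [CharZero K]

theorem path_jac0 {j : ℤ} {x y : K[X] ⊗[K] D} (hx : x ∈ partP (D.P 0)) (hy : y ∈ partP (D.P j))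
    (z : K[X] ⊗[K] D) :
    brP D.br x (brP D.br y z) = brP D.br (brP D.br x y) z + brP D.br y (brP D.br x z) :=
  ext_evP fun a => by
    simp only [map_add, evP_brP]
    exact jac0 (evP_mem hx a) (evP_mem hy a) _

theorem path_leib0 {x : K[X] ⊗[K] D} (hx : x ∈ partP (D.P 0)) (y : K[X] ⊗[K] D) :
    D.d.lTensor K[X] (brP D.br x y) =
      brP D.br (D.d.lTensor K[X] x) y + brP D.br x (D.d.lTensor K[X] y) :=
  ext_evP fun a => by
    simp only [map_add, evP_brP, evP_lTensor]
    exact leib0 (evP_mem hx a) _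

theorem path_symm0 {i : ℤ} {x y : K[X] ⊗[K] D} (hx : x ∈ partP (D.P i)) (hy : y ∈ partP (D.P 0)) :
    brP D.br x y = -brP D.br y x :=
  ext_evP fun a => by
    simp only [map_neg, evP_brP]
    exact symm0' (evP_mem hx a) (evP_mem hy a)

theorem path_symmn1 {x y : K[X] ⊗[K] D} (hx : x ∈ partP (D.P (-1))) (hy : y ∈ partP (D.P 1)) :
    brP D.br x y = brP D.br y x :=
  ext_evP fun a => by
    simp only [evP_brP]
    exact symmn1 (evP_mem hx a) (evP_mem hy a)

end PathLaws

theorem pathRho_nilpotentRep [CharZero K] :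
    NilpotentRep (U := Module.End K ((K[X] ⊗[K] D) × (K[X] ⊗[K] D) × K)) D.pathBr D.pathP
      D.pathRho := by
  obtain ⟨n, hn⟩ := D.exists_F_eq_bot
  refine .of_filtration ?_ D.pathAffF (n := n + 1) ?_ rfl
    fun hx hz => D.pathRho_affF (D.partP_F hx.1) (D.partP_F hx.2) _ hz
  · rintro ⟨m, c⟩ ⟨m', c'⟩ ⟨hm, hc⟩ ⟨hm', hc'⟩
    simp only at hm hc hm' hc'
    refine LinearMap.ext fun ⟨v, w, κ⟩ => Prod.ext ?_ (Prod.ext ?_ (by simp))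
    · simp only [pathBr, pathRho_apply, LinearMap.sub_apply, Module.End.mul_apply, Prod.fst_sub,
        zero_smul, sub_zero, map_sub, map_smul, path_leib0 hm, path_jac0 hm hm',
        path_symm0 (path_d0 hm) hm']
      rw [smul_add, smul_neg]
      abel
    · have h1 : brP D.br (D.d.lTensor K[X] m') c = brP D.br c (D.d.lTensor K[X] m') :=
        (path_symmn1 hc (path_d0 hm')).symm
      have h2 : brP D.br (D.d.lTensor K[X] m) c' = brP D.br c' (D.d.lTensor K[X] m) :=
        (path_symmn1 hc' (path_d0 hm)).symm
      simp only [pathBr, pathRho_apply, LinearMap.sub_apply, Module.End.mul_apply, Prod.fst_sub,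
        Prod.snd_sub,
        zero_smul, sub_zero, map_sub, map_smul, map_add, path_leib0 hm, path_leib0 hm',
        path_jac0 hm hm', path_jac0 hm hc', path_jac0 hm' hc, derP_brP, smul_add, smul_sub,
        path_symm0 (derP_mem hm) hm', h1, h2]
      rw [smul_neg]
      abel
  · rintro (_ | k) hk
    · omega
    · rw [pathAffF, hn _ (by omega), partP_bot, Submodule.prod_bot, Submodule.prod_bot]

end NilDGLA

/-! ### Gauge actions and the group law -/

theorem NilpotentFor.mono {K : Type u} [Field K] {V : Type*} [AddCommGroup V] [Module K V]
    {b : V → V → V} {G G' : Submodule K V} (hG : NilpotentFor K b G) (h : G' ≤ G)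
    (hb : ∀ {x y}, x ∈ G' → y ∈ G' → b x y ∈ G') : NilpotentFor K b G' where
  closed := hb
  nil := by
    obtain ⟨n, hn⟩ := hG.nil
    exact ⟨n, fun l hl => hn l fun x hx => h (hl x hx)⟩

namespace NilDGLA

variable {K : Type u} [Field K] (D : NilDGLA.{u, v} K)

/-- The gauge action. -/
abbrev gauge (a x : D) : D := ConeDef.gauge K D.d D.bra a x

/-- The Maurer-Cartan equation. -/
def MC (x : D) : Prop := D.d x + (2⁻¹ : K) • D.br x x = 0

/-- The operator on `V[s, ds] × K` giving the gauge action of `e ^ u`. -/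
def pexp (u : (K[X] ⊗[K] D) × (K[X] ⊗[K] D)) :
    Module.End K ((K[X] ⊗[K] D) × (K[X] ⊗[K] D) × K) := nexp K (D.pathRho u)

variable {D}

theorem isNilpotent_rho {a : D} (ha : a ∈ D.P 0) : IsNilpotent (D.rho a) :=
  D.rho_nilpotentRep.isNilpotent ha

theorem rho_pow_succ (a x : D) (i : ℕ) :
    (D.rho a ^ (i + 1)) (x, 1) = ((D.bra a)^[i] (D.br a x - D.d a), 0) := by
  induction i with
  | zero => simp
  | succ i ih =>
    rw [pow_succ', Module.End.mul_apply, ih, rho_apply, Function.iterate_succ_apply']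
    simp

/-- The gauge action is the exponential of the affine action on the hyperplane `κ = 1`. -/
theorem nexp_rho {a : D} (ha : a ∈ D.P 0) (x : D) :
    nexp K (D.rho a) (x, 1) = (D.gauge a x, 1) := by
  obtain ⟨n, hn⟩ := isNilpotent_rho ha
  have h0 : ∀ i, n ≤ i → (D.bra a)^[i] (D.br a x - D.d a) = 0 := by
    intro i hi
    have h1 := rho_pow_succ a x i
    rw [pow_eq_zero_of_le (by omega) hn] at h1
    exact (congrArg Prod.fst h1).symm
  have hs : ∑ᶠ i : ℕ, ((i + 1).factorial : K)⁻¹ • (D.bra a)^[i] (D.br a x - D.d a) =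
      ∑ i ∈ Finset.range n, ((i + 1).factorial : K)⁻¹ • (D.bra a)^[i] (D.br a x - D.d a) := by
    refine finsum_eq_sum_of_support_subset _ fun i hi => ?_
    by_contra hlt
    exact hi (by simp [h0 i (by simpa using hlt)])
  rw [nexp_apply_eq_sum K (pow_eq_zero_of_le n.le_succ hn), Finset.sum_range_succ', gauge,
    ConeDef.gauge, hs]
  simp only [rho_pow_succ]
  refine Prod.ext ?_ ?_
  · simp [Prod.fst_sum, add_comm]
  · simp [Prod.snd_sum]

theorem gauge_zero (x : D) : D.gauge 0 x = x := by
  have := nexp_rho (D.P 0).zero_mem x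
  rw [map_zero, nexp_zero] at this
  exact (congrArg Prod.fst this).symm

section CharZero

variable [CharZero K]

theorem gauge_neg_gauge {a x : D} (ha : a ∈ D.P 0) : D.gauge (-a) (D.gauge a x) = x := by
  have h1 := nexp_neg_mul_nexp K (isNilpotent_rho ha)
  have h2 := LinearMap.congr_fun h1 (x, 1)
  rw [← map_neg, Module.End.mul_apply, nexp_rho ha, nexp_rho (neg_mem ha)] at h2
  exact congrArg Prod.fst h2

/-- The bilinear form polar to the curvature `κ d v + 1/2 [v, v]`. -/
def mcForm (D : NilDGLA.{u, v} K) : (D × K) →ₗ[K] (D × K) →ₗ[K] D :=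
  LinearMap.mk₂ K (fun z z' => z.2 • D.d z'.1 + z'.2 • D.d z.1 + D.br z.1 z'.1)
    (fun m m' z => by simp [add_smul]; abel)
    (fun a m z => by simp [mul_smul, smul_comm z.2 a])
    (fun m z z' => by simp [add_smul]; abel)
    (fun a m z => by simp [mul_smul, smul_comm m.2 a])

theorem mcForm_apply (z z' : D × K) :
    mcForm D z z' = z.2 • D.d z'.1 + z'.2 • D.d z.1 + D.br z.1 z'.1 := rfl

theorem isNilpotent_br {a : D} (ha : a ∈ D.F 1) : IsNilpotent (D.br a : Module.End K D) := by
  obtain ⟨n, hn⟩ := D.exists_F_eq_bot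
  have h : ∀ k z, ((D.br a : Module.End K D) ^ k) z ∈ D.F k := by
    intro k z
    induction k with
    | zero => rw [D.F_zero]; trivial
    | succ k ih => rw [pow_succ', Module.End.mul_apply]; exact F_le k ha ih
  refine ⟨n, LinearMap.ext fun z => ?_⟩
  have := h n z
  rwa [hn n le_rfl, Submodule.mem_bot] at this

/-- The gauge action preserves the Maurer-Cartan equation: the curvature transforms by
`e ^ [a, -]`. -/
theorem MC_gauge {a x : D} (ha : a ∈ D.P 0) (hx : x ∈ D.P 1) (h : D.MC x) :
    D.MC (D.gauge a x) := by
  have h0 : ∀ y : D, mcForm D (y, 1) (y, 1) = (2 : K) • (D.d y + (2⁻¹ : K) • D.br y y) := by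
    intro y
    simp [mcForm_apply, smul_smul, two_smul]
  have key := bilin_nexp K (isNilpotent_rho ha) (isNilpotent_br (P_F ha)) (mcForm D)
    ((D.P 1).prod ⊤)
    (fun z hz => ⟨Submodule.sub_mem _ (br01 ha hz.1) (Submodule.smul_mem _ _ (d0 ha)), trivial⟩)
    (by
      rintro ⟨v, κ⟩ ⟨hv, -⟩ ⟨v', κ'⟩ ⟨hv', -⟩
      simp only [SetLike.mem_coe] at hv hv'
      simp only [mcForm_apply, rho_apply, zero_smul, map_sub, map_add, map_smul, D.d_d, smul_zero,
        sub_zero, leib0 ha, LinearMap.sub_apply, LinearMap.smul_apply, symm11 hv (d0 ha),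
        jac0 ha hv, smul_add]
      abel)
    (z := (x, 1)) (z' := (x, 1)) ⟨hx, trivial⟩ ⟨hx, trivial⟩
  rw [nexp_rho ha, h0, h0, show D.d x + (2⁻¹ : K) • D.br x x = 0 from h, smul_zero, map_zero,
    smul_eq_zero] at key
  exact key.resolve_left two_ne_zero

theorem isNilpotent_pathRho {u : (K[X] ⊗[K] D) × (K[X] ⊗[K] D)} (hu : u ∈ D.pathP) :
    IsNilpotent (D.pathRho u) :=
  D.pathRho_nilpotentRep.isNilpotent hu

theorem pexp_mul {u u' : (K[X] ⊗[K] D) × (K[X] ⊗[K] D)} (hu : u ∈ D.pathP) (hu' : u' ∈ D.pathP)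
    (z : (K[X] ⊗[K] D) × (K[X] ⊗[K] D) × K) :
    D.pexp (D.pathMul u u') z = D.pexp u (D.pexp u' z) := by
  rw [pexp, D.pathRho_nilpotentRep.nexp_bch D.path_nilpotentFor hu hu']
  rfl

theorem pathMul_mem {u u' : (K[X] ⊗[K] D) × (K[X] ⊗[K] D)} (hu : u ∈ D.pathP)
    (hu' : u' ∈ D.pathP) : D.pathMul u u' ∈ D.pathP :=
  D.path_nilpotentFor.bch_mem hu hu'

theorem mul_mem {x y : D} (hx : x ∈ D.P 0) (hy : y ∈ D.P 0) : D.mul x y ∈ D.P 0 :=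
  D.nilpotentFor.bch_mem hx hy

theorem pexp_neg_pexp {u : (K[X] ⊗[K] D) × (K[X] ⊗[K] D)} (hu : u ∈ D.pathP)
    (z : (K[X] ⊗[K] D) × (K[X] ⊗[K] D) × K) : D.pexp (-u) (D.pexp u z) = z := by
  rw [pexp, pexp, map_neg, ← Module.End.mul_apply, nexp_neg_mul_nexp K (isNilpotent_pathRho hu)]
  rfl

theorem evP_pathMul {u u' : (K[X] ⊗[K] D) × (K[X] ⊗[K] D)} (hu : u ∈ D.pathP) (hu' : u' ∈ D.pathP)
    (a : K) : evP a (D.pathMul u u').1 = D.mul (evP a u.1) (evP a u'.1) :=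
  D.path_nilpotentFor.map_bch D.nilpotentFor (evP a ∘ₗ LinearMap.fst K _ _)
    (fun _ _ => evP_brP _ _ _ _) (fun _ hx => evP_mem hx.1 a) hu hu'

/-! ### Group laws -/

/-- The degree zero paths in `V[s]` that start at zero. -/
def startP (D : NilDGLA.{u, v} K) : Submodule K ((K[X] ⊗[K] D) × (K[X] ⊗[K] D)) :=
  (partP (D.P 0) ⊓ LinearMap.ker (evP 0)).prod ⊥

theorem startP_le : startP D ≤ D.pathP := Submodule.prod_mono inf_le_left bot_le

theorem startP_nilpotentFor : NilpotentFor K D.pathBr (startP D) := by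
  refine D.path_nilpotentFor.mono startP_le ?_
  rintro ⟨x, y⟩ ⟨x', y'⟩ ⟨⟨h1, h2⟩, h3⟩ ⟨⟨h4, h5⟩, h6⟩
  simp only [SetLike.mem_coe, Submodule.mem_bot, LinearMap.mem_ker] at h1 h2 h3 h4 h5 h6
  subst h3 h6
  refine ⟨⟨brP_mem (fun _ ha _ hb => br00 ha hb) h1 h4, ?_⟩, ?_⟩
  · simp [pathBr, evP_brP, h5]
  · simp [pathBr]

/-- The action of the paths starting at zero is faithful, since it detects the derivative. -/
theorem eq_of_pexp_eq {u u' : (K[X] ⊗[K] D) × (K[X] ⊗[K] D)} (hu : u ∈ startP D)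
    (hu' : u' ∈ startP D) (h : ∀ z, D.pexp u z = D.pexp u' z) : u = u' := by
  have h1 : D.pathRho u = D.pathRho u' :=
    nexp_injective K (isNilpotent_pathRho (startP_le hu)) (isNilpotent_pathRho (startP_le hu'))
      (LinearMap.ext h)
  have h2 := congrArg (fun z => z.2.1) (LinearMap.congr_fun h1 (0, 0, 1))
  obtain ⟨⟨-, h4⟩, h5⟩ := hu
  obtain ⟨⟨-, h7⟩, h8⟩ := hu'
  simp only [SetLike.mem_coe, Submodule.mem_bot, LinearMap.mem_ker] at h4 h5 h7 h8
  simp only [pathRho_apply, map_zero, sub_zero, zero_sub, one_smul, h5, h8, zero_add, neg_inj] at h2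
  have h9 := intP_derP u.1
  have h10 := intP_derP u'.1
  rw [h4, map_zero, sub_zero] at h9
  rw [h7, map_zero, sub_zero] at h10
  exact Prod.ext (by rw [← h9, ← h10, h2]) (by rw [h5, h8])

/-- The path `s x`. -/
def lineP (x : D) : (K[X] ⊗[K] D) × (K[X] ⊗[K] D) := ((Polynomial.X : K[X]) ⊗ₜ[K] x, 0)

theorem lineP_mem {x : D} (hx : x ∈ D.P 0) : lineP x ∈ startP D :=
  ⟨⟨tmul_mem_partP _ hx, by simp [lineP]⟩, Submodule.zero_mem _⟩

theorem evP_one_lineP (x : D) : evP 1 (lineP x).1 = x := by simp [lineP]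

/-- Associativity holds for the paths `s x`, on which the affine action is faithful; evaluate at
`s = 1`. The affine action on `V × K` itself need not be faithful. -/
theorem mul_assoc' {x y z : D} (hx : x ∈ D.P 0) (hy : y ∈ D.P 0) (hz : z ∈ D.P 0) :
    D.mul (D.mul x y) z = D.mul x (D.mul y z) := by
  have h1 := lineP_mem hx
  have h2 := lineP_mem hy
  have h3 := lineP_mem hz
  have h12 := startP_nilpotentFor.bch_mem h1 h2
  have h23 := startP_nilpotentFor.bch_mem h2 h3
  have key : D.pathMul (D.pathMul (lineP x) (lineP y)) (lineP z) =
      D.pathMul (lineP x) (D.pathMul (lineP y) (lineP z)) := by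
    refine eq_of_pexp_eq (startP_nilpotentFor.bch_mem h12 h3) (startP_nilpotentFor.bch_mem h1 h23)
      fun t => ?_
    rw [pexp_mul (startP_le h12) (startP_le h3), pexp_mul (startP_le h1) (startP_le h2),
      pexp_mul (startP_le h1) (startP_le h23), pexp_mul (startP_le h2) (startP_le h3)]
  have := congrArg (fun u => evP 1 u.1) key
  rwa [evP_pathMul (startP_le h12) (startP_le h3), evP_pathMul (startP_le h1) (startP_le h2),
    evP_pathMul (startP_le h1) (startP_le h23), evP_pathMul (startP_le h2) (startP_le h3),
    evP_one_lineP, evP_one_lineP, evP_one_lineP] at this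

theorem pexp_zero (z : (K[X] ⊗[K] D) × (K[X] ⊗[K] D) × K) : D.pexp 0 z = z := by
  rw [pexp, map_zero, nexp_zero]; rfl

theorem zero_mul' {x : D} (hx : x ∈ D.P 0) : D.mul 0 x = x := by
  have h1 := lineP_mem hx
  have h0 := (startP D).zero_mem
  have key : D.pathMul 0 (lineP x) = lineP x :=
    eq_of_pexp_eq (startP_nilpotentFor.bch_mem h0 h1) h1 fun t => by
      rw [pexp_mul (startP_le h0) (startP_le h1), pexp_zero]
  have := congrArg (fun u => evP 1 u.1) key
  rwa [evP_pathMul (startP_le h0) (startP_le h1), evP_one_lineP, Prod.fst_zero, map_zero] at this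

theorem mul_zero' {x : D} (hx : x ∈ D.P 0) : D.mul x 0 = x := by
  have h1 := lineP_mem hx
  have h0 := (startP D).zero_mem
  have key : D.pathMul (lineP x) 0 = lineP x :=
    eq_of_pexp_eq (startP_nilpotentFor.bch_mem h1 h0) h1 fun t => by
      rw [pexp_mul (startP_le h1) (startP_le h0), pexp_zero]
  have := congrArg (fun u => evP 1 u.1) key
  rwa [evP_pathMul (startP_le h1) (startP_le h0), evP_one_lineP, Prod.fst_zero, map_zero] at this

theorem neg_mul' {x : D} (hx : x ∈ D.P 0) : D.mul (-x) x = 0 := by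
  have h1 := lineP_mem hx
  have h0 := (startP D).neg_mem h1
  have key : D.pathMul (-lineP x) (lineP x) = 0 :=
    eq_of_pexp_eq (startP_nilpotentFor.bch_mem h0 h1) (startP D).zero_mem fun t => by
      rw [pexp_mul (startP_le h0) (startP_le h1), pexp_neg_pexp (startP_le h1), pexp_zero]
  have := congrArg (fun u => evP 1 u.1) key
  rwa [evP_pathMul (startP_le h0) (startP_le h1), evP_one_lineP, Prod.fst_neg, map_neg,
    evP_one_lineP, Prod.fst_zero, map_zero] at this

theorem mul_neg' {x : D} (hx : x ∈ D.P 0) : D.mul x (-x) = 0 := by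
  simpa using neg_mul' (neg_mem hx)

/-! ### Gauge transformations of paths -/

theorem pathRho_stable {u : (K[X] ⊗[K] D) × (K[X] ⊗[K] D)} (hu : u ∈ D.pathP) :
    ∀ z ∈ (partP (D.P 1)).prod ((partP (D.P 0)).prod (⊤ : Submodule K K)),
      D.pathRho u z ∈ (partP (D.P 1)).prod ((partP (D.P 0)).prod (⊤ : Submodule K K)) := by
  rintro ⟨v, w, κ⟩ ⟨hv, hw, -⟩
  exact ⟨Submodule.sub_mem _ (brP_mem (fun _ ha _ hb => br01 ha hb) hu.1 hv)
      (Submodule.smul_mem _ _ (path_d0 hu.1)),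
    Submodule.sub_mem _ (Submodule.sub_mem _ (brP_mem (fun _ ha _ hb => br00 ha hb) hu.1 hw)
        (brP_mem (fun _ ha _ hb => brn1 ha hb) hu.2 hv))
      (Submodule.smul_mem _ _ (Submodule.add_mem _ (lTensor_mem (fun _ ha => dn ha) hu.2)
        (derP_mem hu.1))), trivial⟩

theorem pexp_mem {u : (K[X] ⊗[K] D) × (K[X] ⊗[K] D)} (hu : u ∈ D.pathP)
    {z : (K[X] ⊗[K] D) × (K[X] ⊗[K] D) × K}
    (hz : z ∈ (partP (D.P 1)).prod ((partP (D.P 0)).prod (⊤ : Submodule K K))) :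
    D.pexp u z ∈ (partP (D.P 1)).prod ((partP (D.P 0)).prod (⊤ : Submodule K K)) :=
  nexp_mem K (isNilpotent_pathRho hu) (pathRho_stable hu) hz

/-- Evaluation of paths is compatible with the gauge action. -/
theorem evP_pexp {u : (K[X] ⊗[K] D) × (K[X] ⊗[K] D)} (hu : u ∈ D.pathP) (a : K)
    (v w : K[X] ⊗[K] D) :
    evP a (D.pexp u (v, w, 1)).1 = D.gauge (evP a u.1) (evP a v) ∧
      (D.pexp u (v, w, 1)).2.2 = 1 := by
  have h := nexp_intertwine K (isNilpotent_pathRho hu) (isNilpotent_rho (evP_mem hu.1 a))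
    ((evP a).prodMap (LinearMap.snd K (K[X] ⊗[K] D) K)) ⊤ (fun _ _ => trivial)
    (fun z _ => by simp [evP_brP, evP_lTensor]) (z := (v, w, 1)) trivial
  simp only [LinearMap.prodMap_apply, LinearMap.snd_apply] at h
  rw [nexp_rho (evP_mem hu.1 a)] at h
  exact ⟨congrArg Prod.fst h, congrArg Prod.snd h⟩

theorem constP_mem_pathP {x : D} (hx : x ∈ D.P 0) : (constP x, 0) ∈ D.pathP :=
  ⟨constP_mem hx, Submodule.zero_mem _⟩

/-- The gauge action on constant paths. -/
theorem pexp_constP {x : D} (hx : x ∈ D.P 0) (v : D) :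
    D.pexp (constP x, 0) (constP v, 0, 1) = (constP (D.gauge x v), 0, 1) := by
  have h := nexp_intertwine K (isNilpotent_rho hx) (isNilpotent_pathRho (constP_mem_pathP hx))
    ((constP ∘ₗ LinearMap.fst K D K).prod (
        (0 : D × K →ₗ[K] K[X] ⊗[K] D).prod (LinearMap.snd K D K)))
    ⊤ (fun _ _ => trivial)
    (fun z _ => by simp [brP_constP, lTensor_constP]) (z := (v, 1)) trivial
  rw [nexp_rho hx] at h
  exact h.symm

/-- The bilinear form polar to the curvature `κ v' - κ d w + [w, v]` of a path `v + w ds`. -/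
def flatForm (D : NilDGLA.{u, v} K) : ((K[X] ⊗[K] D) × (K[X] ⊗[K] D) × K) →ₗ[K]
    ((K[X] ⊗[K] D) × (K[X] ⊗[K] D) × K) →ₗ[K] K[X] ⊗[K] D :=
  LinearMap.mk₂ K (fun z z' => z.2.2 • (derP z'.1 - D.d.lTensor K[X] z'.2.1) +
      z'.2.2 • (derP z.1 - D.d.lTensor K[X] z.2.1) + brP D.br z.2.1 z'.1 + brP D.br z'.2.1 z.1)
    (fun m m' z => by simp [add_smul, smul_sub]; abel)
    (fun a m z => by simp [mul_smul, smul_comm z.2.2 a, smul_sub])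
    (fun m z z' => by simp [add_smul, smul_sub]; abel)
    (fun a m z => by simp [mul_smul, smul_comm m.2.2 a, smul_sub])

theorem flatForm_apply (z z' : (K[X] ⊗[K] D) × (K[X] ⊗[K] D) × K) :
    flatForm D z z' = z.2.2 • (derP z'.1 - D.d.lTensor K[X] z'.2.1) +
      z'.2.2 • (derP z.1 - D.d.lTensor K[X] z.2.1) + brP D.br z.2.1 z'.1 +
          brP D.br z'.2.1 z.1 := rfl

theorem isNilpotent_brP {a : K[X] ⊗[K] D} (ha : a ∈ partP (D.F 1)) :
    IsNilpotent (brP D.br a : Module.End K (K[X] ⊗[K] D)) := by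
  obtain ⟨n, hn⟩ := D.exists_F_eq_bot
  have h : ∀ k z, ((brP D.br a : Module.End K (K[X] ⊗[K] D)) ^ k) z ∈ partP (D.F k) := by
    intro k z
    induction k with
    | zero => rw [D.F_zero, partP_top]; trivial
    | succ k ih => rw [pow_succ', Module.End.mul_apply]; exact D.brP_F ha ih
  refine ⟨n, LinearMap.ext fun z => ?_⟩
  have := h n z
  rwa [hn n le_rfl, partP_bot, Submodule.mem_bot] at this

/-- The gauge transform of a constant path by a path `α` in degree zero is a flat path `X + A ds`:
the curvature `X' - d A + [A, X]` transforms by `e ^ [α, -]`. -/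
theorem flat_pexp {α : K[X] ⊗[K] D} (hα : α ∈ partP (D.P 0)) {x : D} (hx : x ∈ D.P 1) :
    derP (D.pexp (α, 0) (constP x, 0, 1)).1 =
      D.d.lTensor K[X] (D.pexp (α, 0) (constP x, 0, 1)).2.1 -
        brP D.br (D.pexp (α, 0) (constP x, 0, 1)).2.1 (D.pexp (α, 0) (constP x, 0, 1)).1 := by
  have hu : (α, (0 : K[X] ⊗[K] D)) ∈ D.pathP := ⟨hα, Submodule.zero_mem _⟩
  have key := bilin_nexp K (isNilpotent_pathRho hu) (isNilpotent_brP (D.partP_F hα)) (flatForm D)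
    ((partP (D.P 1)).prod ((partP (D.P 0)).prod (⊤ : Submodule K K))) (pathRho_stable hu)
    (by
      rintro ⟨v, w, κ⟩ ⟨hv, hw, -⟩ ⟨v', w', κ'⟩ ⟨hv', hw', -⟩
      simp only [SetLike.mem_coe] at hv hv' hw hw'
      simp only [flatForm_apply, pathRho_apply, zero_smul, map_zero, LinearMap.zero_apply, sub_zero,
        zero_add, map_sub, map_add, map_smul, derP_brP, derP_lTensor,
        path_leib0 hα, LinearMap.sub_apply, LinearMap.smul_apply, smul_add, smul_sub,
        path_jac0 hα hw, path_jac0 hα hw', path_symm0 (path_d0 hα) hw, path_symm0 (path_d0 hα) hw',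
        smul_comm κ κ']
      simp only [smul_neg]
      abel)
    (z := (constP x, 0, 1)) (z' := (constP x, 0, 1)) ⟨constP_mem hx, Submodule.zero_mem _, trivial⟩
    ⟨constP_mem hx, Submodule.zero_mem _, trivial⟩
  have h1 : (D.pexp (α, 0) (constP x, 0, 1)).2.2 = 1 := (evP_pexp hu 0 _ _).2
  change flatForm D (D.pexp (α, 0) (constP x, 0, 1)) (D.pexp (α, 0) (constP x, 0, 1)) = _ at key
  rw [flatForm_apply, flatForm_apply, h1] at key
  simp only [derP_constP, map_zero, LinearMap.zero_apply, sub_zero, smul_zero, add_zero,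
      one_smul] at key
  set X := (D.pexp (α, 0) (constP x, 0, 1)).1
  set A := (D.pexp (α, 0) (constP x, 0, 1)).2.1
  have h2 : (2 : K) • (derP X - D.d.lTensor K[X] A + brP D.br A X) = 0 := by
    rw [← key, two_smul]; abel
  rw [smul_eq_zero] at h2
  have h3 := h2.resolve_left two_ne_zero
  rw [← sub_eq_zero, ← h3]
  abel

end CharZero

end NilDGLA

namespace NilDGLA

variable {K : Type u} [Field K] {D : NilDGLA.{u, v} K} [CharZero K]

theorem pathRho_pow (α v : K[X] ⊗[K] D) (i : ℕ) :
    ((D.pathRho (α, 0) ^ (i + 1)) (v, 0, 1)).2.1 = -(brP D.br α)^[i] (derP α) ∧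
      ((D.pathRho (α, 0) ^ (i + 1)) (v, 0, 1)).2.2 = 0 := by
  induction i with
  | zero => simp
  | succ i ih =>
    rw [pow_succ', Module.End.mul_apply, Function.iterate_succ_apply', ← map_neg, ← ih.1]
    simp [ih.2]

/-- A map that contracts a finite filtration has a fixed point. -/
theorem exists_fixedPoint {W : Type*} [AddCommGroup W] [Module K W] (F : ℕ → Submodule K W) {n : ℕ}
    (hn : F (n + 1) = ⊥) (S : Submodule K W) (hS : S ≤ F 1) (Ψ : W → W) (hΨ : ∀ α ∈ S, Ψ α ∈ S)
    (hF : ∀ k, ∀ α ∈ S, ∀ β ∈ S, α - β ∈ F k → Ψ α - Ψ β ∈ F (k + 1)) : ∃ α ∈ S, Ψ α = α := by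
  have hP : ∀ k, Ψ^[k] 0 ∈ S := by
    intro k
    induction k with
    | zero => exact Submodule.zero_mem _
    | succ k ih => rw [Function.iterate_succ_apply']; exact hΨ _ ih
  have hd : ∀ k, Ψ^[k + 1] 0 - Ψ^[k] 0 ∈ F (k + 1) := by
    intro k
    induction k with
    | zero => simpa using hS (hΨ 0 (Submodule.zero_mem _))
    | succ k ih =>
      rw [Function.iterate_succ_apply', Function.iterate_succ_apply' (n := k)]
      rw [Function.iterate_succ_apply'] at ih
      exact hF _ _ (hΨ _ (hP k)) _ (hP k) ih
  refine ⟨Ψ^[n] 0, hP n, ?_⟩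
  have := hd n
  rwa [hn, Submodule.mem_bot, sub_eq_zero, Function.iterate_succ_apply'] at this

theorem iterate_brP_mem {S : Submodule K (K[X] ⊗[K] D)} {α : K[X] ⊗[K] D}
    (h1 : ∀ z ∈ S, brP D.br α z ∈ S) (h2 : derP α ∈ S) (i : ℕ) :
    (brP D.br α)^[i] (derP α) ∈ S := by
  induction i with
  | zero => exact h2
  | succ i ih => rw [Function.iterate_succ_apply']; exact h1 _ ih

/-- The terms of the series in `pexp_constP_ds` that contain a bracket contract the filtration. -/
theorem iterate_brP_sub_mem {k : ℕ} {α β : K[X] ⊗[K] D} (hα : α ∈ partP (D.P 0))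
    (hβ : β ∈ partP (D.P 0)) (h : α - β ∈ partP (D.F k)) (i : ℕ) :
    (brP D.br α)^[i] (derP α) - (brP D.br β)^[i] (derP β) ∈ partP (D.F k) ∧
      (brP D.br α)^[i + 1] (derP α) - (brP D.br β)^[i + 1] (derP β) ∈ partP (D.F (k + 1)) := by
  have step : ∀ i, (brP D.br α)^[i] (derP α) - (brP D.br β)^[i] (derP β) ∈ partP (D.F k) →
      (brP D.br α)^[i + 1] (derP α) - (brP D.br β)^[i + 1] (derP β) ∈ partP (D.F (k + 1)) := by
    intro i hi
    rw [Function.iterate_succ_apply', Function.iterate_succ_apply']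
    have h1 : brP D.br α ((brP D.br α)^[i] (derP α)) - brP D.br β ((brP D.br β)^[i] (derP β)) =
        brP D.br α ((brP D.br α)^[i] (derP α) - (brP D.br β)^[i] (derP β)) +
          brP D.br (α - β) ((brP D.br β)^[i] (derP β)) := by
      rw [map_sub, map_sub, LinearMap.sub_apply]
      abel
    rw [h1]
    refine Submodule.add_mem _ (D.brP_F (D.partP_F hα) hi) ?_
    have h2 := D.brP_F h (D.partP_F (iterate_brP_mem (S := partP (D.P 0))
      (fun z hz => brP_mem (fun _ ha _ hb => br00 ha hb) hβ hz) (derP_mem hβ) i))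
    rwa [add_comm 1 k] at h2
  induction i with
  | zero =>
    have h0 : (brP D.br α)^[0] (derP α) - (brP D.br β)^[0] (derP β) ∈ partP (D.F k) := by
      rw [Function.iterate_zero, Function.iterate_zero, id, id, ← map_sub]
      exact derP_mem h
    exact ⟨h0, step 0 h0⟩
  | succ i ih =>
    have h0 := partP_mono (D.F_anti k.le_succ) ih.2
    exact ⟨h0, step _ h0⟩

theorem pathRho_pow_eq_zero {n : ℕ} (hn : D.F (n + 1) = ⊥) {α : K[X] ⊗[K] D}
    (hα : α ∈ partP (D.P 0)) : (D.pathRho (α, 0)) ^ (n + 1) = 0 := by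
  have h : ∀ k z, ((D.pathRho (α, 0)) ^ k) z ∈ D.pathAffF k := by
    intro k z
    induction k with
    | zero => trivial
    | succ k ih =>
      rw [pow_succ', Module.End.mul_apply]
      exact D.pathRho_affF (D.partP_F hα) (Submodule.zero_mem _) k ih
  refine LinearMap.ext fun z => ?_
  have := h (n + 1) z
  rw [pathAffF, hn, partP_bot, Submodule.prod_bot, Submodule.prod_bot, Submodule.mem_bot] at this
  exact this

/-- The `ds`-component of the gauge transform of a constant by a path `α` is
`-∑ᵢ [α, -]ⁱ α' / (i + 1)!`. -/
theorem pexp_constP_ds {n : ℕ} (hn : D.F (n + 1 + 1) = ⊥) {α : K[X] ⊗[K] D}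
    (hα : α ∈ partP (D.P 0)) (v : K[X] ⊗[K] D) :
    (D.pexp (α, 0) (v, 0, 1)).2.1 = -(derP α + ∑ i ∈ Finset.range n,
      ((i + 2).factorial : K)⁻¹ • (brP D.br α)^[i + 1] (derP α)) := by
  have h1 : ∀ i, ((D.pathRho (α, 0) ^ (i + 1)) (v, 0, 1)).2.1 = -(brP D.br α)^[i] (derP α) :=
    fun i => (pathRho_pow α v i).1
  rw [pexp, nexp_apply_eq_sum K (pathRho_pow_eq_zero hn hα), Finset.sum_range_succ',
    Finset.sum_range_succ']
  simp only [Prod.snd_add, Prod.fst_add, Prod.snd_sum, Prod.fst_sum, Prod.smul_snd, Prod.smul_fst,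
    h1, pow_zero, Module.End.one_apply, smul_zero, add_zero, Function.iterate_zero, id,
    zero_add, Nat.factorial_one, Nat.cast_one, inv_one, one_smul, smul_neg, Finset.sum_neg_distrib]
  rw [neg_add, add_comm]

/-- Every degree zero polynomial `a` is the `ds`-component of the gauge transform of a constant by a
path `α` starting at zero; `α` is the fixed point of a map contracting the filtration. -/
theorem exists_primitive {a : K[X] ⊗[K] D} (ha : a ∈ partP (D.P 0)) :
    ∃ α ∈ partP (D.P 0), evP 0 α = 0 ∧ ∀ x, (D.pexp (α, 0) (constP x, 0, 1)).2.1 = a := by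
  obtain ⟨n, hn⟩ := D.exists_F_eq_bot
  -- by `pexp_constP_ds` the path `α` has to satisfy `α' = -(a + ∑ᵢ [α, -]ⁱ⁺¹ α' / (i + 2)!)`
  let Ψ : K[X] ⊗[K] D → K[X] ⊗[K] D := fun α =>
    -intP (a + ∑ i ∈ Finset.range n, ((i + 2).factorial : K)⁻¹ • (brP D.br α)^[i + 1] (derP α))
  have hΨP : ∀ α ∈ partP (D.P 0), Ψ α ∈ partP (D.P 0) := fun α hα =>
    Submodule.neg_mem _ (intP_mem (Submodule.add_mem _ ha (Submodule.sum_mem _ fun i _ =>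
      Submodule.smul_mem _ _ (iterate_brP_mem
        (fun z hz => brP_mem (fun _ ha _ hb => br00 ha hb) hα hz) (derP_mem hα) _))))
  have hΨF : ∀ k, ∀ α ∈ partP (D.P 0), ∀ β ∈ partP (D.P 0), α - β ∈ partP (D.F k) →
      Ψ α - Ψ β ∈ partP (D.F (k + 1)) := by
    intro k α hα β hβ h
    have h1 : Ψ α - Ψ β = -intP (∑ i ∈ Finset.range n, ((i + 2).factorial : K)⁻¹ •
        ((brP D.br α)^[i + 1] (derP α) - (brP D.br β)^[i + 1] (derP β))) := by
      simp only [Ψ, smul_sub, Finset.sum_sub_distrib, map_sub, map_add]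
      abel
    rw [h1]
    exact Submodule.neg_mem _ (intP_mem (Submodule.sum_mem _ fun i _ =>
      Submodule.smul_mem _ _ (iterate_brP_sub_mem hα hβ h i).2))
  obtain ⟨α, hα, hfix⟩ := exists_fixedPoint (fun k => partP (D.F k)) (n := n)
    (by rw [hn _ n.le_succ, partP_bot]) (partP (D.P 0)) (partP_mono (D.P_le 0)) Ψ hΨP hΨF
  refine ⟨α, hα, ?_, fun x => ?_⟩
  · rw [← hfix]; simp [Ψ]
  · have hder := congrArg derP hfix
    simp only [Ψ, map_neg, derP_intP] at hder
    rw [pexp_constP_ds (n := n) (hn _ (by omega)) hα]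
    generalize ∑ i ∈ Finset.range n, ((i + 2).factorial : K)⁻¹ • (brP D.br α)^[i + 1] (derP α) = S
      at hder ⊢
    rw [← hder]
    abel

/-- A flat path `x + a ds` is the gauge transform of the constant `x(0)` by a path starting at
zero. -/
theorem exists_gauge_path {x a : K[X] ⊗[K] D} (hx : x ∈ partP (D.P 1)) (ha : a ∈ partP (D.P 0))
    (h : derP x = D.d.lTensor K[X] a - brP D.br a x) :
    ∃ α ∈ partP (D.P 0), evP 0 α = 0 ∧ D.pexp (α, 0) (constP (evP 0 x), 0, 1) = (x, a, 1) := by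
  obtain ⟨α, hα, hα0, hA⟩ := exists_primitive ha
  have hu : (α, (0 : K[X] ⊗[K] D)) ∈ D.pathP := ⟨hα, Submodule.zero_mem _⟩
  refine ⟨α, hα, hα0, ?_⟩
  have h1 := flat_pexp hα (evP_mem hx 0)
  rw [hA] at h1
  have h2 := evP_pexp hu 0 (constP (evP 0 x)) 0
  rw [hα0, evP_constP, gauge_zero] at h2
  obtain ⟨n, hn⟩ := D.F_nil
  have h3 : x - (D.pexp (α, 0) (constP (evP 0 x), 0, 1)).1 = 0 := by
    refine eq_zero_of_derP_eq D.F D.F_zero hn (fun z => -brP D.br a z)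
      (fun k z hz => Submodule.neg_mem _ (D.brP_F (D.partP_F ha) hz)) ?_ ?_
    · rw [map_sub, h, h1, map_sub]; abel
    · rw [map_sub, h2.1, sub_self]
  exact Prod.ext (sub_eq_zero.1 h3).symm (Prod.ext (hA _) h2.2)

end NilDGLA

/-- A morphism of nilpotent differential graded Lie algebras. -/
structure NilDGLAHom {K : Type u} [Field K] (D D' : NilDGLA.{u, v} K) where
  toLin : D →ₗ[K] D'
  map_P : ∀ {i x}, x ∈ D.P i → toLin x ∈ D'.P i
  map_d : ∀ x, toLin (D.d x) = D'.d (toLin x)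
  map_br : ∀ x y, toLin (D.br x y) = D'.br (toLin x) (toLin y)

namespace NilDGLAHom

variable {K : Type u} [Field K] {D D' : NilDGLA.{u, v} K} [CharZero K] (f : NilDGLAHom D D')

/-- The induced map on polynomials. -/
abbrev path : K[X] ⊗[K] D →ₗ[K] K[X] ⊗[K] D' := f.toLin.lTensor K[X]

theorem path_mem {i : ℤ} {x : K[X] ⊗[K] D} (hx : x ∈ partP (D.P i)) : f.path x ∈ partP (D'.P i) :=
  lTensor_mem (fun _ hv => f.map_P hv) hx

theorem path_d (x : K[X] ⊗[K] D) :
    f.path (D.d.lTensor K[X] x) = D'.d.lTensor K[X] (f.path x) :=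
  ext_evP fun a => by simp only [evP_lTensor, f.map_d]

theorem pexp_path {α : K[X] ⊗[K] D} (hα : α ∈ partP (D.P 0)) (v w : K[X] ⊗[K] D) (κ : K) :
    D'.pexp (f.path α, 0) (f.path v, f.path w, κ) =
      (f.path (D.pexp (α, 0) (v, w, κ)).1, f.path (D.pexp (α, 0) (v, w, κ)).2.1,
        (D.pexp (α, 0) (v, w, κ)).2.2) := by
  have h := nexp_intertwine K (NilDGLA.isNilpotent_pathRho (D := D) (u := (α, 0))
      ⟨hα, Submodule.zero_mem _⟩)
    (NilDGLA.isNilpotent_pathRho (D := D') (u := (f.path α, 0)) ⟨f.path_mem hα,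
        Submodule.zero_mem _⟩)
    (f.path.prodMap (f.path.prodMap (LinearMap.id : K →ₗ[K] K))) ⊤ (fun _ _ => trivial)
    (fun z _ => by
      simp [lTensor_brP f.toLin f.map_br, derP_lTensor, ← f.path_d])
    (z := (v, w, κ)) trivial
  exact h.symm

end NilDGLAHom

/-! ### Homotopy and gauge equivalence for a pair of morphisms -/

section Pairs

variable {K : Type u} [Field K] {L M N : NilDGLA.{u, v} K} [CharZero K] (h : NilDGLAHom L M)
  (g : NilDGLAHom N M)

/-- A path in the Maurer-Cartan set of the pair `(h, g)`: Maurer-Cartan elements `x + a ds` of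
`L[s, ds]` and `y + b ds` of `N[s, ds]`, and `m + c ds` of degree zero in `M[s, ds]` with
`g (y + b ds) = e ^ (m + c ds) * h (x + a ds)`. -/
structure PathMC (x a : K[X] ⊗[K] L) (y b : K[X] ⊗[K] N) (m c : K[X] ⊗[K] M) : Prop where
  mem_x : x ∈ partP (L.P 1)
  mem_a : a ∈ partP (L.P 0)
  mem_y : y ∈ partP (N.P 1)
  mem_b : b ∈ partP (N.P 0)
  mem_m : m ∈ partP (M.P 0)
  mem_c : c ∈ partP (M.P (-1))
  mc_x : ∀ s, L.MC (evP s x)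
  mc_y : ∀ s, N.MC (evP s y)
  flat_x : derP x = L.d.lTensor K[X] a - brP L.br a x
  flat_y : derP y = N.d.lTensor K[X] b - brP N.br b y
  gauge : M.pexp (m, c) (h.path x, h.path a, 1) = (g.path y, g.path b, 1)

open NilDGLA

/-- The endpoints of a path are gauge equivalent. The logarithm `u` of
`e ^ (-g β) e ^ (m + c ds) e ^ (h α) e ^ (-m(0))` stabilises `g(y(0))`, where `α` and `β` are the
paths that transport `x(0)` to `x + a ds` and `y(0)` to `y + b ds`. Hence `u = u₀ + u₁ ds`
satisfies `u₀' = -(d u₁ + [u₁, g(y(0))])`, and `u₀(1)` is of the form `d c + [g(y(0)), c]`. -/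
theorem PathMC.gaugeEquiv {x a : K[X] ⊗[K] L} {y b : K[X] ⊗[K] N} {m c : K[X] ⊗[K] M}
    (H : PathMC h g x a y b m c) :
    ∃ a₀ ∈ L.P 0, ∃ b₀ ∈ N.P 0, ∃ c₀ ∈ M.P (-1), evP 1 x = L.gauge a₀ (evP 0 x) ∧
      evP 1 y = N.gauge b₀ (evP 0 y) ∧
      evP 1 m = M.mul (M.mul (M.mul (g.toLin b₀) (M.d c₀ + M.br (g.toLin (evP 0 y)) c₀)) (evP 0 m))
        (-h.toLin a₀) := by
  obtain ⟨α, hα, hα0, hαx⟩ := exists_gauge_path H.mem_x H.mem_a H.flat_x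
  obtain ⟨β, hβ, hβ0, hβy⟩ := exists_gauge_path H.mem_y H.mem_b H.flat_y
  have hm0 : evP 0 m ∈ M.P 0 := evP_mem H.mem_m 0
  have hm1 : evP 1 m ∈ M.P 0 := evP_mem H.mem_m 1
  have u1 : (-g.path β, (0 : K[X] ⊗[K] M)) ∈ M.pathP :=
    ⟨Submodule.neg_mem _ (g.path_mem hβ), Submodule.zero_mem _⟩
  have u2 : (m, c) ∈ M.pathP := ⟨H.mem_m, H.mem_c⟩
  have u3 : (h.path α, (0 : K[X] ⊗[K] M)) ∈ M.pathP := ⟨h.path_mem hα, Submodule.zero_mem _⟩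
  have u4 : (constP (-evP 0 m), (0 : K[X] ⊗[K] M)) ∈ M.pathP := constP_mem_pathP (neg_mem hm0)
  have u12 := pathMul_mem u1 u2
  have u123 := pathMul_mem u12 u3
  have u1234 := pathMul_mem u123 u4
  have hev : ∀ s, evP s (M.pathMul (M.pathMul (M.pathMul (-g.path β, 0) (m, c)) (h.path α, 0))
      (constP (-evP 0 m), 0)).1 =
      M.mul (M.mul (M.mul (-g.toLin (evP s β)) (evP s m)) (h.toLin (evP s α))) (-evP 0 m) := by
    intro s
    rw [evP_pathMul u123 u4, evP_pathMul u12 u3, evP_pathMul u1 u2, map_neg, evP_lTensor,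
      evP_lTensor, evP_constP]
  set U := M.pathMul (M.pathMul (M.pathMul (-g.path β, 0) (m, c)) (h.path α, 0))
    (constP (-evP 0 m), 0) with hU
  have hgy : g.toLin (evP 0 y) = M.gauge (evP 0 m) (h.toLin (evP 0 x)) := by
    have h1 := (evP_pexp u2 0 (h.path x) (h.path a)).1
    rw [H.gauge, evP_lTensor, evP_lTensor] at h1
    exact h1
  -- the four factors carry `g(y(0))` to `h(x(0))`, `h(x + a ds)`, `g(y + b ds)` and `g(y(0))`
  have hfix : M.pexp U (constP (g.toLin (evP 0 y)), 0, 1) = (constP (g.toLin (evP 0 y)), 0, 1) := by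
    have hx := h.pexp_path hα (constP (evP 0 x)) 0 1
    rw [hαx, map_zero] at hx
    have hy := g.pexp_path hβ (constP (evP 0 y)) 0 1
    rw [hβy, map_zero] at hy
    have u1' : (g.path β, (0 : K[X] ⊗[K] M)) ∈ M.pathP := ⟨g.path_mem hβ, Submodule.zero_mem _⟩
    have hneg := pexp_neg_pexp u1' (g.path (constP (evP 0 y)), 0, 1)
    rw [hy, Prod.neg_mk, neg_zero] at hneg
    rw [hU, pexp_mul u123 u4, pexp_constP (neg_mem hm0), hgy, gauge_neg_gauge hm0,
      ← lTensor_constP h.toLin, pexp_mul u12 u3, hx, pexp_mul u1 u2, H.gauge, hneg,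
      ← hgy, lTensor_constP]
  have hker := apply_eq_zero_of_nexp_apply K (isNilpotent_pathRho u1234) hfix
  have hds := congrArg (fun z => z.2.1) hker
  simp only [pathRho_apply, map_zero, zero_sub, one_smul, Prod.snd_zero, Prod.fst_zero] at hds
  have hder : derP U.1 =
      -(M.d.lTensor K[X] U.2 + brP M.br U.2 (constP (g.toLin (evP 0 y)))) := by
    rw [sub_eq_zero, neg_eq_iff_eq_neg] at hds
    rw [hds]; abel
  have hgyP : g.toLin (evP 0 y) ∈ M.P 1 := g.map_P (evP_mem H.mem_y 0)
  -- integrate the differential equation from `0` to `1`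
  have hU0 : evP 0 U.1 = 0 := by
    rw [hev, hα0, hβ0, map_zero, map_zero, neg_zero, zero_mul' hm0, mul_zero' hm0, mul_neg' hm0]
  have hU1 : evP 1 U.1 = M.d (-evP 1 (intP U.2)) +
      M.br (g.toLin (evP 0 y)) (-evP 1 (intP U.2)) := by
    have h1 := intP_derP U.1
    rw [hU0, map_zero, sub_zero] at h1
    have h2 : intP (brP M.br U.2 (constP (g.toLin (evP 0 y)))) =
        (M.br.flip (g.toLin (evP 0 y))).lTensor K[X] (intP U.2) := by
      rw [← intP_lTensor]
      congr 1
      exact ext_evP fun s => by simp only [evP_brP, evP_lTensor, evP_constP, LinearMap.flip_apply]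
    rw [← h1, hder, map_neg, map_add, intP_lTensor, h2, map_neg, map_add, evP_lTensor, evP_lTensor,
      LinearMap.flip_apply, map_neg, map_neg,
      symmn1 (evP_mem (intP_mem u1234.2) 1) hgyP]
    abel
  have hα1 : evP 1 α ∈ L.P 0 := evP_mem hα 1
  have hβ1 : evP 1 β ∈ N.P 0 := evP_mem hβ 1
  refine ⟨evP 1 α, hα1, evP 1 β, hβ1, -evP 1 (intP U.2),
    neg_mem (evP_mem (intP_mem u1234.2) 1), ?_, ?_, ?_⟩
  · have := (evP_pexp (D := L) (u := (α, 0)) ⟨hα, Submodule.zero_mem _⟩ 1 (constP (evP 0 x)) 0).1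
    rwa [hαx, evP_constP] at this
  · have := (evP_pexp (D := N) (u := (β, 0)) ⟨hβ, Submodule.zero_mem _⟩ 1 (constP (evP 0 y)) 0).1
    rwa [hβy, evP_constP] at this
  -- solve the formula for `u₀(1)` for `m(1)`
  · have ha' := h.map_P hα1
    have hb' := g.map_P hβ1
    have e1 := mul_mem (neg_mem hb') hm1
    have e2 := mul_mem e1 ha'
    rw [← hU1, hev, ← mul_assoc' hb' e2 (neg_mem hm0), ← mul_assoc' hb' e1 ha',
      ← mul_assoc' hb' (neg_mem hb') hm1, mul_neg' hb', zero_mul' hm1,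
      mul_assoc' (mul_mem hm1 ha') (neg_mem hm0) hm0, neg_mul' hm0, mul_zero' (mul_mem hm1 ha'),
      mul_assoc' hm1 ha' (neg_mem ha'), mul_neg' ha', mul_zero' hm1]

/-- The square of the twisted differential `d + [y, -]` vanishes for Maurer-Cartan elements `y`. -/
theorem NilDGLA.twisted_d_d {y c : M} (hy : y ∈ M.P 1) (hmc : M.MC y) :
    M.d (M.d c + M.br y c) + M.br y (M.d c + M.br y c) = 0 := by
  have h1 : M.br y (M.br y c) = (2⁻¹ : K) • M.br (M.br y y) c := by
    have h2 := M.jacobi c hy hy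
    have h3 : (2 : K) • M.br y (M.br y c) = M.br (M.br y y) c := by
      rw [two_smul]
      nth_rewrite 1 [h2]
      simp
    rw [← h3, smul_smul, inv_mul_cancel₀ two_ne_zero, one_smul]
  have h4 : M.d y = -((2⁻¹ : K) • M.br y y) := eq_neg_of_add_eq_zero_left hmc
  rw [map_add, map_add, M.d_d, leib1 hy, h1, h4]
  simp only [zero_add, map_neg, map_smul, LinearMap.neg_apply, LinearMap.smul_apply]
  abel

/-- Gauge equivalent triples are the endpoints of a path, namely of the gauge transforms by
`s a`, `s b` and `s T - c ds`. -/
theorem exists_pathMC {x a : L} {y : N} {p : M} {b : N} {c : M} (hx : x ∈ L.P 1)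
    (hy : y ∈ N.P 1) (hp : p ∈ M.P 0) (mcx : L.MC x) (mcy : N.MC y)
    (hgy : g.toLin y = M.gauge p (h.toLin x)) (ha : a ∈ L.P 0) (hb : b ∈ N.P 0)
    (hc : c ∈ M.P (-1)) : ∃ X A Y B m e, PathMC h g X A Y B m e ∧
      evP 0 X = x ∧ evP 0 Y = y ∧ evP 0 m = p ∧ evP 1 X = L.gauge a x ∧ evP 1 Y = N.gauge b y ∧
      evP 1 m = M.mul (M.mul (M.mul (g.toLin b) (M.d c + M.br (g.toLin y) c)) p)
        (-h.toLin a) := by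
  set T := M.d c + M.br (g.toLin y) c with hTdef
  have hgyP : g.toLin y ∈ M.P 1 := g.map_P hy
  have hT : T ∈ M.P 0 := Submodule.add_mem _ (dn hc) (br1n hgyP hc)
  have hα : (lineP a).1 ∈ partP (L.P 0) := tmul_mem_partP _ ha
  have hβ : (lineP b).1 ∈ partP (N.P 0) := tmul_mem_partP _ hb
  have hαL : lineP a ∈ L.pathP := startP_le (lineP_mem ha)
  have hβN : lineP b ∈ N.pathP := startP_le (lineP_mem hb)
  have u1 : (g.path (lineP b).1, (0 : K[X] ⊗[K] M)) ∈ M.pathP :=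
    ⟨g.path_mem hβ, Submodule.zero_mem _⟩
  have u2 : ((Polynomial.X : K[X]) ⊗ₜ[K] T, constP (-c)) ∈ M.pathP :=
    ⟨tmul_mem_partP _ hT, constP_mem (neg_mem hc)⟩
  have u3 : (constP p, (0 : K[X] ⊗[K] M)) ∈ M.pathP := constP_mem_pathP hp
  have u4 : (h.path (lineP a).1, (0 : K[X] ⊗[K] M)) ∈ M.pathP :=
    ⟨h.path_mem hα, Submodule.zero_mem _⟩
  have u4' := neg_mem u4
  have u12 := pathMul_mem u1 u2
  have u123 := pathMul_mem u12 u3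
  have u1234 := pathMul_mem u123 u4'
  have hev : ∀ s, evP s (M.pathMul (M.pathMul (M.pathMul (g.path (lineP b).1, 0)
      ((Polynomial.X : K[X]) ⊗ₜ[K] T, constP (-c))) (constP p, 0)) (-(h.path (lineP a).1, 0))).1 =
      M.mul (M.mul (M.mul (s • g.toLin b) (s • T)) p) (-(s • h.toLin a)) := by
    intro s
    rw [evP_pathMul u123 u4', evP_pathMul u12 u3, evP_pathMul u1 u2]
    simp [lineP]
  set U := M.pathMul (M.pathMul (M.pathMul (g.path (lineP b).1, 0)
      ((Polynomial.X : K[X]) ⊗ₜ[K] T, constP (-c))) (constP p, 0)) (-(h.path (lineP a).1,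
          0)) with hU
  have hX := fun s => evP_pexp hαL s (constP x) 0
  have hY := fun s => evP_pexp hβN s (constP y) 0
  have memX := pexp_mem hαL (z := (constP x, 0, 1)) ⟨constP_mem hx, Submodule.zero_mem _, trivial⟩
  have memY := pexp_mem hβN (z := (constP y, 0, 1)) ⟨constP_mem hy, Submodule.zero_mem _, trivial⟩
  have hlineL : ∀ s, evP s (lineP a).1 = s • a := fun s => by simp [lineP]
  have hlineN : ∀ s, evP s (lineP b).1 = s • b := fun s => by simp [lineP]
  have hgMC : M.MC (g.toLin y) := by
    rw [NilDGLA.MC, ← g.map_d, ← g.map_br, ← map_smul, ← map_add]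
    rw [show N.d y + (2⁻¹ : K) • N.br y y = 0 from mcy, map_zero]
  -- `s T - c ds` stabilises `g(y)`
  have hstab : M.pexp ((Polynomial.X : K[X]) ⊗ₜ[K] T, constP (-c)) (constP (g.toLin y), 0, 1) =
      (constP (g.toLin y), 0, 1) := by
    refine nexp_apply_of_apply_eq_zero K (isNilpotent_pathRho u2) ?_
    refine Prod.ext ?_ (Prod.ext ?_ (by simp))
    · have h1 := NilDGLA.twisted_d_d (c := c) hgyP hgMC
      rw [← hTdef] at h1
      simp only [pathRho_apply, constP_apply, brP_tmul, mul_one, LinearMap.lTensor_tmul, one_smul,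
        ← TensorProduct.tmul_sub, Prod.fst_zero]
      rw [symm0 hT hgyP, ← neg_add', add_comm, h1, neg_zero, TensorProduct.tmul_zero]
    · simp only [pathRho_apply, map_zero, zero_sub, constP_apply, brP_tmul, mul_one,
        LinearMap.lTensor_tmul, one_smul, derP_tmul, Polynomial.derivative_X, Prod.snd_zero,
        Prod.fst_zero, ← TensorProduct.tmul_add]
      rw [map_neg, LinearMap.neg_apply, symmn1 hc hgyP, TensorProduct.tmul_neg, map_neg, neg_neg,
        sub_eq_zero, hTdef]
      congr 1
      abel
  refine ⟨(L.pexp (lineP a) (constP x, 0, 1)).1, (L.pexp (lineP a) (constP x, 0, 1)).2.1,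
    (N.pexp (lineP b) (constP y, 0, 1)).1, (N.pexp (lineP b) (constP y, 0, 1)).2.1, U.1, U.2,
    ⟨memX.1, memX.2.1, memY.1, memY.2.1, u1234.1, u1234.2, fun s => ?_, fun s => ?_,
      flat_pexp hα hx, flat_pexp hβ hy, ?_⟩, ?_, ?_, ?_, ?_, ?_, ?_⟩
  · rw [(hX s).1, hlineL, evP_constP]
    exact MC_gauge (Submodule.smul_mem _ _ ha) hx mcx
  · rw [(hY s).1, hlineN, evP_constP]
    exact MC_gauge (Submodule.smul_mem _ _ hb) hy mcy
  · have h1 := h.pexp_path hα (constP x) 0 1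
    have h2 := g.pexp_path hβ (constP y) 0 1
    have h3 : (L.pexp ((lineP a).1, 0) (constP x, 0, 1)).2.2 = 1 := (hX 0).2
    have h4 : (N.pexp ((lineP b).1, 0) (constP y, 0, 1)).2.2 = 1 := (hY 0).2
    rw [h3, map_zero] at h1
    rw [h4, map_zero] at h2
    have h5 : M.pexp U (h.path (L.pexp (lineP a) (constP x, 0, 1)).1,
        h.path (L.pexp (lineP a) (constP x, 0, 1)).2.1, 1) =
        (g.path (N.pexp (lineP b) (constP y, 0, 1)).1,
          g.path (N.pexp (lineP b) (constP y, 0, 1)).2.1, 1) := by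
      rw [hU, pexp_mul u123 u4']
      refine Eq.trans (congrArg _ (congrArg _ h1.symm)) (Eq.trans ?_ h2)
      rw [pexp_neg_pexp u4, pexp_mul u12 u3, lTensor_constP, pexp_constP hp, ← hgy,
        pexp_mul u1 u2, hstab, lTensor_constP]
    exact h5
  · rw [(hX 0).1, hlineL, zero_smul, NilDGLA.gauge_zero, evP_constP]
  · rw [(hY 0).1, hlineN, zero_smul, NilDGLA.gauge_zero, evP_constP]
  · rw [hev, zero_smul, zero_smul, zero_smul, neg_zero, zero_mul' (Submodule.zero_mem _),
      zero_mul' hp, mul_zero' hp]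
  · rw [(hX 1).1, hlineL, one_smul, evP_constP]
  · rw [(hY 1).1, hlineN, one_smul, evP_constP]
  · rw [hev, one_smul, one_smul, one_smul]

end Pairs

/-! ### The differential equation behind the transferred brackets -/

section Recursion

variable {K : Type u} [Field K] {U V W : Type*} [AddCommGroup U] [Module K U] [AddCommGroup W]
  [Module K W] [AddCommGroup V] [Module K V]

/-- The homotopy `f ↦ t ∫₀¹ f - ∫₀ᵗ f` on `V[t]`. -/
def kP : K[X] ⊗[K] V →ₗ[K] K[X] ⊗[K] V := (homotopyPoly K).rTensor V

/-- The integral `∫₀¹` on `V[t]`. -/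
def integralP : K[X] ⊗[K] V →ₗ[K] V := evP 1 ∘ₗ intP

/-- The affine polynomial `(1 - t) u₀ + t u₁`. -/
def affineP (u₀ u₁ : V) : K[X] ⊗[K] V :=
  (1 - Polynomial.X : K[X]) ⊗ₜ[K] u₀ + (Polynomial.X : K[X]) ⊗ₜ[K] u₁

theorem kP_apply (z : K[X] ⊗[K] V) :
    kP z = (Polynomial.X : K[X]) ⊗ₜ[K] integralP z - intP z := by
  induction z using TensorProduct.induction_on with
  | zero => simp
  | add x y hx hy => simp only [map_add, hx, hy, TensorProduct.tmul_add]; abel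
  | tmul r v =>
    simp [kP, integralP, homotopyPoly, TensorProduct.smul_tmul]

theorem kP_lTensor (f : V →ₗ[K] W) (z : K[X] ⊗[K] V) :
    kP (f.lTensor K[X] z) = f.lTensor K[X] (kP z) := by
  induction z using TensorProduct.induction_on with
  | zero => simp
  | tmul r v => simp [kP]
  | add x y hx hy => simp [hx, hy]

theorem integralP_lTensor (f : V →ₗ[K] W) (z : K[X] ⊗[K] V) :
    integralP (f.lTensor K[X] z) = f (integralP z) := by
  simp [integralP, intP_lTensor, evP_lTensor]

theorem lTensor_affineP (f : V →ₗ[K] W) (u₀ u₁ : V) :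
    f.lTensor K[X] (affineP u₀ u₁) = affineP (f u₀) (f u₁) := by
  simp [affineP]

theorem brP_constP_left (b : V →ₗ[K] V →ₗ[K] V) (x : V) (z : K[X] ⊗[K] V) :
    brP b (constP x) z = (b x).lTensor K[X] z := by
  induction z using TensorProduct.induction_on with
  | zero => simp
  | tmul r v => simp [constP]
  | add x y hx hy => simp only [map_add, hx, hy]

/-- The sequence `p₀, k (T p₀), k (T (k (T p₀))), …`. -/
def iterP (T : U →ₗ[K] U) (p₀ : K[X] ⊗[K] U) : ℕ → K[X] ⊗[K] U
  | 0 => p₀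
  | n + 1 => kP (T.lTensor K[X] (iterP T p₀ n))

theorem lTensor_pow_iterP (T : Module.End K U) (p₀ : K[X] ⊗[K] U) (n : ℕ) :
    iterP T p₀ n = (kP ^ n : Module.End K (K[X] ⊗[K] U)) ((T ^ n).lTensor K[X] p₀) := by
  induction n with
  | zero =>
    change p₀ = (1 : Module.End K U).lTensor K[X] p₀
    rw [Module.End.one_eq_id, LinearMap.lTensor_id_apply]
  | succ n ih =>
    have hc : Commute (kP : Module.End K (K[X] ⊗[K] U)) (T.lTensor K[X]) :=
      LinearMap.ext fun z => kP_lTensor T z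
    have h1 : T.lTensor K[X] ((kP ^ n : Module.End K (K[X] ⊗[K] U)) ((T ^ n).lTensor K[X] p₀)) =
        (kP ^ n : Module.End K (K[X] ⊗[K] U)) (T.lTensor K[X] ((T ^ n).lTensor K[X] p₀)) :=
      (LinearMap.congr_fun (hc.pow_left n).eq _).symm
    rw [iterP, ih, h1, pow_succ', Module.End.mul_apply, pow_succ', Module.End.mul_eq_comp,
      LinearMap.lTensor_comp_apply]

theorem iterP_eq_zero {T : Module.End K U} {n : ℕ} (hT : T ^ n = 0) (p₀ : K[X] ⊗[K] U) {k : ℕ}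
    (hk : n ≤ k) : iterP T p₀ k = 0 := by
  rw [lTensor_pow_iterP, pow_eq_zero_of_le hk hT, LinearMap.lTensor_zero, LinearMap.zero_apply,
    map_zero]

/-- The affine operator `(u, κ) ↦ (T u - κ e, 0)`. -/
def affOp (T : U →ₗ[K] U) (e : U) : Module.End K (U × K) :=
  (T ∘ₗ LinearMap.fst K U K - (LinearMap.toSpanSingleton K U e) ∘ₗ LinearMap.snd K U K).prod 0

@[simp] theorem affOp_apply (T : U →ₗ[K] U) (e : U) (z : U × K) :
    affOp T e z = (T z.1 - z.2 • e, 0) := by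
  simp [affOp]

theorem affOp_pow (T : Module.End K U) (e : U) (z : U × K) (i : ℕ) :
    (affOp T e ^ (i + 1)) z = ((T ^ i) (T z.1 - z.2 • e), 0) := by
  induction i with
  | zero => simp
  | succ i ih =>
    rw [pow_succ', Module.End.mul_apply, ih, affOp_apply, pow_succ', Module.End.mul_apply]
    simp

theorem affOp_pow_eq_zero {T : Module.End K U} {n : ℕ} (hT : T ^ n = 0) (e : U) :
    affOp T e ^ (n + 1) = 0 := by
  refine LinearMap.ext fun z => ?_
  rw [affOp_pow, hT]
  rfl

theorem nexp_affOp {T : Module.End K U} {n : ℕ} (hT : T ^ n = 0) (e u : U) :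
    nexp K (affOp T e) (u, 1) =
      (u + ∑ i ∈ Finset.range n, ((i + 1).factorial : K)⁻¹ • (T ^ i) (T u - e), 1) := by
  rw [nexp_apply_eq_sum K (affOp_pow_eq_zero hT e), Finset.sum_range_succ']
  simp only [affOp_pow]
  refine Prod.ext ?_ ?_
  · simp [Prod.fst_sum, add_comm]
  · simp [Prod.snd_sum]

variable [CharZero K]

/-- A polynomial solution of `Z' = -N Z` satisfies `Z(0) = e ^ N Z(1)`. -/
theorem nexp_evP_one {N : Module.End K W} (hN : IsNilpotent N) {Z : K[X] ⊗[K] W}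
    (hZ : derP Z = -N.lTensor K[X] Z) : nexp K N (evP 1 Z) = evP 0 Z := by
  have hc : ∀ n, coeffP n Z = (n.factorial : K)⁻¹ • ((-N) ^ n) (evP 0 Z) := by
    intro n
    induction n with
    | zero => simp [coeffP_zero]
    | succ n ih =>
      have h1 := congrArg (coeffP n) hZ
      have h0 : ((n : K) + 1) ≠ 0 := by exact_mod_cast n.succ_ne_zero
      rw [coeffP_derP, map_neg, coeffP_lTensor, ih] at h1
      rw [pow_succ', Module.End.mul_apply, Nat.factorial_succ, Nat.cast_mul, mul_inv, mul_smul,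
        LinearMap.neg_apply, smul_neg, ← map_smul, ← h1, smul_smul]
      push_cast
      rw [inv_mul_cancel₀ h0, one_smul]
  obtain ⟨n, hn⟩ := hN.neg
  obtain ⟨m, hm⟩ := exists_eq_sum_coeffP Z
  have h1 : evP 1 Z = nexp K (-N) (evP 0 Z) := by
    rw [nexp_apply_eq_sum K (pow_eq_zero_of_le (le_max_left n m) hn),
      evP_eq_sum (hm _ (le_max_right n m)).2]
    exact Finset.sum_congr rfl fun i _ => by rw [one_pow, one_smul, hc]
  rw [h1, ← Module.End.mul_apply, nexp_mul_nexp_neg K hN]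
  rfl

/-- The sum `P` of the iterates of `p ↦ k (T p)` on `(1 - t) u₀ + t u₁` solves `P' = c - T P`,
`P(0) = u₀`, `P(1) = u₁` for the constant `c = u₁ - u₀ + ∫₀¹ T P`, so that the exponential of
`u ↦ T u - c` carries `u₁` to `u₀`. The equation on the left says that `c = e`. -/
theorem integral_iterP_eq_zero_iff {T : Module.End K U} {n : ℕ} (hT : T ^ n = 0) (e u₀ u₁ : U)
    {k : ℕ} (hk : n ≤ k) :
    e + u₀ - u₁ - ∑ i ∈ Finset.range k,
        integralP (T.lTensor K[X] (iterP T (affineP u₀ u₁) i)) = 0 ↔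
      nexp K (affOp T e) (u₁, 1) = (u₀, 1) := by
  set P := ∑ i ∈ Finset.range k, iterP T (affineP u₀ u₁) i with hP
  have hTP : ∑ i ∈ Finset.range k, integralP (T.lTensor K[X] (iterP T (affineP u₀ u₁) i)) =
      integralP (T.lTensor K[X] P) := by
    rw [hP, map_sum, map_sum]
  rw [hTP]
  -- the sum of the iterates is a fixed point, as the iterates of order `k` and higher vanish
  have hfix : P = affineP u₀ u₁ + kP (T.lTensor K[X] P) := by
    have h1 : kP (T.lTensor K[X] P) = ∑ i ∈ Finset.range k, iterP T (affineP u₀ u₁) (i + 1) := by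
      rw [hP, map_sum, map_sum]
      rfl
    have h2 := Finset.sum_range_succ' (iterP T (affineP u₀ u₁)) k
    rw [Finset.sum_range_succ, iterP_eq_zero hT _ hk, add_zero, ← hP, ← h1] at h2
    exact h2.trans (add_comm _ _)
  obtain ⟨e', he'⟩ : ∃ e', e' = u₁ - u₀ + integralP (T.lTensor K[X] P) := ⟨_, rfl⟩
  have hder : derP P = constP e' - T.lTensor K[X] P := by
    conv_lhs => rw [hfix]
    rw [kP_apply, affineP, map_add, map_add, map_sub, derP_intP, derP_tmul, derP_tmul, derP_tmul,
        he']
    simp only [map_sub, Polynomial.derivative_one, Polynomial.derivative_X, zero_sub, map_add,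
      constP_apply, TensorProduct.neg_tmul]
    abel
  have h0 : evP 0 P = u₀ := by
    rw [hfix, kP_apply]
    simp [affineP]
  have h1 : evP 1 P = u₁ := by
    rw [hfix, kP_apply]
    simp [affineP, integralP]
  have hn := affOp_pow_eq_zero hT
  have hsol : nexp K (affOp T e') (u₁, 1) = (u₀, 1) := by
    -- the path `(P, 1)` in `U × K` solves the linear equation `Z' = -N Z`
    have h2 := nexp_evP_one (N := affOp T e') ⟨_, hn e'⟩
      (Z := (LinearMap.inl K U K).lTensor K[X] P + constP (0, 1)) (by
        rw [map_add, derP_constP, add_zero, derP_lTensor, hder, map_sub, map_add, lTensor_constP,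
          lTensor_constP, ← LinearMap.comp_apply ((affOp T e').lTensor K[X]),
              ← LinearMap.lTensor_comp,
          ← LinearMap.comp_apply (LinearMap.lTensor K[X] _) (T.lTensor K[X]),
              ← LinearMap.lTensor_comp]
        have h3 : affOp T e' ∘ₗ LinearMap.inl K U K = LinearMap.inl K U K ∘ₗ T := by
          ext <;> simp
        have h4 : affOp T e' (0, 1) = -(LinearMap.inl K U K e') := by
          ext <;> simp
        rw [h3, h4, map_neg]
        abel)
    simpa [evP_lTensor, h0, h1] using h2
  have hee : e + u₀ - u₁ - integralP (T.lTensor K[X] P) = e - e' := by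
    rw [he']; abel
  rw [hee, sub_eq_zero]
  constructor
  · rintro rfl
    exact hsol
  · intro h2
    -- `e` is determined by the image `u₀` of `u₁`, since `(e ^ T - 1) / T` is invertible
    have h3 : nexp K (affOp T (e - e')) (0, 1) = (0, 1) := by
      rw [← hsol, nexp_affOp hT, nexp_affOp hT] at h2
      have h4 := congrArg Prod.fst h2
      simp only [add_right_inj] at h4
      rw [nexp_affOp hT]
      refine Prod.ext ?_ rfl
      rw [← sub_eq_zero, ← Finset.sum_sub_distrib] at h4
      simp only [map_zero, zero_sub, zero_add]
      rw [← h4]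
      refine Finset.sum_congr rfl fun i _ => ?_
      rw [← smul_sub, ← map_sub]
      congr 2
      abel
    have h5 := apply_eq_zero_of_nexp_apply K ⟨_, hn (e - e')⟩ h3
    have h6 := congrArg Prod.fst h5
    simp only [affOp_apply, map_zero, one_smul, zero_sub, Prod.fst_zero, neg_eq_zero] at h6
    exact sub_eq_zero.1 h6

end Recursion

namespace NilDGLA

variable {K : Type u} [Field K] [CharZero K] {D : NilDGLA.{u, v} K}

/-- The linear part `(v, w) ↦ ([m, v], [m, w] - [c, v])` of the action of `m + c ds` at a point of
the path. -/
def pairOp (m c : D) : Module.End K (D × D) :=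
  (D.br m ∘ₗ LinearMap.fst K D D).prod
    (D.br m ∘ₗ LinearMap.snd K D D - D.br c ∘ₗ LinearMap.fst K D D)

@[simp] theorem pairOp_apply (m c : D) (z : D × D) :
    pairOp m c z = (D.br m z.1, D.br m z.2 - D.br c z.1) := rfl

theorem exists_pairOp_pow (D : NilDGLA.{u, v} K) :
    ∃ n, ∀ m ∈ D.F 1, ∀ c ∈ D.F 1, pairOp m c ^ n = 0 := by
  obtain ⟨n, hn⟩ := D.exists_F_eq_bot
  refine ⟨n, fun m hm c hc => ?_⟩
  have h : ∀ k z, (pairOp m c ^ k) z ∈ (D.F k).prod (D.F k) := by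
    intro k z
    induction k with
    | zero => rw [D.F_zero]; exact ⟨trivial, trivial⟩
    | succ k ih =>
      rw [pow_succ', Module.End.mul_apply]
      exact ⟨F_le k hm ih.1, Submodule.sub_mem _ (F_le k hm ih.2) (F_le k hc ih.1)⟩
  refine LinearMap.ext fun z => ?_
  have := h n z
  rwa [hn n le_rfl, Submodule.prod_bot, Submodule.mem_bot] at this

theorem isNilpotent_pairOp {m c : D} (hm : m ∈ D.F 1) (hc : c ∈ D.F 1) :
    IsNilpotent (pairOp m c) := by
  obtain ⟨n, hn⟩ := D.exists_pairOp_pow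
  exact ⟨n, hn m hm c hc⟩

theorem isNilpotent_affOp_pairOp {m c : D} (hm : m ∈ D.F 1) (hc : c ∈ D.F 1) (e : D × D) :
    IsNilpotent (affOp (pairOp m c) e) := by
  obtain ⟨n, hn⟩ := isNilpotent_pairOp hm hc
  exact ⟨_, affOp_pow_eq_zero hn e⟩

/-- The pointwise form of the gauge relation for paths: at each `s` the action of `m + c ds`
involves only the values of `m` and `c` and the derivative of `m`, which comes from the differential
`d/ds`. -/
theorem pexp_eq_iff {m c x a y b : K[X] ⊗[K] D} (hm : m ∈ partP (D.P 0))
    (hc : c ∈ partP (D.P (-1))) :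
    D.pexp (m, c) (x, a, 1) = (y, b, 1) ↔ ∀ s : K,
      nexp K (affOp (pairOp (evP s m) (evP s c)) (D.d (evP s m), D.d (evP s c) + evP s (derP m)))
        ((evP s x, evP s a), 1) = ((evP s y, evP s b), 1) := by
  have hu : (m, c) ∈ D.pathP := ⟨hm, hc⟩
  have key : ∀ s : K, nexp K (affOp (pairOp (evP s m) (evP s c))
      (D.d (evP s m), D.d (evP s c) + evP s (derP m))) ((evP s x, evP s a), 1) =
      ((evP s (D.pexp (m, c) (x, a, 1)).1, evP s (D.pexp (m, c) (x, a, 1)).2.1),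
        (D.pexp (m, c) (x, a, 1)).2.2) := by
    intro s
    have h := nexp_intertwine K (isNilpotent_pathRho hu)
      (isNilpotent_affOp_pairOp (P_F (evP_mem hm s)) (P_F (evP_mem hc s))
        (D.d (evP s m), D.d (evP s c) + evP s (derP m)))
      (((evP s ∘ₗ LinearMap.fst K _ _).prod
        (evP s ∘ₗ LinearMap.fst K _ _ ∘ₗ LinearMap.snd K _ _)).prod
        (LinearMap.snd K _ _ ∘ₗ LinearMap.snd K _ _) :
        ((K[X] ⊗[K] D) × (K[X] ⊗[K] D) × K) →ₗ[K] (D × D) × K) ⊤ (fun _ _ => trivial)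
      (fun z _ => by simp [evP_brP, evP_lTensor]) (z := (x, a, 1)) trivial
    exact h.symm
  constructor
  · intro h s
    rw [key, h]
  · intro h
    have h1 : (D.pexp (m, c) (x, a, 1)).2.2 = 1 := (evP_pexp hu 0 x a).2
    have h2 : ∀ s, evP s (D.pexp (m, c) (x, a, 1)).1 = evP s y ∧
        evP s (D.pexp (m, c) (x, a, 1)).2.1 = evP s b := by
      intro s
      have h3 := (key s).symm.trans (h s)
      simp only [Prod.mk.injEq] at h3
      exact h3.1
    exact Prod.ext (ext_evP fun s => (h2 s).1) (Prod.ext (ext_evP fun s => (h2 s).2) h1)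

/-- For a constant path without `ds`-component one recovers the gauge action. -/
theorem nexp_affOp_pairOp_zero {m : D} (hm : m ∈ D.P 0) (x : D) :
    nexp K (affOp (pairOp m 0) (D.d m, 0)) ((x, 0), 1) = ((D.gauge m x, 0), 1) := by
  have h := nexp_intertwine K (isNilpotent_rho hm)
    (isNilpotent_affOp_pairOp (P_F hm) (Submodule.zero_mem _) (D.d m, 0))
    (((LinearMap.inl K D D) ∘ₗ LinearMap.fst K D K).prod (LinearMap.snd K D K)) ⊤
    (fun _ _ => trivial) (fun z _ => by simp) (z := (x, 1)) trivial
  rw [nexp_rho hm] at h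
  exact h.symm

end NilDGLA

/-! ### Scalar extension of multilinear maps -/

section Extension

variable {K : Type u} [Field K] (R : Type w) [CommRing R] [Algebra K R]

variable {C : Type*} [AddCommGroup C] [Module K C] {H : Type*} [AddCommGroup H] [Module K H]
  {W : Type*} [AddCommGroup W] [Module K W]

/-- The extension of a bilinear map to `R ⊗ C` and `R ⊗ H`. -/
def extBilin (B : C →ₗ[K] H →ₗ[K] W) : R ⊗[K] C →ₗ[K] R ⊗[K] H →ₗ[K] R ⊗[K] W :=
  TensorProduct.map₂ (LinearMap.mul K R) B

@[simp] theorem extBilin_tmul (B : C →ₗ[K] H →ₗ[K] W) (r s : R) (x : C) (y : H) :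
    extBilin R B (r ⊗ₜ x) (s ⊗ₜ y) = (r * s) ⊗ₜ B x y := rfl

theorem extBilin_hom {C' H' W' : Type*} [AddCommGroup C'] [Module K C'] [AddCommGroup H']
    [Module K H'] [AddCommGroup W'] [Module K W'] {B : C →ₗ[K] H →ₗ[K] W}
    {B' : C' →ₗ[K] H' →ₗ[K] W'} {φ : C →ₗ[K] C'} {χ : H →ₗ[K] H'} {ψ : W →ₗ[K] W'}
    (hB : ∀ x y, ψ (B x y) = B' (φ x) (χ y)) (x : R ⊗[K] C) (y : R ⊗[K] H) :
    ψ.lTensor R (extBilin R B x y) = extBilin R B' (φ.lTensor R x) (χ.lTensor R y) := by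
  induction x using TensorProduct.induction_on with
  | zero => simp
  | add x x' hx hx' => simp only [map_add, LinearMap.add_apply, hx, hx']
  | tmul r x =>
    induction y using TensorProduct.induction_on with
    | zero => simp
    | add y y' hy hy' => simp only [map_add, hy, hy']
    | tmul s y => simp [hB]

theorem multilinear_ext_tmul {X : Type*} [AddCommGroup X] [Module K X] {n : ℕ}
    {f g : MultilinearMap K (fun _ : Fin n => R ⊗[K] C) X}
    (hfg : ∀ (r : Fin n → R) (x : Fin n → C), f (fun i => r i ⊗ₜ x i) = g (fun i => r i ⊗ₜ x i)) :
    f = g := by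
  induction n with
  | zero =>
    ext z
    have := hfg (fun _ => 0) (fun _ => 0)
    rwa [Subsingleton.elim (fun i : Fin 0 => (0 : R) ⊗ₜ[K] (0 : C)) z] at this
  | succ n ih =>
    have h1 : f.curryLeft = g.curryLeft := by
      refine TensorProduct.ext' fun r x => ih fun r' x' => ?_
      have h2 := hfg (Fin.cons r r') (Fin.cons x x')
      have h3 : (fun i : Fin (n + 1) => (Fin.cons r r' : Fin (n + 1) → R) i ⊗ₜ[K]
          (Fin.cons x x' : Fin (n + 1) → C) i) = Fin.cons (r ⊗ₜ x) (fun i => r' i ⊗ₜ x' i) := by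
        ext i
        refine Fin.cases ?_ (fun j => ?_) i <;> simp
      rw [h3] at h2
      exact h2
    rw [← MultilinearMap.uncurry_curryLeft f, ← MultilinearMap.uncurry_curryLeft g, h1]

variable {R} in
theorem lTensor_comp_eq_zero {V W X : Type*} [AddCommGroup V] [Module K V]
    [AddCommGroup W] [Module K W] [AddCommGroup X] [Module K X] {f : V →ₗ[K] W}
    {f' : W →ₗ[K] X} (hf : f' ∘ₗ f = 0) (z : R ⊗[K] V) :
    f'.lTensor R (f.lTensor R z) = 0 := by
  rw [← LinearMap.lTensor_comp_apply, hf, LinearMap.lTensor_zero, LinearMap.zero_apply]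

variable {R} in
theorem lTensor_comp_eq_self {V W : Type*}
    [AddCommGroup V] [Module K V] [AddCommGroup W] [Module K W]
    {f : V →ₗ[K] W} {f' : W →ₗ[K] V} (hf : f' ∘ₗ f = LinearMap.id) (z : R ⊗[K] V) :
    f'.lTensor R (f.lTensor R z) = z := by
  rw [← LinearMap.lTensor_comp_apply, hf, LinearMap.lTensor_id_apply]

/-- If `ψ (f x) = ∑ᵢ f'ᵢ (ψᵢ₀ x₀, ψᵢ₁ x₁, …)`, then the same holds for the extensions. -/
theorem extend_hom {V V' : Type*} [AddCommGroup V] [Module K V] [AddCommGroup V'] [Module K V']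
    {ι : Type*} (s : Finset ι) {n : ℕ} {f : MultilinearMap K (fun _ : Fin n => V) V}
    {f' : MultilinearMap K (fun _ : Fin n => V') V'} {ψ : V →ₗ[K] V'}
    {ψ' : ι → Fin n → V →ₗ[K] V'} (hf : ∀ x, ψ (f x) = ∑ i ∈ s, f' (fun j => ψ' i j (x j)))
    (z : Fin n → R ⊗[K] V) :
    ψ.lTensor R (extend R n f z) = ∑ i ∈ s, extend R n f' (fun j => (ψ' i j).lTensor R (z j)) := by
  have h1 : (ψ.lTensor R).compMultilinearMap ((extend R n f).restrictScalars K) =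
      ∑ i ∈ s, ((extend R n f').restrictScalars K).compLinearMap
        (fun j => (ψ' i j).lTensor R) := by
    refine multilinear_ext_tmul R fun r x => ?_
    simp [extend_tmul, hf, TensorProduct.tmul_sum]
  have h2 := congrArg (fun F => F z) h1
  simpa using h2

end Extension

section Evaluation

variable {K : Type u} [Field K] {V : Type*} [AddCommGroup V] [Module K V]

theorem evP_extend (a : K) (n : ℕ) (f : MultilinearMap K (fun _ : Fin n => V) V)
    (z : Fin n → K[X] ⊗[K] V) : evP a (extend K[X] n f z) = f (fun j => evP a (z j)) := by
  have h1 : (evP a).compMultilinearMap ((extend K[X] n f).restrictScalars K) =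
      f.compLinearMap (fun _ => evP a) := by
    refine multilinear_ext_tmul K[X] fun r x => ?_
    simp [extend_tmul, Polynomial.eval_prod, MultilinearMap.map_smul_univ]
  exact congrArg (fun F => F z) h1

end Evaluation

section Commute

variable {K : Type u} [Field K] (R : Type w) [CommRing R] [Algebra K R]
  {V W : Type*} [AddCommGroup V] [Module K V] [AddCommGroup W] [Module K W]

/-- The isomorphism `R ⊗ V[s] = (R ⊗ V)[s]`. -/
abbrev swapP : R ⊗[K] (K[X] ⊗[K] V) ≃ₗ[K] K[X] ⊗[K] (R ⊗[K] V) :=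
  TensorProduct.leftComm K R K[X] V

@[simp] theorem swapP_tmul (r : R) (p : K[X]) (x : V) :
    swapP R (r ⊗ₜ[K] (p ⊗ₜ[K] x)) = p ⊗ₜ (r ⊗ₜ x) := rfl

/-- Two linear maps on `R ⊗ V[s]` agree if they do so on pure tensors. -/
theorem ext_tmul_tmul {X : Type*} [AddCommGroup X] [Module K X]
    {f g : R ⊗[K] (K[X] ⊗[K] V) →ₗ[K] X}
    (hfg : ∀ r p x, f (r ⊗ₜ (p ⊗ₜ x)) = g (r ⊗ₜ (p ⊗ₜ x))) : f = g :=
  TensorProduct.ext_threefold' fun r p x => hfg r p x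

theorem swapP_map {g₁ : K[X] →ₗ[K] K[X]} {f : V →ₗ[K] W} (z : R ⊗[K] (K[X] ⊗[K] V)) :
    swapP R ((TensorProduct.map g₁ f).lTensor R z) =
      TensorProduct.map g₁ (f.lTensor R) (swapP R z) := by
  have : (swapP R).toLinearMap ∘ₗ (TensorProduct.map g₁ f).lTensor R =
      TensorProduct.map g₁ (f.lTensor R) ∘ₗ (swapP R).toLinearMap :=
    ext_tmul_tmul R fun r p x => by simp
  exact LinearMap.congr_fun this z

theorem evP_swapP (a : K) (z : R ⊗[K] (K[X] ⊗[K] V)) :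
    evP a (swapP R z) = (evP a).lTensor R z := by
  have : evP a ∘ₗ (swapP R).toLinearMap = (evP a : K[X] ⊗[K] V →ₗ[K] V).lTensor R :=
    ext_tmul_tmul R fun r p x => by simp
  exact LinearMap.congr_fun this z

theorem swapP_brP (b : V →ₗ[K] V →ₗ[K] V) (y z : R ⊗[K] (K[X] ⊗[K] V)) :
    swapP R (extBilin R (brP b) y z) = brP (extBilin R b) (swapP R y) (swapP R z) := by
  have : (extBilin R (brP b)).compr₂ (swapP R).toLinearMap =
      (brP (extBilin R b)).compl₁₂ (swapP R).toLinearMap (swapP R).toLinearMap := by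
    refine ext_tmul_tmul R fun r p x => ext_tmul_tmul R fun r' p' x' => ?_
    simp
  exact LinearMap.congr_fun (LinearMap.congr_fun this y) z

end Commute

/-! ### The nilpotent algebra `L ⊗ A` -/

section CoeffPart

variable {K : Type u} [Field K] (R : Type w) [CommRing R] [Algebra K R]

variable {C : Type*} [AddCommGroup C] [Module K C] {H : Type*} [AddCommGroup H] [Module K H]
  {W : Type*} [AddCommGroup W] [Module K W]

variable {R} in
theorem tmul_mem_coeffPart {I : Ideal R} {S : Submodule K C} {r : R} (hr : r ∈ I) {x : C}
    (hx : x ∈ S) : r ⊗ₜ[K] x ∈ coeffPart R I S :=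
  Submodule.apply_mem_map₂ (TensorProduct.mk K R C) (p := I.restrictScalars K) hr hx

variable {R} in
theorem coeffPart_induction {I : Ideal R} {S : Submodule K C}
    {Q : (z : R ⊗[K] C) → z ∈ coeffPart R I S → Prop} (zero : Q 0 (Submodule.zero_mem _))
    (add : ∀ x y hx hy, Q x hx → Q y hy → Q (x + y) (Submodule.add_mem _ hx hy))
    (tmul : ∀ r (hr : r ∈ I) x (hx : x ∈ S), Q (r ⊗ₜ x) (tmul_mem_coeffPart hr hx))
    {z : R ⊗[K] C} (hz : z ∈ coeffPart R I S) : Q z hz := by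
  have key : ∀ c : K, ∃ h, Q (c • z) h := by
    refine Submodule.span_induction (p := fun z _ => ∀ c : K, ∃ h, Q (c • z) h) ?_
      (fun c => by rw [smul_zero]; exact ⟨_, zero⟩)
      (fun x y _ _ hx hy c => by
        obtain ⟨h1, h2⟩ := hx c
        obtain ⟨h3, h4⟩ := hy c
        rw [smul_add]
        exact ⟨_, add _ _ h1 h3 h2 h4⟩)
      (fun a x _ hx c => by rw [smul_smul]; exact hx _)
      (show z ∈ Submodule.span K (Set.image2 (fun r x => r ⊗ₜ[K] x) I S) by
        rwa [coeffPart, Submodule.map₂_eq_span_image2] at hz)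
    rintro _ ⟨r, hr, x, hx, rfl⟩ c
    rw [← TensorProduct.tmul_smul]
    exact ⟨_, tmul r hr _ (S.smul_mem c hx)⟩
  have := key 1
  simp only [one_smul] at this
  exact this.2

theorem coeffPart_top_top : coeffPart R (⊤ : Ideal R) (⊤ : Submodule K C) = ⊤ := by
  rw [← top_le_iff, ← TensorProduct.map₂_mk_top_top_eq_top]
  exact Submodule.map₂_le.2 fun r _ v _ => tmul_mem_coeffPart Submodule.mem_top Submodule.mem_top

variable {R} in
theorem lTensor_mem_coeffPart {I : Ideal R} {S : Submodule K C} {S' : Submodule K H}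
    {f : C →ₗ[K] H} (hf : ∀ x ∈ S, f x ∈ S') {z : R ⊗[K] C} (hz : z ∈ coeffPart R I S) :
    f.lTensor R z ∈ coeffPart R I S' := by
  induction hz using coeffPart_induction with
  | zero => simp
  | add x y _ _ hx hy => rw [map_add]; exact Submodule.add_mem _ hx hy
  | tmul r hr x hx => exact tmul_mem_coeffPart hr (hf x hx)

variable {R} in
theorem extBilin_mem_coeffPart {I J : Ideal R} {B : C →ₗ[K] H →ₗ[K] W} {S : Submodule K C}
    {S' : Submodule K H} {S'' : Submodule K W} (hB : ∀ x ∈ S, ∀ y ∈ S', B x y ∈ S'')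
    {y : R ⊗[K] C} {z : R ⊗[K] H} (hy : y ∈ coeffPart R I S) (hz : z ∈ coeffPart R J S') :
    extBilin R B y z ∈ coeffPart R (I * J) S'' := by
  induction hy using coeffPart_induction with
  | zero => simp
  | add x y _ _ hx hy => rw [map_add, LinearMap.add_apply]; exact Submodule.add_mem _ hx hy
  | tmul r hr x hx =>
    induction hz using coeffPart_induction with
    | zero => simp
    | add x y _ _ hx hy => rw [map_add]; exact Submodule.add_mem _ hx hy
    | tmul s hs y hy => exact tmul_mem_coeffPart (Ideal.mul_mem_mul hr hs) (hB x hx y hy)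

end CoeffPart

section Nil

variable {K : Type u} [Field K]

theorem lTensor_lTensor_eq {R : Type w} [CommRing R] [Algebra K R] {V : Type v} [AddCommGroup V]
    [Module K V] {f : V →ₗ[K] V} (hf : ∀ x, f (f x) = 0) (z : R ⊗[K] V) :
    f.lTensor R (f.lTensor R z) = 0 := by
  rw [← LinearMap.lTensor_comp_apply, (LinearMap.ext hf : f ∘ₗ f = 0)]
  simp

theorem tmul_negOnePow {R : Type w} [CommRing R] [Algebra K R] {V : Type v} [AddCommGroup V]
    [Module K V] (i : ℤ) (r : R) (x : V) :
    r ⊗ₜ[K] (i.negOnePow • x) = i.negOnePow • (r ⊗ₜ[K] x) := by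
  rcases Int.even_or_odd i with hi | hi
  · simp [Int.negOnePow_even i hi]
  · simp [Int.negOnePow_odd i hi, TensorProduct.tmul_neg]

/-- `L ⊗ A` with the pieces `Lⁱ ⊗ m_A` and the filtration `L ⊗ m_Aᵏ`. -/
abbrev DGLA.nil (L : DGLA.{u, v} K) (A : ArtAlg.{u, w} K) : NilDGLA.{u, max v w} K where
  carrier := A ⊗[K] L
  d := L.d.lTensor A
  br := extBilin A L.br
  P i := L.part A i
  F k := coeffPart A (A.m ^ k) ⊤
  F_zero := by
    rw [pow_zero, Ideal.one_eq_top]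
    exact coeffPart_top_top A.carrier
  F_anti h := coeffPart_mono (Ideal.pow_le_pow_right h) le_rfl
  F_nil := by
    obtain ⟨n, hn⟩ := A.exists_m_pow
    exact ⟨n, by rw [hn]; exact coeffPart_bot _⟩
  P_le i := coeffPart_mono (by simp) le_top
  d_F h := lTensor_mem_coeffPart (fun _ _ => Submodule.mem_top) h
  br_F hx hy := by
    rw [pow_add]
    exact extBilin_mem_coeffPart (fun _ _ _ _ => Submodule.mem_top) hx hy
  d_mem h := lTensor_mem_coeffPart (fun _ hx => L.d_mem hx) h
  d_d := lTensor_lTensor_eq L.d_d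
  br_mem hx hy := coeffPart_mono Ideal.mul_le_left le_rfl
    (extBilin_mem_coeffPart (fun _ hx _ hy => L.br_mem hx hy) hx hy)
  br_symm {i j x y} hx hy := by
    induction hx using coeffPart_induction with
    | zero => simp
    | add x x' _ _ hx hx' =>
      rw [map_add, LinearMap.add_apply, hx, hx', map_add, smul_add, neg_add]
    | tmul r _ x hx =>
      induction hy using coeffPart_induction with
      | zero => simp
      | add y y' _ _ hy hy' =>
        rw [map_add, hy, hy', map_add, LinearMap.add_apply, smul_add, neg_add]
      | tmul s _ y hy =>
        rw [extBilin_tmul, extBilin_tmul, L.br_symm hx hy, TensorProduct.tmul_neg,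
          tmul_negOnePow, mul_comm s r]
  jacobi {i j x y} z hx hy := by
    induction hx using coeffPart_induction with
    | zero => simp
    | add x x' _ _ hx hx' => simp only [map_add, LinearMap.add_apply, hx, hx', smul_add]; abel
    | tmul r _ x hx =>
      induction hy using coeffPart_induction with
      | zero => simp
      | add y y' _ _ hy hy' => simp only [map_add, LinearMap.add_apply, hy, hy', smul_add]; abel
      | tmul s _ y hy =>
        induction z using TensorProduct.induction_on with
        | zero => simp
        | add z z' hz hz' => simp only [map_add, hz, hz', smul_add]; abel
        | tmul t z =>
          simp only [extBilin_tmul]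
          rw [L.jacobi z hx hy, TensorProduct.tmul_add, tmul_negOnePow, mul_assoc,
            mul_left_comm r s t]
  leibniz {i x} y hx := by
    induction hx using coeffPart_induction with
    | zero => simp
    | add x x' _ _ hx hx' => simp only [map_add, LinearMap.add_apply, hx, hx', smul_add]; abel
    | tmul r _ x hx =>
      induction y using TensorProduct.induction_on with
      | zero => simp
      | add z z' hz hz' => simp only [map_add, hz, hz', smul_add]; abel
      | tmul t z =>
        simp only [extBilin_tmul, LinearMap.lTensor_tmul]
        rw [L.leibniz z hx, TensorProduct.tmul_add, tmul_negOnePow]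

variable {L M : DGLA.{u, v} K} (A : ArtAlg.{u, w} K)

theorem DGLA.brA_eq (x y : A ⊗[K] L) : L.brA A x y = extBilin A L.br x y := by
  rw [DGLA.brA]
  induction x using TensorProduct.induction_on with
  | zero => simp
  | add x x' hx hx' => simp only [map_add, LinearMap.add_apply, hx, hx']
  | tmul r x =>
    induction y using TensorProduct.induction_on with
    | zero => simp
    | add y y' hy hy' => simp only [map_add, hy, hy']
    | tmul s y => simp

theorem DGLA.isMC_iff {x : A ⊗[K] L} : L.IsMC A x ↔ x ∈ L.part A 1 ∧ (L.nil A).MC x := by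
  rw [DGLA.IsMC, DGLA.brA_eq]
  rfl

theorem DGLA.gaugeA_eq (a x : A ⊗[K] L) : L.gaugeA A a x = (L.nil A).gauge a x := by
  rw [DGLA.gaugeA, funext₂ (DGLA.brA_eq (L := L) A)]
  rfl

theorem DGLA.mulA_eq (a x : A ⊗[K] L) : L.mulA A a x = (L.nil A).mul a x := by
  rw [DGLA.mulA, funext₂ (DGLA.brA_eq (L := L) A)]

/-- The morphism `L ⊗ A → M ⊗ A` induced by a morphism `L → M`. -/
def DGLAHom.nil (h : DGLAHom L M) : NilDGLAHom (L.nil A) (M.nil A) where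
  toLin := h.toLin.lTensor A
  map_P hx := lTensor_mem_coeffPart (fun _ hx => h.map_gr hx) hx
  map_d x := by
    have := LinearMap.lTensor_comp (A : Type w) h.toLin L.d
    rw [(LinearMap.ext h.map_d : h.toLin ∘ₗ L.d = M.d ∘ₗ h.toLin), LinearMap.lTensor_comp] at this
    exact (LinearMap.congr_fun this x).symm
  map_br x y := extBilin_hom A h.map_br x y

end Nil

/-! ### The brackets of the cone on even elements and their first variation -/

section ConeExtension

variable {K : Type u} [Field K] (R : Type w) [CommRing R] [Algebra K R]
  {L M N : DGLA.{u, v} K} (h : DGLAHom L M) (g : DGLAHom N M)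

theorem consMultilinear_extBilin_tmul {C H W : Type*} [AddCommGroup C] [Module K C]
    [AddCommGroup H] [Module K H] [AddCommGroup W] [Module K W] {n : ℕ}
    {B : C →ₗ[K] H →ₗ[K] W} {m : MultilinearMap K (fun _ : Fin n => C) H}
    {m' : MultilinearMap K (fun _ : Fin n => R ⊗[K] C) (R ⊗[K] H)}
    (hm : ∀ (r : Fin n → R) (x : Fin n → C), m' (fun i => r i ⊗ₜ x i) = (∏ i, r i) ⊗ₜ m x)
    (r : Fin (n + 1) → R) (x : Fin (n + 1) → C) :
    consMultilinear (extBilin R B) m' (fun i => r i ⊗ₜ x i) =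
      (∏ i, r i) ⊗ₜ consMultilinear B m x := by
  rw [consMultilinear_apply, consMultilinear_apply, Fin.prod_univ_succ]
  exact congrArg _ (hm (Fin.tail r) (Fin.tail x))

/-- The extension of `nestedK` to `R ⊗ C`. -/
def nestedExt : (n : ℕ) →
    MultilinearMap K (fun _ : Fin (n + 1) => R ⊗[K] (L × N × M)) (R ⊗[K] PathAmbient L M N)
  | 0 => ((iota h g).lTensor R).compMultilinearMap (MultilinearMap.ofSubsingleton K _ _ (0 : Fin 1)
      LinearMap.id)
  | n + 1 => (homotopyK.lTensor R).compMultilinearMap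
      (consMultilinear (extBilin R (ambientQ₂ ∘ₗ iota h g)) (nestedExt n))

/-- The extension to `R ⊗ C` of `tree` before the application of `π`. -/
def preTreeExt (n : ℕ) :
    MultilinearMap K (fun _ : Fin (n + 2) => R ⊗[K] (L × N × M)) (R ⊗[K] PathAmbient L M N) :=
  consMultilinear (extBilin R (ambientQ₂ ∘ₗ iota h g)) (nestedExt R h g n)

theorem nestedExt_tmul (n : ℕ) (r : Fin (n + 1) → R) (x : Fin (n + 1) → L × N × M) :
    nestedExt R h g n (fun i => r i ⊗ₜ x i) = (∏ i, r i) ⊗ₜ nestedK h g n x := by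
  induction n with
  | zero => simp [nestedExt, nestedK]
  | succ n ih =>
    have := consMultilinear_extBilin_tmul R (B := ambientQ₂ ∘ₗ iota h g) ih r x
    simp only [nestedExt, nestedK, LinearMap.compMultilinearMap_apply, this, LinearMap.lTensor_tmul]

theorem preTreeExt_tmul (n : ℕ) (r : Fin (n + 2) → R) (x : Fin (n + 2) → L × N × M) :
    proj.lTensor R (preTreeExt R h g n (fun i => r i ⊗ₜ x i)) = (∏ i, r i) ⊗ₜ tree h g n x := by
  rw [preTreeExt, consMultilinear_extBilin_tmul R (nestedExt_tmul R h g n)]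
  rfl

theorem extend_coneBracket (n : ℕ) (z : Fin (n + 2) → R ⊗[K] (L × N × M)) :
    extend R (n + 2) (coneBracket h g n) z = ((-1 : K) ^ n / 2) •
      ∑ e : Fin (n + 2) → Fin 2, ∑ σ : Equiv.Perm (Fin (n + 2)), koszulSign σ e •
        proj.lTensor R (preTreeExt R h g n
          (fun i => (shiftedPart (e (σ i))).lTensor R (z (σ i)))) := by
  have hz : ∀ (k : ℤ) (F : MultilinearMap K (fun _ : Fin (n + 2) => R ⊗[K] (L × N × M))
      (R ⊗[K] (L × N × M))) (z : Fin (n + 2) → R ⊗[K] (L × N × M)), (k • F) z = k • F z :=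
    fun _ _ _ => rfl
  have h1 : (extend R (n + 2) (coneBracket h g n)).restrictScalars K = ((-1 : K) ^ n / 2) •
      ∑ e : Fin (n + 2) → Fin 2, ∑ σ : Equiv.Perm (Fin (n + 2)), koszulSign σ e •
        (((proj.lTensor R).compMultilinearMap (preTreeExt R h g n)).compLinearMap
          (fun i => (shiftedPart (e (σ i))).lTensor R)).domDomCongr σ := by
    refine multilinear_ext_tmul R fun r x => ?_
    simp only [MultilinearMap.coe_restrictScalars, extend_tmul, coneBracket, smul_apply, sum_apply,
      MultilinearMap.domDomCongr_apply, MultilinearMap.compLinearMap_apply, TensorProduct.tmul_smul,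
      TensorProduct.tmul_sum]
    congr 1
    refine Finset.sum_congr rfl fun e _ => Finset.sum_congr rfl fun σ _ => ?_
    refine Eq.trans ?_ (hz _ _ _).symm
    simp only [MultilinearMap.domDomCongr_apply, MultilinearMap.compLinearMap_apply,
      LinearMap.lTensor_tmul, LinearMap.compMultilinearMap_apply, preTreeExt_tmul]
    rw [Equiv.prod_comp σ r]
  have h2 := congrArg (fun F => F z) h1
  simpa only [MultilinearMap.coe_restrictScalars, smul_apply, sum_apply, hz,
      MultilinearMap.domDomCongr_apply, MultilinearMap.compLinearMap_apply,
      LinearMap.compMultilinearMap_apply] using h2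

/-- The bracket of homogeneous elements of which at most one is odd in `C[1]`. -/
theorem extend_coneBracket_of_homogeneous (n : ℕ) {z : Fin (n + 2) → R ⊗[K] (L × N × M)}
    {e : Fin (n + 2) → Fin 2}
    (he : ∀ i e', (shiftedPart e').lTensor R (z i) = if e' = e i then z i else 0)
    (hodd : ∀ i j, i ≠ j → e i = 0 ∨ e j = 0) :
    extend R (n + 2) (coneBracket h g n) z = ((-1 : K) ^ n / 2) •
      ∑ σ : Equiv.Perm (Fin (n + 2)),
        proj.lTensor R (preTreeExt R h g n (fun i => z (σ i))) := by
  -- only the parities `e` of the entries themselves contribute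
  rw [extend_coneBracket, Finset.sum_eq_single e]
  · congr 1
    refine Finset.sum_congr rfl fun σ _ => ?_
    have h1 : koszulSign σ e = 1 := by
      refine Finset.prod_eq_one fun i _ => Finset.prod_eq_one fun j _ => ?_
      split_ifs with hij
      · rcases hodd (σ i) (σ j) (σ.injective.ne hij.1.ne) with h0 | h0 <;> simp [h0]
      · rfl
    rw [h1, one_smul]
    simp [he]
  · intro e' _ hne
    obtain ⟨i, hi⟩ := Function.ne_iff.1 hne
    refine Finset.sum_eq_zero fun σ _ => ?_
    rw [(preTreeExt R h g n).map_coord_zero (σ.symm i), map_zero, smul_zero]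
    rw [he, if_neg]
    simpa using hi
  · simp

variable [CharZero K]

theorem shiftedPart_even {p : R ⊗[K] (L × N × M)} (hp : coneSgn.lTensor R p = -p) (e : Fin 2) :
    (shiftedPart e).lTensor R p = if e = 0 then p else 0 := by
  have h2 : (2 : K) ≠ 0 := two_ne_zero
  fin_cases e <;> simp [shiftedPart, LinearMap.lTensor_smul, LinearMap.lTensor_sub, hp,
      ← two_smul K, smul_smul, h2]

theorem shiftedPart_odd {p : R ⊗[K] (L × N × M)} (hp : coneSgn.lTensor R p = p) (e : Fin 2) :
    (shiftedPart e).lTensor R p = if e = 1 then p else 0 := by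
  have h2 : (2 : K) ≠ 0 := two_ne_zero
  fin_cases e <;> simp [shiftedPart, LinearMap.lTensor_smul, LinearMap.lTensor_sub, hp,
      ← two_smul K, smul_smul, h2]

variable {R} in
/-- On an even element of `C[1]` the trees for all permutations agree, and no signs arise. -/
theorem extend_coneBracket_const {p : R ⊗[K] (L × N × M)} (hp : coneSgn.lTensor R p = -p) (n : ℕ) :
    ((n + 2).factorial : K)⁻¹ • extend R (n + 2) (coneBracket h g n) (fun _ => p) =
      ((-1 : K) ^ n / 2) • proj.lTensor R (preTreeExt R h g n (fun _ => p)) := by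
  rw [extend_coneBracket_of_homogeneous R h g n (e := fun _ => 0)
    (fun _ e => shiftedPart_even R hp e) (fun _ _ _ => Or.inl rfl), Finset.sum_const,
    Finset.card_univ, Fintype.card_perm, Fintype.card_fin, ← Nat.cast_smul_eq_nsmul K,
    smul_comm, inv_smul_smul₀ (Nat.cast_ne_zero.2 (Nat.factorial_ne_zero _))]

variable {R} in
/-- The first variation of `extend_coneBracket_const` in an odd direction; with a single odd entry
there are still no Koszul signs. -/
theorem extend_coneBracket_update {p q : R ⊗[K] (L × N × M)} (hp : coneSgn.lTensor R p = -p)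
    (hq : coneSgn.lTensor R q = q) (n : ℕ) :
    ((n + 2).factorial : K)⁻¹ • ∑ i, extend R (n + 2) (coneBracket h g n)
        (Function.update (fun _ => p) i q) =
      ((-1 : K) ^ n / 2) • proj.lTensor R
        (∑ i, preTreeExt R h g n (Function.update (fun _ => p) i q)) := by
  have h1 : ∀ i, extend R (n + 2) (coneBracket h g n) (Function.update (fun _ => p) i q) =
      ((-1 : K) ^ n / 2) • ∑ σ : Equiv.Perm (Fin (n + 2)),
        proj.lTensor R (preTreeExt R h g n (Function.update (fun _ => p) (σ.symm i) q)) := by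
    intro i
    rw [extend_coneBracket_of_homogeneous R h g n (e := Pi.single i 1)]
    · congr 1
      refine Finset.sum_congr rfl fun σ _ => ?_
      congr 2
      ext j
      by_cases hj : σ j = i
      · simp [← hj]
      · rw [Function.update_of_ne hj, Function.update_of_ne]
        rintro rfl
        simp at hj
    · intro j e
      by_cases hj : j = i
      · subst hj
        simpa using shiftedPart_odd R hq e
      · simpa [hj] using shiftedPart_even R hp e
    · intro j k hjk
      by_cases hj : j = i
      · exact Or.inr (Pi.single_eq_of_ne (fun hk => hjk (hj.trans hk.symm)) _)
      · exact Or.inl (Pi.single_eq_of_ne hj _)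
  simp only [h1]
  rw [← Finset.smul_sum, Finset.sum_comm]
  have h2 : ∀ σ : Equiv.Perm (Fin (n + 2)), ∑ i, proj.lTensor R (preTreeExt R h g n
      (Function.update (fun _ => p) (σ.symm i) q)) =
      proj.lTensor R (∑ i, preTreeExt R h g n (Function.update (fun _ => p) i q)) := by
    intro σ
    rw [map_sum]
    exact Equiv.sum_comp σ.symm (fun i => proj.lTensor R (preTreeExt R h g n
      (Function.update (fun _ => p) i q)))
  simp only [h2]
  rw [Finset.sum_const,
    Finset.card_univ, Fintype.card_perm, Fintype.card_fin, ← Nat.cast_smul_eq_nsmul K,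
    smul_comm, inv_smul_smul₀ (Nat.cast_ne_zero.2 (Nat.factorial_ne_zero _))]

end ConeExtension

/-! ### Components -/

section Components

variable {K : Type u} [Field K] [CharZero K] (A : ArtAlg.{u, w} K)
  {L M N : DGLA.{u, v} K} (h : DGLAHom L M) (g : DGLAHom N M)

theorem extBilin_hom_add {R : Type w} [CommRing R] [Algebra K R]
    {C H W C₁ H₁ C₂ H₂ W' : Type*} [AddCommGroup C] [Module K C]
    [AddCommGroup H] [Module K H] [AddCommGroup W] [Module K W] [AddCommGroup C₁] [Module K C₁]
    [AddCommGroup H₁] [Module K H₁] [AddCommGroup C₂] [Module K C₂] [AddCommGroup H₂] [Module K H₂]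
    [AddCommGroup W'] [Module K W'] {B : C →ₗ[K] H →ₗ[K] W}
    {B₁ : C₁ →ₗ[K] H₁ →ₗ[K] W'} {B₂ : C₂ →ₗ[K] H₂ →ₗ[K] W'} {φ₁ : C →ₗ[K] C₁} {χ₁ : H →ₗ[K] H₁}
    {φ₂ : C →ₗ[K] C₂} {χ₂ : H →ₗ[K] H₂} {ψ : W →ₗ[K] W'}
    (hB : ∀ x y, ψ (B x y) = B₁ (φ₁ x) (χ₁ y) + B₂ (φ₂ x) (χ₂ y)) (x : R ⊗[K] C) (y : R ⊗[K] H) :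
    ψ.lTensor R (extBilin R B x y) = extBilin R B₁ (φ₁.lTensor R x) (χ₁.lTensor R y) +
      extBilin R B₂ (φ₂.lTensor R x) (χ₂.lTensor R y) := by
  induction x using TensorProduct.induction_on with
  | zero => simp
  | add x x' hx hx' => simp only [map_add, LinearMap.add_apply, hx, hx']; abel
  | tmul r x =>
    induction y using TensorProduct.induction_on with
    | zero => simp
    | add y y' hy hy' => simp only [map_add, hy, hy']; abel
    | tmul s y => simp [hB, TensorProduct.tmul_add]

/-- The component in `L ⊗ A` of an element of the cone. -/
abbrev coneL : A ⊗[K] (L × N × M) →ₗ[K] A ⊗[K] L := (LinearMap.fst K L (N × M)).lTensor A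

/-- The component in `N ⊗ A` of an element of the cone. -/
abbrev coneN : A ⊗[K] (L × N × M) →ₗ[K] A ⊗[K] N :=
  (LinearMap.fst K N M ∘ₗ LinearMap.snd K L (N × M)).lTensor A

/-- The component in `M ⊗ A` of an element of the cone. -/
abbrev coneM : A ⊗[K] (L × N × M) →ₗ[K] A ⊗[K] M :=
  (LinearMap.snd K N M ∘ₗ LinearMap.snd K L (N × M)).lTensor A

/-- The element of `C ⊗ A` with given components. -/
def coneMk (x : A ⊗[K] L) (y : A ⊗[K] N) (m : A ⊗[K] M) : A ⊗[K] (L × N × M) :=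
  (LinearMap.inl K L (N × M)).lTensor A x +
    (LinearMap.inr K L (N × M) ∘ₗ LinearMap.inl K N M).lTensor A y +
    (LinearMap.inr K L (N × M) ∘ₗ LinearMap.inr K N M).lTensor A m

variable {A} in
@[simp] theorem coneL_mk (x : A ⊗[K] L) (y : A ⊗[K] N) (m : A ⊗[K] M) :
    coneL A (coneMk A x y m) = x := by
  rw [coneMk, map_add, map_add, lTensor_comp_eq_self rfl, lTensor_comp_eq_zero rfl,
    lTensor_comp_eq_zero rfl, add_zero, add_zero]

variable {A} in
@[simp] theorem coneN_mk (x : A ⊗[K] L) (y : A ⊗[K] N) (m : A ⊗[K] M) :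
    coneN A (coneMk A x y m) = y := by
  rw [coneMk, map_add, map_add, lTensor_comp_eq_self rfl, lTensor_comp_eq_zero rfl,
    lTensor_comp_eq_zero rfl, add_zero, zero_add]

variable {A} in
@[simp] theorem coneM_mk (x : A ⊗[K] L) (y : A ⊗[K] N) (m : A ⊗[K] M) :
    coneM A (coneMk A x y m) = m := by
  rw [coneMk, map_add, map_add, lTensor_comp_eq_self rfl, lTensor_comp_eq_zero rfl,
    lTensor_comp_eq_zero rfl, add_zero, zero_add]

variable {A} in
theorem coneMk_components (z : A ⊗[K] (L × N × M)) :
    coneMk A (coneL A z) (coneN A z) (coneM A z) = z := by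
  rw [coneMk, ← LinearMap.lTensor_comp_apply, ← LinearMap.lTensor_comp_apply,
    ← LinearMap.lTensor_comp_apply, ← LinearMap.add_apply, ← LinearMap.add_apply,
    ← LinearMap.lTensor_add, ← LinearMap.lTensor_add]
  have : (LinearMap.inl K L (N × M) ∘ₗ LinearMap.fst K L (N × M) +
      (LinearMap.inr K L (N × M) ∘ₗ LinearMap.inl K N M) ∘ₗ
        (LinearMap.fst K N M ∘ₗ LinearMap.snd K L (N × M)) +
      (LinearMap.inr K L (N × M) ∘ₗ LinearMap.inr K N M) ∘ₗ
        (LinearMap.snd K N M ∘ₗ LinearMap.snd K L (N × M))) = LinearMap.id :=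
    LinearMap.ext fun z => by simp
  rw [this, LinearMap.lTensor_id_apply]

variable {A} in
theorem cone_ext {z z' : A ⊗[K] (L × N × M)} (hL : coneL A z = coneL A z')
    (hN : coneN A z = coneN A z') (hM : coneM A z = coneM A z') : z = z' := by
  rw [← coneMk_components z, ← coneMk_components z', hL, hN, hM]

variable {A} in
theorem mem_cone_iff {i : ℤ} {p : A ⊗[K] (L × N × M)} :
    p ∈ coeffPart A A.m ((L.gr i).prod ((N.gr i).prod (M.gr (i - 1)))) ↔
      coneL A p ∈ L.part A i ∧ coneN A p ∈ N.part A i ∧ coneM A p ∈ M.part A (i - 1) := by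
  constructor
  · intro hp
    refine ⟨lTensor_mem_coeffPart ?_ hp, lTensor_mem_coeffPart ?_ hp,
      lTensor_mem_coeffPart ?_ hp⟩
    exacts [fun _ hx => hx.1, fun _ hx => hx.2.1, fun _ hx => hx.2.2]
  · rintro ⟨h1, h2, h3⟩
    rw [← coneMk_components p]
    refine Submodule.add_mem _ (Submodule.add_mem _ (lTensor_mem_coeffPart ?_ h1)
      (lTensor_mem_coeffPart ?_ h2)) (lTensor_mem_coeffPart ?_ h3)
    exacts [fun x hx => ⟨hx, Submodule.zero_mem _, Submodule.zero_mem _⟩,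
      fun x hx => ⟨Submodule.zero_mem _, hx, Submodule.zero_mem _⟩,
      fun x hx => ⟨Submodule.zero_mem _, Submodule.zero_mem _, hx⟩]

/-- The component in `L ⊗ A` of an element of `(L × N × M[t, dt]) ⊗ A`. -/
abbrev ambL : A ⊗[K] PathAmbient L M N →ₗ[K] A ⊗[K] L := (LinearMap.fst K _ _).lTensor A

/-- The component in `N ⊗ A` of an element of `(L × N × M[t, dt]) ⊗ A`. -/
abbrev ambN : A ⊗[K] PathAmbient L M N →ₗ[K] A ⊗[K] N :=
  (LinearMap.fst K _ _ ∘ₗ LinearMap.snd K _ _).lTensor A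

/-- The functional part of the component in `M[t, dt] ⊗ A`. -/
abbrev ambP : A ⊗[K] PathAmbient L M N →ₗ[K] K[X] ⊗[K] (A ⊗[K] M) :=
  (swapP A.carrier).toLinearMap ∘ₗ
    (LinearMap.fst K _ _ ∘ₗ LinearMap.snd K _ _ ∘ₗ LinearMap.snd K _ _).lTensor A

/-- The coefficient of `dt` of the component in `M[t, dt] ⊗ A`. -/
abbrev ambQ : A ⊗[K] PathAmbient L M N →ₗ[K] K[X] ⊗[K] (A ⊗[K] M) :=
  (swapP A.carrier).toLinearMap ∘ₗ
    (LinearMap.snd K _ _ ∘ₗ LinearMap.snd K _ _ ∘ₗ LinearMap.snd K _ _).lTensor A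

variable {A}

theorem sgn_part {i : ℤ} {x : A ⊗[K] L} (hx : x ∈ L.part A i) :
    L.sgn.lTensor A x = i.negOnePow • x := by
  induction hx using coeffPart_induction with
  | zero => simp
  | add x y _ _ hx hy => rw [map_add, hx, hy, smul_add]
  | tmul r _ x hx => rw [LinearMap.lTensor_tmul, L.sgn_apply hx, tmul_negOnePow]

theorem swapP_constP {C : Type*} [AddCommGroup C] [Module K C] (f : C →ₗ[K] M) (z : A ⊗[K] C) :
    swapP A.carrier ((constP ∘ₗ f).lTensor A z) = constP (f.lTensor A z) := by
  induction z using TensorProduct.induction_on with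
  | zero => simp
  | add x y hx hy => simp only [map_add, hx, hy]
  | tmul r x => simp [constP]

/-- The linear map `u ↦ (1 - t) f₀(u) + t f₁(u)`. -/
def affineHom {C : Type*} [AddCommGroup C] [Module K C] (f₀ f₁ : C →ₗ[K] M) :
    C →ₗ[K] K[X] ⊗[K] M :=
  TensorProduct.mk K K[X] M (1 - Polynomial.X) ∘ₗ f₀ + TensorProduct.mk K K[X] M Polynomial.X ∘ₗ f₁

theorem swapP_affineHom {C : Type*} [AddCommGroup C] [Module K C] (f₀ f₁ : C →ₗ[K] M)
    (z : A ⊗[K] C) : swapP A.carrier ((affineHom f₀ f₁).lTensor A z) =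
      affineP (f₀.lTensor A z) (f₁.lTensor A z) := by
  induction z using TensorProduct.induction_on with
  | zero => simp [affineP]
  | add x y hx hy =>
    simp only [map_add, hx, hy, affineP, TensorProduct.tmul_add]; abel
  | tmul r x =>
    have h1 : affineHom f₀ f₁ x = (1 - Polynomial.X : K[X]) ⊗ₜ[K] f₀ x +
        (Polynomial.X : K[X]) ⊗ₜ[K] f₁ x := rfl
    rw [LinearMap.lTensor_tmul, h1, TensorProduct.tmul_add, map_add, swapP_tmul, swapP_tmul]
    rfl

theorem ambL_iota (p : A ⊗[K] (L × N × M)) : ambL A ((iota h g).lTensor A p) = coneL A p :=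
  (LinearMap.lTensor_comp_apply ..).symm

theorem ambN_iota (p : A ⊗[K] (L × N × M)) : ambN A ((iota h g).lTensor A p) = coneN A p :=
  (LinearMap.lTensor_comp_apply ..).symm

theorem ambP_iota (p : A ⊗[K] (L × N × M)) : ambP A ((iota h g).lTensor A p) =
    affineP (g.toLin.lTensor A (coneN A p)) (h.toLin.lTensor A (coneL A p)) := by
  rw [LinearMap.comp_apply, ← LinearMap.lTensor_comp_apply, ← LinearMap.lTensor_comp_apply,
    ← LinearMap.lTensor_comp_apply]
  exact swapP_affineHom _ _ p

theorem ambQ_iota (p : A ⊗[K] (L × N × M)) : ambQ A ((iota h g).lTensor A p) =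
    constP (coneM A p) := by
  rw [LinearMap.comp_apply, ← LinearMap.lTensor_comp_apply]
  exact swapP_constP _ p

theorem ambL_homotopyK (w : A ⊗[K] PathAmbient L M N) : ambL A (homotopyK.lTensor A w) = 0 :=
  lTensor_comp_eq_zero rfl w

theorem ambN_homotopyK (w : A ⊗[K] PathAmbient L M N) : ambN A (homotopyK.lTensor A w) = 0 :=
  lTensor_comp_eq_zero rfl w

theorem ambQ_homotopyK (w : A ⊗[K] PathAmbient L M N) : ambQ A (homotopyK.lTensor A w) = 0 := by
  rw [LinearMap.comp_apply, lTensor_comp_eq_zero rfl w, map_zero]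

theorem ambP_homotopyK (w : A ⊗[K] PathAmbient L M N) :
    ambP A (homotopyK.lTensor A w) = kP (ambQ A w) := by
  rw [LinearMap.comp_apply, LinearMap.comp_apply, ← LinearMap.lTensor_comp_apply]
  have h1 := swapP_map (K := K) A.carrier (g₁ := homotopyPoly K) (f := (LinearMap.id : M →ₗ[K] M))
    ((LinearMap.snd K _ _ ∘ₗ LinearMap.snd K _ _ ∘ₗ LinearMap.snd K _ _ :
      PathAmbient L M N →ₗ[K] _).lTensor A w)
  rw [← LinearMap.lTensor_comp_apply, LinearMap.lTensor_id] at h1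
  exact h1

theorem coneL_proj (w : A ⊗[K] PathAmbient L M N) : coneL A (proj.lTensor A w) = ambL A w :=
  (LinearMap.lTensor_comp_apply ..).symm

theorem coneN_proj (w : A ⊗[K] PathAmbient L M N) : coneN A (proj.lTensor A w) = ambN A w :=
  (LinearMap.lTensor_comp_apply ..).symm

theorem coneM_proj (w : A ⊗[K] PathAmbient L M N) :
    coneM A (proj.lTensor A w) = integralP (ambQ A w) := by
  have h1 : ∀ z : A ⊗[K] (K[X] ⊗[K] M), integralP.lTensor A z = integralP (swapP A.carrier z) := by
    intro z
    have : (integralP : K[X] ⊗[K] M →ₗ[K] M).lTensor A =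
        integralP ∘ₗ (swapP A.carrier).toLinearMap :=
      ext_tmul_tmul A.carrier fun r p x => by simp [integralP]
    exact LinearMap.congr_fun this z
  rw [LinearMap.comp_apply, LinearEquiv.coe_coe, ← h1, ← LinearMap.lTensor_comp_apply,
    ← LinearMap.lTensor_comp_apply]
  congr 2
  refine LinearMap.ext fun z => ?_
  simp only [proj, integralP, evP, intP, LinearMap.comp_apply, LinearMap.rTensor_comp]
  rfl

/-- The operator `q₂(ι(p) ⊙ -)`. -/
abbrev coneQ (p : A ⊗[K] (L × N × M)) : A ⊗[K] PathAmbient L M N →ₗ[K] A ⊗[K] PathAmbient L M N :=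
  extBilin A.carrier (ambientQ₂ ∘ₗ iota h g) p

theorem ambL_coneQ (p : A ⊗[K] (L × N × M)) (w : A ⊗[K] PathAmbient L M N) :
    ambL A (coneQ h g p w) = (L.nil A).br (L.sgn.lTensor A (coneL A p)) (ambL A w) := by
  rw [← LinearMap.lTensor_comp_apply]
  exact extBilin_hom A.carrier (fun _ _ => rfl) p w

theorem ambN_coneQ (p : A ⊗[K] (L × N × M)) (w : A ⊗[K] PathAmbient L M N) :
    ambN A (coneQ h g p w) = (N.nil A).br (N.sgn.lTensor A (coneN A p)) (ambN A w) := by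
  rw [← LinearMap.lTensor_comp_apply]
  exact extBilin_hom A.carrier (fun _ _ => rfl) p w

theorem ambQ_coneQ (p : A ⊗[K] (L × N × M)) (w : A ⊗[K] PathAmbient L M N) :
    ambQ A (coneQ h g p w) =
      brP (M.nil A).br (constP (-M.sgn.lTensor A (coneM A p))) (ambP A w) +
      brP (M.nil A).br (affineP
        (M.sgn.lTensor A (M.sgn.lTensor A (g.toLin.lTensor A (coneN A p))))
        (M.sgn.lTensor A (M.sgn.lTensor A (h.toLin.lTensor A (coneL A p))))) (ambQ A w) := by
  have h1 := extBilin_hom_add (R := A.carrier) (B := ambientQ₂ ∘ₗ iota h g) (B₁ := brP M.br)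
    (B₂ := brP M.br)
    (ψ := LinearMap.snd K _ _ ∘ₗ LinearMap.snd K _ _ ∘ₗ LinearMap.snd K _ _)
    (φ₁ := constP ∘ₗ (-M.sgn) ∘ₗ LinearMap.snd K N M ∘ₗ LinearMap.snd K L (N × M))
    (χ₁ := LinearMap.fst K _ _ ∘ₗ LinearMap.snd K _ _ ∘ₗ LinearMap.snd K _ _)
    (φ₂ := affineHom (M.sgn ∘ₗ M.sgn ∘ₗ g.toLin ∘ₗ LinearMap.fst K N M ∘ₗ LinearMap.snd K L (N × M))
      (M.sgn ∘ₗ M.sgn ∘ₗ h.toLin ∘ₗ LinearMap.fst K L (N × M)))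
    (χ₂ := LinearMap.snd K _ _ ∘ₗ LinearMap.snd K _ _ ∘ₗ LinearMap.snd K _ _)
    (fun x y => by
      simp [ambientQ₂, ambientBr, ambientSgn, iota, brP, affineHom, constP]) p w
  rw [LinearMap.comp_apply, h1, map_add, LinearEquiv.coe_coe, swapP_brP, swapP_brP, swapP_constP,
    swapP_affineHom]
  simp only [LinearMap.lTensor_comp, LinearMap.comp_apply, LinearMap.lTensor_neg,
    LinearMap.neg_apply]
  rfl

end Components

/-! ### The curvature of the cone -/

section Jets

variable {K : Type u} [Field K] [CharZero K] {A : ArtAlg.{u, w} K}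
  {L M N : DGLA.{u, v} K} (h : DGLAHom L M) (g : DGLAHom N M)

/-- `p ∈ C¹ ⊗ m_A` -/
structure ConeOne (p : A ⊗[K] (L × N × M)) : Prop where
  l : coneL A p ∈ L.part A 1
  n : coneN A p ∈ N.part A 1
  m : coneM A p ∈ M.part A 0

/-- `q ∈ C⁰ ⊗ m_A` -/
structure ConeZero (q : A ⊗[K] (L × N × M)) : Prop where
  l : coneL A q ∈ L.part A 0
  n : coneN A q ∈ N.part A 0
  m : coneM A q ∈ M.part A (-1)

theorem coneOne_iff {p : A ⊗[K] (L × N × M)} :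
    p ∈ coeffPart A A.m ((L.gr 1).prod ((N.gr 1).prod (M.gr (1 - 1)))) ↔ ConeOne p := by
  rw [mem_cone_iff]
  exact ⟨fun H => ⟨H.1, H.2.1, H.2.2⟩, fun H => ⟨H.l, H.n, H.m⟩⟩

theorem coneZero_iff {p : A ⊗[K] (L × N × M)} :
    p ∈ coeffPart A A.m ((L.gr 0).prod ((N.gr 0).prod (M.gr (0 - 1)))) ↔ ConeZero p := by
  rw [mem_cone_iff]
  exact ⟨fun H => ⟨H.1, H.2.1, H.2.2⟩, fun H => ⟨H.l, H.n, H.m⟩⟩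

theorem DGLAHom.lTensor_part (f : DGLAHom L M) {i : ℤ} {x : A ⊗[K] L} (hx : x ∈ L.part A i) :
    f.toLin.lTensor A x ∈ M.part A i := (f.nil A).map_P hx

theorem sgn_sgn_part {i : ℤ} {x : A ⊗[K] L} (hx : x ∈ L.part A i) :
    L.sgn.lTensor A (L.sgn.lTensor A x) = x := by
  rw [sgn_part hx]
  rcases Int.even_or_odd i with hi | hi
  · rw [Int.negOnePow_even i hi, one_smul, sgn_part hx, Int.negOnePow_even i hi, one_smul]
  · rw [Int.negOnePow_odd i hi, Units.neg_smul, one_smul, map_neg, sgn_part hx,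
      Int.negOnePow_odd i hi, Units.neg_smul, one_smul, neg_neg]

theorem coneL_coneSgn (p : A ⊗[K] (L × N × M)) :
    coneL A (coneSgn.lTensor A p) = L.sgn.lTensor A (coneL A p) := by
  rw [← LinearMap.lTensor_comp_apply, ← LinearMap.lTensor_comp_apply]
  rfl

theorem coneN_coneSgn (p : A ⊗[K] (L × N × M)) :
    coneN A (coneSgn.lTensor A p) = N.sgn.lTensor A (coneN A p) := by
  rw [← LinearMap.lTensor_comp_apply, ← LinearMap.lTensor_comp_apply]
  rfl

theorem coneM_coneSgn (p : A ⊗[K] (L × N × M)) :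
    coneM A (coneSgn.lTensor A p) = -M.sgn.lTensor A (coneM A p) := by
  rw [← LinearMap.lTensor_comp_apply, ← LinearMap.neg_apply, ← LinearMap.lTensor_neg,
    ← LinearMap.lTensor_comp_apply]
  rfl

variable {p q : A ⊗[K] (L × N × M)}

theorem ConeOne.coneSgn (hp : ConeOne p) : coneSgn.lTensor A p = -p := by
  refine cone_ext ?_ ?_ ?_
  · rw [coneL_coneSgn, sgn_part hp.l]; simp
  · rw [coneN_coneSgn, sgn_part hp.n]; simp
  · rw [coneM_coneSgn, sgn_part hp.m]; simp

theorem ConeZero.coneSgn (hq : ConeZero q) : coneSgn.lTensor A q = q := by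
  refine cone_ext ?_ ?_ ?_
  · rw [coneL_coneSgn, sgn_part hq.l]; simp
  · rw [coneN_coneSgn, sgn_part hq.n]; simp
  · rw [coneM_coneSgn, sgn_part hq.m]; simp

theorem ConeOne.ambL_coneQ (hp : ConeOne p) (w : A ⊗[K] PathAmbient L M N) :
    ambL A (coneQ h g p w) = -(L.nil A).br (coneL A p) (ambL A w) := by
  rw [ConeDef.ambL_coneQ, sgn_part hp.l]
  simp

theorem ConeOne.ambN_coneQ (hp : ConeOne p) (w : A ⊗[K] PathAmbient L M N) :
    ambN A (coneQ h g p w) = -(N.nil A).br (coneN A p) (ambN A w) := by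
  rw [ConeDef.ambN_coneQ, sgn_part hp.n]
  simp

theorem ConeOne.ambQ_coneQ (hp : ConeOne p) (w : A ⊗[K] PathAmbient L M N) :
    ambQ A (coneQ h g p w) = -brP (M.nil A).br (constP (coneM A p)) (ambP A w) +
      brP (M.nil A).br (affineP (g.toLin.lTensor A (coneN A p)) (h.toLin.lTensor A (coneL A p)))
        (ambQ A w) := by
  rw [ConeDef.ambQ_coneQ, sgn_sgn_part (g.lTensor_part hp.n), sgn_sgn_part (h.lTensor_part hp.l),
    sgn_part hp.m]
  simp

theorem ConeZero.ambL_coneQ (hq : ConeZero q) (w : A ⊗[K] PathAmbient L M N) :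
    ambL A (coneQ h g q w) = (L.nil A).br (coneL A q) (ambL A w) := by
  rw [ConeDef.ambL_coneQ, sgn_part hq.l]
  simp

theorem ConeZero.ambN_coneQ (hq : ConeZero q) (w : A ⊗[K] PathAmbient L M N) :
    ambN A (coneQ h g q w) = (N.nil A).br (coneN A q) (ambN A w) := by
  rw [ConeDef.ambN_coneQ, sgn_part hq.n]
  simp

theorem ConeZero.ambQ_coneQ (hq : ConeZero q) (w : A ⊗[K] PathAmbient L M N) :
    ambQ A (coneQ h g q w) = brP (M.nil A).br (constP (coneM A q)) (ambP A w) +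
      brP (M.nil A).br (affineP (g.toLin.lTensor A (coneN A q)) (h.toLin.lTensor A (coneL A q)))
        (ambQ A w) := by
  rw [ConeDef.ambQ_coneQ, sgn_sgn_part (g.lTensor_part hq.n), sgn_sgn_part (h.lTensor_part hq.l),
    sgn_part hq.m]
  simp

/-- The first variation of `preTreeExt` at `p` in the direction `q`. -/
def preTreeJet (p q : A ⊗[K] (L × N × M)) (n : ℕ) : A ⊗[K] PathAmbient L M N :=
  ∑ i, preTreeExt A.carrier h g n (Function.update (fun _ => p) i q)

theorem preTreeExt_zero (z : Fin 2 → A ⊗[K] (L × N × M)) :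
    preTreeExt A.carrier h g 0 z = coneQ h g (z 0) ((iota h g).lTensor A (z 1)) := rfl

theorem preTreeExt_succ (n : ℕ) (z : Fin (n + 3) → A ⊗[K] (L × N × M)) :
    preTreeExt A.carrier h g (n + 1) z =
      coneQ h g (z 0) (homotopyK.lTensor A (preTreeExt A.carrier h g n (Fin.tail z))) := rfl

theorem preTreeJet_zero (p q : A ⊗[K] (L × N × M)) : preTreeJet h g p q 0 =
    coneQ h g q ((iota h g).lTensor A p) + coneQ h g p ((iota h g).lTensor A q) := by
  rw [preTreeJet, Fin.sum_univ_two, preTreeExt_zero, preTreeExt_zero]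
  simp

theorem preTreeJet_succ (p q : A ⊗[K] (L × N × M)) (n : ℕ) : preTreeJet h g p q (n + 1) =
    coneQ h g q (homotopyK.lTensor A (preTreeExt A.carrier h g n (fun _ => p))) +
      coneQ h g p (homotopyK.lTensor A (preTreeJet h g p q n)) := by
  rw [preTreeJet, Fin.sum_univ_succ, preTreeJet, map_sum, map_sum]
  congr 1
  refine Finset.sum_congr rfl fun i _ => ?_
  rw [← Function.update_of_ne (Fin.succ_ne_zero i).symm q (fun _ : Fin (n + 3) => p)]
  exact (preTreeExt_succ h g n _).trans (by rw [Fin.tail_update_succ]; rfl)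

theorem fst_pairOp (D : NilDGLA.{u, v} K) (m c : D) (z : K[X] ⊗[K] (D × D)) :
    (LinearMap.fst K _ _).lTensor K[X] ((NilDGLA.pairOp m c).lTensor K[X] z) =
      brP D.br (constP m) ((LinearMap.fst K _ _).lTensor K[X] z) := by
  rw [brP_constP_left, ← LinearMap.lTensor_comp_apply, ← LinearMap.lTensor_comp_apply]
  rfl

theorem snd_pairOp (D : NilDGLA.{u, v} K) (m c : D) (z : K[X] ⊗[K] (D × D)) :
    (LinearMap.snd K _ _).lTensor K[X] ((NilDGLA.pairOp m c).lTensor K[X] z) =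
      brP D.br (constP m) ((LinearMap.snd K _ _).lTensor K[X] z) -
        brP D.br (constP c) ((LinearMap.fst K _ _).lTensor K[X] z) := by
  rw [brP_constP_left, brP_constP_left, ← LinearMap.lTensor_comp_apply,
    ← LinearMap.lTensor_comp_apply, ← LinearMap.lTensor_comp_apply, ← LinearMap.sub_apply,
    ← LinearMap.lTensor_sub]
  rfl

theorem brP_affineP_const (D : NilDGLA.{u, v} K) {m u₀ u₁ : D} {ε : K}
    (h₀ : D.br u₀ m = ε • D.br m u₀) (h₁ : D.br u₁ m = ε • D.br m u₁) :
    brP D.br (affineP u₀ u₁) (constP m) = ε • brP D.br (constP m) (affineP u₀ u₁) := by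
  simp only [affineP, constP_apply, map_add, LinearMap.add_apply, brP_tmul, h₀, h₁, smul_add,
    TensorProduct.tmul_smul, mul_one, one_mul]

/-- The operator `([m, -], [m, -] - [c, -])` on `M ⊗ A` determined by `p = (x, y, m)` and
`q = (a, b, c)`. -/
def conePair (p q : A ⊗[K] (L × N × M)) : Module.End K (M.nil A × M.nil A) :=
  NilDGLA.pairOp (coneM A p) (coneM A q)

/-- The iterates of the homotopy operator on `(1 - t) (g y, g b) + t (h x, h a)`, followed by one
application of `conePair`. -/
def coneIter (p q : A ⊗[K] (L × N × M)) (n : ℕ) : K[X] ⊗[K] (M.nil A × M.nil A) :=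
  (conePair p q).lTensor K[X] (iterP (conePair p q) (affineP
    (g.toLin.lTensor A (coneN A p), g.toLin.lTensor A (coneN A q))
    (h.toLin.lTensor A (coneL A p), h.toLin.lTensor A (coneL A q))) n)

theorem coneIter_succ (p q : A ⊗[K] (L × N × M)) (n : ℕ) :
    coneIter h g p q (n + 1) = (conePair p q).lTensor K[X] (kP (coneIter h g p q n)) := rfl

/-- Up to a factor, the coefficients of `dt` in the trees and in their first variations are the two
components of `coneIter`. The recursion closes up because the homotopy `κ` turns the `dt`-part of a
tree into a function, on which `q₂(ι(p) ⊙ -)` acts through the `M`-component `m dt` of `ι(p)`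
only. -/
theorem ambQ_preTree (hp : ConeOne p) (hq : ConeZero q) (n : ℕ) :
    ambQ A (preTreeExt A.carrier h g n (fun _ => p)) =
        (-2 * (-1 : K) ^ n) • (LinearMap.fst K _ _).lTensor K[X] (coneIter h g p q n) ∧
      ambQ A (preTreeJet h g p q n) =
        (-2 * (-1 : K) ^ n) • (LinearMap.snd K _ _).lTensor K[X] (coneIter h g p q n) := by
  induction n with
  | zero =>
    have hm0 := brP_affineP_const (M.nil A) (ε := -1)
      ((NilDGLA.symm0' (g.lTensor_part hp.n) hp.m).trans (neg_one_smul K _).symm)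
      ((NilDGLA.symm0' (h.lTensor_part hp.l) hp.m).trans (neg_one_smul K _).symm)
    have hm1 := brP_affineP_const (M.nil A) (ε := -1)
      ((NilDGLA.symm0' (g.lTensor_part hq.n) hp.m).trans (neg_one_smul K _).symm)
      ((NilDGLA.symm0' (h.lTensor_part hq.l) hp.m).trans (neg_one_smul K _).symm)
    have hc := brP_affineP_const (M.nil A) (ε := 1)
      ((NilDGLA.symmn1 hq.m (g.lTensor_part hp.n)).symm.trans (one_smul K _).symm)
      ((NilDGLA.symmn1 hq.m (h.lTensor_part hp.l)).symm.trans (one_smul K _).symm)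
    constructor
    · rw [preTreeExt_zero, hp.ambQ_coneQ, ambP_iota, ambQ_iota, hm0, coneIter, conePair,
        fst_pairOp, iterP, lTensor_affineP]
      simp only [LinearMap.fst_apply]
      module
    · rw [preTreeJet_zero, map_add, hp.ambQ_coneQ, hq.ambQ_coneQ, ambP_iota, ambQ_iota, ambP_iota,
        ambQ_iota, hm1, hc, coneIter, conePair, snd_pairOp, iterP, lTensor_affineP,
        lTensor_affineP]
      simp only [LinearMap.fst_apply, LinearMap.snd_apply]
      module
  | succ n ih =>
    rw [coneIter_succ, conePair, fst_pairOp, snd_pairOp, ← kP_lTensor, ← kP_lTensor]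
    constructor
    · rw [preTreeExt_succ, hp.ambQ_coneQ, ambQ_homotopyK, ambP_homotopyK,
        show Fin.tail (fun _ : Fin (n + 3) => p) = fun _ => p from rfl, ih.1,
        map_smul, map_smul, map_zero, pow_succ]
      module
    · rw [preTreeJet_succ, map_add, hp.ambQ_coneQ, hq.ambQ_coneQ, ambQ_homotopyK, ambP_homotopyK,
        ambQ_homotopyK, ambP_homotopyK, ih.1, ih.2,
        map_smul, map_smul, map_smul, map_smul, map_zero, map_zero, pow_succ]
      module

theorem ambL_preTree_zero (hp : ConeOne p) :
    ambL A (preTreeExt A.carrier h g 0 (fun _ => p)) = -(L.nil A).br (coneL A p) (coneL A p) := by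
  rw [preTreeExt_zero, hp.ambL_coneQ, ambL_iota]

theorem ambN_preTree_zero (hp : ConeOne p) :
    ambN A (preTreeExt A.carrier h g 0 (fun _ => p)) = -(N.nil A).br (coneN A p) (coneN A p) := by
  rw [preTreeExt_zero, hp.ambN_coneQ, ambN_iota]

theorem ambL_preTree_succ (hp : ConeOne p) (n : ℕ) :
    ambL A (preTreeExt A.carrier h g (n + 1) (fun _ => p)) = 0 := by
  rw [preTreeExt_succ, hp.ambL_coneQ, ambL_homotopyK, map_zero, neg_zero]

theorem ambN_preTree_succ (hp : ConeOne p) (n : ℕ) :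
    ambN A (preTreeExt A.carrier h g (n + 1) (fun _ => p)) = 0 := by
  rw [preTreeExt_succ, hp.ambN_coneQ, ambN_homotopyK, map_zero, neg_zero]

theorem ambL_preTreeJet_zero (hp : ConeOne p) (hq : ConeZero q) :
    ambL A (preTreeJet h g p q 0) = (2 : K) • (L.nil A).br (coneL A q) (coneL A p) := by
  rw [preTreeJet_zero, map_add, hp.ambL_coneQ, hq.ambL_coneQ, ambL_iota, ambL_iota,
    NilDGLA.symm0' (D := L.nil A) (x := coneL A p) hp.l hq.l, neg_neg, two_smul]

theorem ambN_preTreeJet_zero (hp : ConeOne p) (hq : ConeZero q) :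
    ambN A (preTreeJet h g p q 0) = (2 : K) • (N.nil A).br (coneN A q) (coneN A p) := by
  rw [preTreeJet_zero, map_add, hp.ambN_coneQ, hq.ambN_coneQ, ambN_iota, ambN_iota,
    NilDGLA.symm0' (D := N.nil A) (x := coneN A p) hp.n hq.n, neg_neg, two_smul]

theorem ambL_preTreeJet_succ (hp : ConeOne p) (hq : ConeZero q) (n : ℕ) :
    ambL A (preTreeJet h g p q (n + 1)) = 0 := by
  rw [preTreeJet_succ, map_add, hp.ambL_coneQ, hq.ambL_coneQ, ambL_homotopyK, ambL_homotopyK,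
    map_zero, map_zero, neg_zero, add_zero]

theorem ambN_preTreeJet_succ (hp : ConeOne p) (hq : ConeZero q) (n : ℕ) :
    ambN A (preTreeJet h g p q (n + 1)) = 0 := by
  rw [preTreeJet_succ, map_add, hp.ambN_coneQ, hq.ambN_coneQ, ambN_homotopyK, ambN_homotopyK,
    map_zero, map_zero, neg_zero, add_zero]

end Jets

section Curvature

variable {K : Type u} [Field K] {A : ArtAlg.{u, w} K}

/-- The first variation of the curvature of an `L∞` algebra at `p` in the direction `q`. -/
def LInftyData.jet (T : LInftyData.{u, v} K) (p q : A ⊗[K] T) : A ⊗[K] T :=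
  T.q₁.lTensor A q + ∑ᶠ n : ℕ, ((n + 2).factorial : K)⁻¹ •
    ∑ i, extend A (n + 2) (T.q n) (Function.update (fun _ => p) i q)

theorem extend_eq_zero {V : Type v} [AddCommGroup V] [Module K V] {k n : ℕ} (hk : A.m ^ k = ⊥)
    (hn : k ≤ n) (ψ : MultilinearMap K (fun _ : Fin n => V) V) {z : Fin n → A ⊗[K] V}
    (hz : ∀ i, z i ∈ coeffPart A A.m ⊤) : extend A n ψ z = 0 :=
  eq_zero_of_filt hk hn (extend_mem_coeffPart n ψ hz)

theorem finsum_eq_sum_range {V : Type*} [AddCommGroup V] {F : ℕ → V} {k : ℕ}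
    (hF : ∀ n ≥ k, F n = 0) : ∑ᶠ n, F n = ∑ n ∈ Finset.range k, F n :=
  finsum_eq_sum_of_support_subset _ fun n hn => by
    by_contra hlt
    exact hn (hF n (by simpa using hlt))

variable [CharZero K] {L M N : DGLA.{u, v} K} (h : DGLAHom L M) (g : DGLAHom N M)

/-- The unary bracket of the cone. -/
abbrev coneD : (L × N × M) →ₗ[K] L × N × M := (cone h g).q₁

/-- The curvature of the cone. -/
abbrev coneCurvature (p : A ⊗[K] (L × N × M)) : A ⊗[K] (L × N × M) := (cone h g).curvature A p

/-- The first variation of the curvature of the cone. -/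
abbrev coneJet (p q : A ⊗[K] (L × N × M)) : A ⊗[K] (L × N × M) := (cone h g).jet p q

theorem coneL_coneD (z : A ⊗[K] (L × N × M)) :
    coneL A ((coneD h g).lTensor A z) = -(L.nil A).d (coneL A z) := by
  have h1 : LinearMap.fst K L (N × M) ∘ₗ coneD h g = -(L.d ∘ₗ LinearMap.fst K L (N × M)) := rfl
  rw [← LinearMap.lTensor_comp_apply, h1, LinearMap.lTensor_neg, LinearMap.lTensor_comp]
  rfl

theorem coneN_coneD (z : A ⊗[K] (L × N × M)) :
    coneN A ((coneD h g).lTensor A z) = -(N.nil A).d (coneN A z) := by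
  have h1 : (LinearMap.fst K N M ∘ₗ LinearMap.snd K L (N × M)) ∘ₗ coneD h g =
    -(N.d ∘ₗ (LinearMap.fst K N M ∘ₗ LinearMap.snd K L (N × M))) := rfl
  rw [← LinearMap.lTensor_comp_apply, h1, LinearMap.lTensor_neg, LinearMap.lTensor_comp]
  rfl

theorem coneM_coneD (z : A ⊗[K] (L × N × M)) :
    coneM A ((coneD h g).lTensor A z) = (M.nil A).d (coneM A z) +
      g.toLin.lTensor A (coneN A z) - h.toLin.lTensor A (coneL A z) := by
  have h1 : (LinearMap.snd K N M ∘ₗ LinearMap.snd K L (N × M)) ∘ₗ coneD h g =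
    M.d ∘ₗ (LinearMap.snd K N M ∘ₗ LinearMap.snd K L (N × M)) +
      g.toLin ∘ₗ (LinearMap.fst K N M ∘ₗ LinearMap.snd K L (N × M)) -
      h.toLin ∘ₗ LinearMap.fst K L (N × M) := rfl
  rw [← LinearMap.lTensor_comp_apply, h1, LinearMap.lTensor_sub, LinearMap.lTensor_add,
    LinearMap.lTensor_comp _ M.d, LinearMap.lTensor_comp _ g.toLin,
    LinearMap.lTensor_comp _ h.toLin]
  rfl

variable {p q : A ⊗[K] (L × N × M)}

theorem ConeOne.mem_top (hp : ConeOne p) : p ∈ coeffPart A A.m ⊤ :=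
  coeffPart_mono le_rfl le_top (coneOne_iff.2 hp)

theorem ConeZero.mem_top (hq : ConeZero q) : q ∈ coeffPart A A.m ⊤ :=
  coeffPart_mono le_rfl le_top (coneZero_iff.2 hq)

theorem cone_curvature_eq (hp : ConeOne p) {k : ℕ} (hk : A.m ^ k = ⊥) :
    coneCurvature h g p = (coneD h g).lTensor A p + ∑ n ∈ Finset.range (k + 1),
      ((-1 : K) ^ n / 2) • proj.lTensor A (preTreeExt A.carrier h g n (fun _ => p)) := by
  have h1 : coneCurvature h g p = (coneD h g).lTensor A p +
      ∑ᶠ n : ℕ, ((n + 2).factorial : K)⁻¹ • extend A (n + 2) (coneBracket h g n) (fun _ => p) := rfl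
  rw [h1, finsum_eq_sum_range (k := k + 1)]
  · simp only [extend_coneBracket_const h g hp.coneSgn]
  · intro n hn
    rw [extend_eq_zero hk (by omega) _ fun _ => hp.mem_top, smul_zero]

theorem cone_jet_eq (hp : ConeOne p) (hq : ConeZero q) {k : ℕ} (hk : A.m ^ k = ⊥) :
    coneJet h g p q = (coneD h g).lTensor A q + ∑ n ∈ Finset.range (k + 1),
      ((-1 : K) ^ n / 2) • proj.lTensor A (preTreeJet h g p q n) := by
  have h1 : coneJet h g p q = (coneD h g).lTensor A q +
      ∑ᶠ n : ℕ, ((n + 2).factorial : K)⁻¹ • ∑ i, extend A (n + 2) (coneBracket h g n)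
        (Function.update (fun _ => p) i q) := rfl
  rw [h1, finsum_eq_sum_range (k := k + 1)]
  · simp only [extend_coneBracket_update h g hp.coneSgn hq.coneSgn]
    rfl
  · intro n hn
    rw [Finset.sum_eq_zero fun i _ => ?_, smul_zero]
    refine extend_eq_zero hk (by omega) _ fun j => ?_
    by_cases hj : j = i
    · rw [hj, Function.update_self]
      exact hq.mem_top
    · rw [Function.update_of_ne hj]
      exact hp.mem_top

theorem coneL_sum (c : ℕ → K) (F : ℕ → A ⊗[K] PathAmbient L M N) (hF : ∀ n, ambL A (F (n + 1)) = 0)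
    (k : ℕ) : coneL A (∑ n ∈ Finset.range (k + 1), c n • proj.lTensor A (F n)) =
      c 0 • ambL A (F 0) := by
  simp only [map_sum, map_smul, coneL_proj]
  rw [Finset.sum_range_succ', Finset.sum_eq_zero fun n _ => by rw [hF, smul_zero], zero_add]

theorem coneN_sum (c : ℕ → K) (F : ℕ → A ⊗[K] PathAmbient L M N) (hF : ∀ n, ambN A (F (n + 1)) = 0)
    (k : ℕ) : coneN A (∑ n ∈ Finset.range (k + 1), c n • proj.lTensor A (F n)) =
      c 0 • ambN A (F 0) := by
  simp only [map_sum, map_smul, coneN_proj]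
  rw [Finset.sum_range_succ', Finset.sum_eq_zero fun n _ => by rw [hF, smul_zero], zero_add]

theorem coneM_sum (F : ℕ → A ⊗[K] PathAmbient L M N) (G : ℕ → K[X] ⊗[K] (M.nil A))
    (hF : ∀ n, ambQ A (F n) = (-2 * (-1 : K) ^ n) • G n) (k : ℕ) :
    coneM A (∑ n ∈ Finset.range k, ((-1 : K) ^ n / 2) • proj.lTensor A (F n)) =
      -∑ n ∈ Finset.range k, integralP (G n) := by
  simp only [map_sum, map_smul, coneM_proj, hF, smul_smul]
  rw [← Finset.sum_neg_distrib]
  refine Finset.sum_congr rfl fun n _ => ?_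
  have h1 : (-1 : K) ^ n / 2 * (-2 * (-1) ^ n) = -1 := by
    have h2 : (-1 : K) ^ n * (-1) ^ n = 1 := by rw [← mul_pow]; simp
    linear_combination (-1 : K) * h2
  rw [h1, neg_one_smul]

/-- The components of the vanishing of the curvature of `p = (x, y, m)` and of its variation along
`q = (a, b, c)`, the latter up to a term `r`, which will be a derivative. In `L` and `N` only the
terms of order at most two contribute. In `M` the sum over trees becomes, by
`integral_iterP_eq_zero_iff`, the equation `g(y) = e ^ m * h(x)` together with its variation. -/
theorem cone_curvature_iff (hp : ConeOne p) (hq : ConeZero q) (r : A ⊗[K] (L × N × M)) :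
    (coneCurvature h g p = 0 ∧ r + coneJet h g p q = 0) ↔
      (L.nil A).MC (coneL A p) ∧ (N.nil A).MC (coneN A p) ∧
      coneL A r = (L.nil A).d (coneL A q) - (L.nil A).br (coneL A q) (coneL A p) ∧
      coneN A r = (N.nil A).d (coneN A q) - (N.nil A).br (coneN A q) (coneN A p) ∧
      nexp K (affOp (conePair p q)
          ((M.nil A).d (coneM A p), (M.nil A).d (coneM A q) + coneM A r))
        ((h.toLin.lTensor A (coneL A p), h.toLin.lTensor A (coneL A q)), 1) =
        ((g.toLin.lTensor A (coneN A p), g.toLin.lTensor A (coneN A q)), 1) := by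
  obtain ⟨k₁, hk₁⟩ := A.exists_m_pow
  obtain ⟨k₂, hk₂⟩ := (M.nil A).exists_pairOp_pow
  -- a common bound for the trees and for the iterates of the homotopy operator
  have hk : A.m ^ (k₁ + k₂) = ⊥ := by rw [pow_add, hk₁, Ideal.bot_mul]
  have hT : conePair p q ^ k₂ = 0 := hk₂ _ (NilDGLA.P_F hp.m) _ (NilDGLA.P_F hq.m)
  rw [← integral_iterP_eq_zero_iff hT _ _ _ (k := k₁ + k₂ + 1) (by omega),
    cone_curvature_eq h g hp hk, cone_jet_eq h g hp hq hk]
  have hz : ∀ z : A ⊗[K] (L × N × M), z = 0 ↔ coneL A z = 0 ∧ coneN A z = 0 ∧ coneM A z = 0 := by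
    refine fun z => ⟨?_, fun H => cone_ext ?_ ?_ ?_⟩
    · rintro rfl; simp
    · rw [H.1, map_zero]
    · rw [H.2.1, map_zero]
    · rw [H.2.2, map_zero]
  have hpq := ambQ_preTree h g hp hq
  rw [hz, hz]
  simp only [map_add (coneL A), map_add (coneN A), map_add (coneM A)]
  rw [coneL_sum _ _ (ambL_preTree_succ h g hp), coneN_sum _ _ (ambN_preTree_succ h g hp),
    coneL_sum _ _ (ambL_preTreeJet_succ h g hp hq), coneN_sum _ _ (ambN_preTreeJet_succ h g hp hq),
    coneM_sum _ _ fun n => (hpq n).1, coneM_sum _ _ fun n => (hpq n).2,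
    ambL_preTree_zero h g hp, ambN_preTree_zero h g hp, ambL_preTreeJet_zero h g hp hq,
    ambN_preTreeJet_zero h g hp hq, coneL_coneD, coneN_coneD, coneM_coneD, coneL_coneD, coneN_coneD,
    coneM_coneD]
  simp only [integralP_lTensor]
  have e1 : ∀ (D : NilDGLA.{u, max v w} K) (x : D),
      -D.d x + ((-1 : K) ^ 0 / 2) • -D.br x x = 0 ↔ D.MC x := by
    intro D x
    rw [NilDGLA.MC, ← neg_eq_zero]
    have : -(-D.d x + ((-1 : K) ^ 0 / 2) • -D.br x x) = D.d x + (2⁻¹ : K) • D.br x x := by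
      rw [pow_zero, one_div]; module
    rw [this]
  have e2 : ∀ (D : NilDGLA.{u, max v w} K) (x a r : D),
      r + (-D.d a + ((-1 : K) ^ 0 / 2) • (2 : K) • D.br a x) = 0 ↔ r = D.d a - D.br a x := by
    intro D x a r
    rw [← sub_eq_zero (b := D.d a - _)]
    have : r + (-D.d a + ((-1 : K) ^ 0 / 2) • (2 : K) • D.br a x) = r - (D.d a - D.br a x) := by
      module
    rw [this]
  rw [e1 (L.nil A), e1 (N.nil A), e2 (L.nil A), e2 (N.nil A), Prod.ext_iff]
  simp only [Prod.fst_sub, Prod.snd_sub, Prod.fst_add, Prod.snd_add, Prod.fst_sum, Prod.snd_sum,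
    Prod.fst_zero, Prod.snd_zero, LinearMap.fst_apply, LinearMap.snd_apply, coneIter,
    integralP_lTensor]
  rw [← sub_eq_add_neg, ← sub_eq_add_neg, add_sub_assoc', add_sub_assoc', add_left_comm,
    ← add_assoc]
  tauto

end Curvature

/-! ### Maurer-Cartan elements of the path algebra -/

section Swap

variable {K : Type u} [Field K] {R : Type w} [CommRing R] [Algebra K R]
  {V : Type*} [AddCommGroup V] [Module K V]

theorem swapP_mem {I : Ideal R} {S : Submodule K V} {z : R ⊗[K] (K[X] ⊗[K] V)}
    (hz : z ∈ coeffPart R I (coeffPart K[X] ⊤ S)) : swapP R z ∈ partP (coeffPart R I S) := by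
  induction hz using coeffPart_induction with
  | zero => simp
  | add x y _ _ hx hy => rw [map_add]; exact Submodule.add_mem _ hx hy
  | tmul r hr x hx =>
    induction hx using coeffPart_induction with
    | zero => simp
    | add x y _ _ hx hy => rw [TensorProduct.tmul_add, map_add]; exact Submodule.add_mem _ hx hy
    | tmul f _ x hx => exact tmul_mem_partP f (tmul_mem_coeffPart hr hx)

theorem swapP_symm_mem {I : Ideal R} {S : Submodule K V} {z : K[X] ⊗[K] (R ⊗[K] V)}
    (hz : z ∈ partP (coeffPart R I S)) :
    (swapP R).symm z ∈ coeffPart R I (coeffPart K[X] ⊤ S) := by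
  induction hz using coeffPart_induction with
  | zero => simp
  | add x y _ _ hx hy => rw [map_add]; exact Submodule.add_mem _ hx hy
  | tmul f _ x hx =>
    induction hx using coeffPart_induction with
    | zero => simp
    | add x y _ _ hx hy => rw [TensorProduct.tmul_add, map_add]; exact Submodule.add_mem _ hx hy
    | tmul r hr x hx => exact tmul_mem_coeffPart hr (tmul_mem_partP f hx)

end Swap

namespace LInftyData

variable {K : Type u} [Field K] {A : ArtAlg.{u, w} K} (T : LInftyData.{u, v} K)

/-- `p(s) + q(s) ds ↦ p(s)` -/
def pathFst : T.path →ₗ[K] K[X] ⊗[K] T := LinearMap.fst K (K[X] ⊗[K] T) (K[X] ⊗[K] T)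

/-- `p(s) + q(s) ds ↦ q(s)` -/
def pathSnd : T.path →ₗ[K] K[X] ⊗[K] T := LinearMap.snd K (K[X] ⊗[K] T) (K[X] ⊗[K] T)

/-- `p(s) ↦ p(s) + 0 ds` -/
def pathInl : K[X] ⊗[K] T →ₗ[K] T.path := LinearMap.inl K (K[X] ⊗[K] T) (K[X] ⊗[K] T)

/-- `q(s) ↦ 0 + q(s) ds` -/
def pathInr : K[X] ⊗[K] T →ₗ[K] T.path := LinearMap.inr K (K[X] ⊗[K] T) (K[X] ⊗[K] T)

/-- The polynomial `p` with coefficients in `T ⊗ A` of `p(s) + q(s) ds`. -/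
def polyFst (Γ : A ⊗[K] T.path) : K[X] ⊗[K] (A ⊗[K] T) := swapP A.carrier (T.pathFst.lTensor A Γ)

/-- The polynomial `q` with coefficients in `T ⊗ A` of `p(s) + q(s) ds`. -/
def polySnd (Γ : A ⊗[K] T.path) : K[X] ⊗[K] (A ⊗[K] T) := swapP A.carrier (T.pathSnd.lTensor A Γ)

variable {T}

theorem polyFst_mem {i : ℤ} {Γ : A ⊗[K] T.path} (hΓ : Γ ∈ coeffPart A A.m (T.path.gr i)) :
    T.polyFst Γ ∈ partP (coeffPart A A.m (T.gr i)) :=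
  swapP_mem (lTensor_mem_coeffPart (S := T.path.gr i) (f := T.pathFst) (fun _ hx => hx.1) hΓ)

theorem polySnd_mem {i : ℤ} {Γ : A ⊗[K] T.path} (hΓ : Γ ∈ coeffPart A A.m (T.path.gr i)) :
    T.polySnd Γ ∈ partP (coeffPart A A.m (T.gr (i - 1))) :=
  swapP_mem (lTensor_mem_coeffPart (S := T.path.gr i) (f := T.pathSnd) (fun _ hx => hx.2) hΓ)

theorem exists_path {i : ℤ} {P Q : K[X] ⊗[K] (A ⊗[K] T)}
    (hP : P ∈ partP (coeffPart A A.m (T.gr i)))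
    (hQ : Q ∈ partP (coeffPart A A.m (T.gr (i - 1)))) :
    ∃ Γ ∈ coeffPart A A.m (T.path.gr i), T.polyFst Γ = P ∧ T.polySnd Γ = Q := by
  refine ⟨T.pathInl.lTensor A ((swapP A.carrier).symm P) +
    T.pathInr.lTensor A ((swapP A.carrier).symm Q), Submodule.add_mem _
      (lTensor_mem_coeffPart (f := T.pathInl) (S' := T.path.gr i)
        (fun _ hx => ⟨hx, Submodule.zero_mem _⟩) (swapP_symm_mem hP))
      (lTensor_mem_coeffPart (f := T.pathInr) (S' := T.path.gr i)
        (fun _ hx => ⟨Submodule.zero_mem _, hx⟩) (swapP_symm_mem hQ)), ?_, ?_⟩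
  · rw [polyFst, map_add, lTensor_comp_eq_self rfl, lTensor_comp_eq_zero rfl, add_zero,
      LinearEquiv.apply_symm_apply]
  · rw [polySnd, map_add, lTensor_comp_eq_zero rfl, lTensor_comp_eq_self rfl, zero_add,
      LinearEquiv.apply_symm_apply]

theorem evP_polyFst (s : K) (Γ : A ⊗[K] T.path) :
    evP s (T.polyFst Γ) = (evP s ∘ₗ T.pathFst).lTensor A Γ := by
  rw [polyFst, evP_swapP, LinearMap.lTensor_comp_apply]

theorem evP_polySnd (s : K) (Γ : A ⊗[K] T.path) :
    evP s (T.polySnd Γ) = (evP s ∘ₗ T.pathSnd).lTensor A Γ := by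
  rw [polySnd, evP_swapP, LinearMap.lTensor_comp_apply]

theorem evP_derP_polyFst (s : K) (Γ : A ⊗[K] T.path) :
    evP s (derP (T.polyFst Γ)) = (evP s ∘ₗ derP ∘ₗ T.pathFst).lTensor A Γ := by
  have h1 := swapP_map (K := K) A.carrier (g₁ := Polynomial.derivative)
    (f := (LinearMap.id : T →ₗ[K] T)) (T.pathFst.lTensor A Γ)
  rw [LinearMap.lTensor_id] at h1
  have h2 : derP (T.polyFst Γ) = swapP A.carrier ((derP ∘ₗ T.pathFst).lTensor A Γ) := by
    rw [LinearMap.lTensor_comp_apply]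
    exact h1.symm
  rw [h2, evP_swapP, ← LinearMap.lTensor_comp_apply]

theorem evalPath_eq (s : K) (Γ : A ⊗[K] T.path) :
    (T.evalPath s).baseChange A Γ = evP s (T.polyFst Γ) :=
  (evP_polyFst s Γ).symm

variable [CharZero K]

theorem path_eq_zero_iff {z : A ⊗[K] T.path} :
    z = 0 ↔ ∀ s : K, evP s (T.polyFst z) = 0 ∧ evP s (T.polySnd z) = 0 := by
  constructor
  · rintro rfl s
    simp [polyFst, polySnd]
  · intro H
    have h1 : T.polyFst z = 0 := ext_evP fun s => by rw [(H s).1, map_zero]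
    have h2 : T.polySnd z = 0 := ext_evP fun s => by rw [(H s).2, map_zero]
    rw [polyFst, LinearEquiv.map_eq_zero_iff] at h1
    rw [polySnd, LinearEquiv.map_eq_zero_iff] at h2
    have h3 : T.pathInl ∘ₗ T.pathFst + T.pathInr ∘ₗ T.pathSnd = LinearMap.id :=
      LinearMap.coprod_inl_inr (R := K) (M := K[X] ⊗[K] T) (M₂ := K[X] ⊗[K] T) ▸
        LinearMap.ext fun z => by rfl
    have h4 := LinearMap.lTensor_id_apply A.carrier T.path z
    rw [← h3, LinearMap.lTensor_add, LinearMap.add_apply, LinearMap.lTensor_comp_apply,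
      LinearMap.lTensor_comp_apply, h1, h2, map_zero, map_zero, add_zero] at h4
    exact h4.symm

theorem sgn_coeffPart {i : ℤ} {x : A ⊗[K] T} (hx : x ∈ coeffPart A A.m (T.gr i)) :
    T.sgn.lTensor A x = i.negOnePow • x := by
  induction hx using coeffPart_induction with
  | zero => simp
  | add x y _ _ hx hy => rw [map_add, hx, hy, smul_add]
  | tmul r _ x hx => rw [LinearMap.lTensor_tmul, T.sgn_apply hx, tmul_negOnePow]

theorem evP_pathFst_q (s : K) (n : ℕ) (x : Fin (n + 2) → T.path) :
    (evP s ∘ₗ T.pathFst) (T.path.q n x) = T.q n fun j => (evP s ∘ₗ T.pathFst) (x j) :=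
  evP_extend s (n + 2) (T.q n) fun j => T.pathFst (x j)

theorem evP_pathSnd_q (s : K) (n : ℕ) (x : Fin (n + 2) → T.path) :
    (evP s ∘ₗ T.pathSnd) (T.path.q n x) = ∑ i, T.q n fun j =>
      (if j < i then evP s ∘ₗ T.pathFst else if j = i then evP s ∘ₗ T.pathSnd
        else -(T.sgn ∘ₗ evP s ∘ₗ T.pathFst)) (x j) := by
  have h1 : T.pathSnd (T.path.q n x) = ∑ i, extend K[X] (n + 2) (T.q n) fun j =>
      (if j < i then T.pathFst else if j = i then T.pathSnd
        else -((T.sgn.lTensor K[X]) ∘ₗ T.pathFst)) (x j) := by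
    have h2 : ∀ F : Fin (n + 2) → MultilinearMap K (fun _ : Fin (n + 2) => T.path) (K[X] ⊗[K] T),
        (∑ i, F i) x = ∑ i, F i x := fun F => by simp
    exact h2 fun i => ((extend K[X] (n + 2) (T.q n)).restrictScalars K).compLinearMap fun j =>
      if j < i then T.pathFst else if j = i then T.pathSnd
        else -((T.sgn.lTensor K[X]) ∘ₗ T.pathFst)
  rw [LinearMap.comp_apply, h1, map_sum]
  refine Finset.sum_congr rfl fun i _ => ?_
  rw [evP_extend]
  congr 1
  ext j
  split_ifs
  · rfl
  · rfl
  · rw [LinearMap.neg_apply, map_neg, LinearMap.comp_apply, evP_lTensor]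
    rfl

theorem evP_pathFst_q₁ (s : K) :
    (evP s ∘ₗ T.pathFst) ∘ₗ T.path.q₁ = T.q₁ ∘ₗ evP s ∘ₗ T.pathFst :=
  LinearMap.ext fun x => evP_lTensor T.q₁ s (T.pathFst x)

theorem evP_pathSnd_q₁ (s : K) : (evP s ∘ₗ T.pathSnd) ∘ₗ T.path.q₁ =
    T.q₁ ∘ₗ evP s ∘ₗ T.pathSnd - T.sgn ∘ₗ evP s ∘ₗ derP ∘ₗ T.pathFst := by
  have h1 : ∀ z : K[X] ⊗[K] T, evP s (TensorProduct.map Polynomial.derivative T.sgn z) =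
      T.sgn (evP s (derP z)) := by
    intro z
    rw [← evP_lTensor, derP, ← LinearMap.comp_apply (T.sgn.lTensor K[X]),
      LinearMap.lTensor_comp_rTensor]
  refine LinearMap.ext fun x => ?_
  have h2 : T.pathSnd (T.path.q₁ x) = T.q₁.lTensor K[X] (T.pathSnd x) -
    TensorProduct.map Polynomial.derivative T.sgn (T.pathFst x) := rfl
  rw [LinearMap.comp_apply, LinearMap.comp_apply, h2, map_sub, evP_lTensor, h1]
  rfl

theorem evP_polyFst_extend (s : K) (n : ℕ) (Γ : A ⊗[K] T.path) :
    evP s (T.polyFst (extend A (n + 2) (T.path.q n) fun _ => Γ)) =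
      extend A (n + 2) (T.q n) fun _ => evP s (T.polyFst Γ) := by
  have h1 := extend_hom A.carrier (ι := Unit) {()} (f := T.path.q n) (f' := T.q n)
    (ψ := evP s ∘ₗ T.pathFst) (ψ' := fun _ _ => evP s ∘ₗ T.pathFst)
    (fun x => by rw [Finset.sum_singleton, evP_pathFst_q]) fun _ => Γ
  rw [evP_polyFst, h1, Finset.sum_singleton, evP_polyFst]

theorem evP_polySnd_extend (s : K) (n : ℕ) {Γ : A ⊗[K] T.path}
    (hΓ : Γ ∈ coeffPart A A.m (T.path.gr 1)) :
    evP s (T.polySnd (extend A (n + 2) (T.path.q n) fun _ => Γ)) =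
      ∑ i, extend A (n + 2) (T.q n)
        (Function.update (fun _ => evP s (T.polyFst Γ)) i (evP s (T.polySnd Γ))) := by
  have h1 := extend_hom A.carrier Finset.univ (f := T.path.q n) (f' := T.q n)
    (ψ := evP s ∘ₗ T.pathSnd) (ψ' := fun i j => if j < i then evP s ∘ₗ T.pathFst
      else if j = i then evP s ∘ₗ T.pathSnd else -(T.sgn ∘ₗ evP s ∘ₗ T.pathFst))
    (evP_pathSnd_q s n) fun _ => Γ
  rw [evP_polySnd, h1]
  refine Finset.sum_congr rfl fun i _ => ?_
  congr 1
  ext j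
  rcases lt_trichotomy j i with hj | rfl | hj
  · rw [if_pos hj, Function.update_of_ne hj.ne, evP_polyFst]
  · rw [if_neg (lt_irrefl _), if_pos rfl, Function.update_self, evP_polySnd]
  · rw [if_neg hj.not_gt, if_neg hj.ne', Function.update_of_ne hj.ne', LinearMap.lTensor_neg,
      LinearMap.neg_apply, LinearMap.lTensor_comp_apply, ← evP_polyFst,
      sgn_coeffPart (evP_mem (polyFst_mem hΓ) s)]
    simp

/-- The Maurer-Cartan equation in `T[s, ds]` says that `p(s)` is a Maurer-Cartan element for all
`s` and that `p'` is the infinitesimal gauge transformation by `q`. -/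
theorem path_curvature_iff {Γ : A ⊗[K] T.path} (hΓ : Γ ∈ coeffPart A A.m (T.path.gr 1)) :
    T.path.curvature A Γ = 0 ↔ ∀ s : K, T.curvature A (evP s (T.polyFst Γ)) = 0 ∧
      evP s (derP (T.polyFst Γ)) + T.jet (evP s (T.polyFst Γ)) (evP s (T.polySnd Γ)) = 0 := by
  obtain ⟨k, hk⟩ := A.exists_m_pow
  have hmem : ∀ s, evP s (T.polyFst Γ) ∈ coeffPart A A.m (T.gr 1) := fun s =>
    evP_mem (polyFst_mem hΓ) s
  have hmem' : ∀ s, evP s (T.polySnd Γ) ∈ coeffPart A A.m (T.gr (1 - 1)) := fun s =>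
    evP_mem (polySnd_mem hΓ) s
  have hc : T.path.curvature A Γ = T.path.q₁.lTensor A Γ + ∑ n ∈ Finset.range k,
      ((n + 2).factorial : K)⁻¹ • extend A (n + 2) (T.path.q n) (fun _ => Γ) := by
    rw [curvature, finsum_eq_sum_range (k := k)]
    · rfl
    · intro n hn
      rw [extend_eq_zero hk (by omega) _ fun _ => coeffPart_mono le_rfl le_top hΓ, smul_zero]
  have hcs : ∀ s, T.curvature A (evP s (T.polyFst Γ)) = T.q₁.lTensor A (evP s (T.polyFst Γ)) +
      ∑ n ∈ Finset.range k, ((n + 2).factorial : K)⁻¹ •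
        extend A (n + 2) (T.q n) (fun _ => evP s (T.polyFst Γ)) := by
    intro s
    rw [curvature, finsum_eq_sum_range (k := k)]
    · rfl
    · intro n hn
      rw [extend_eq_zero hk (by omega) _ fun _ => coeffPart_mono le_rfl le_top (hmem s), smul_zero]
  have hjs : ∀ s, T.jet (evP s (T.polyFst Γ)) (evP s (T.polySnd Γ)) =
      T.q₁.lTensor A (evP s (T.polySnd Γ)) +
      ∑ n ∈ Finset.range k, ((n + 2).factorial : K)⁻¹ • ∑ i, extend A (n + 2) (T.q n)
        (Function.update (fun _ => evP s (T.polyFst Γ)) i (evP s (T.polySnd Γ))) := by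
    intro s
    rw [jet, finsum_eq_sum_range (k := k)]
    intro n hn
    rw [Finset.sum_eq_zero fun i _ => ?_, smul_zero]
    refine extend_eq_zero hk (by omega) _ fun j => ?_
    by_cases hj : j = i
    · rw [hj, Function.update_self]
      exact coeffPart_mono le_rfl le_top (hmem' s)
    · rw [Function.update_of_ne hj]
      exact coeffPart_mono le_rfl le_top (hmem s)
  rw [path_eq_zero_iff]
  refine forall_congr' fun s => ?_
  have e1 : evP s (T.polyFst (T.path.curvature A Γ)) = T.curvature A (evP s (T.polyFst Γ)) := by
    rw [hcs, hc, evP_polyFst, map_add, map_sum, ← LinearMap.lTensor_comp_apply, evP_pathFst_q₁,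
      LinearMap.lTensor_comp_apply, ← evP_polyFst]
    congr 1
    refine Finset.sum_congr rfl fun n _ => ?_
    rw [map_smul, ← evP_polyFst, evP_polyFst_extend]
  have e2 : evP s (T.polySnd (T.path.curvature A Γ)) = evP s (derP (T.polyFst Γ)) +
      T.jet (evP s (T.polyFst Γ)) (evP s (T.polySnd Γ)) := by
    rw [hjs, hc, evP_polySnd, map_add, map_sum, ← LinearMap.lTensor_comp_apply, evP_pathSnd_q₁,
      LinearMap.lTensor_sub, LinearMap.sub_apply, LinearMap.lTensor_comp_apply,
      LinearMap.lTensor_comp_apply _ T.sgn, ← evP_polySnd, ← evP_derP_polyFst,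
      sgn_coeffPart (evP_mem (derP_mem (polyFst_mem hΓ)) s), ← add_assoc]
    congr 1
    · simp [add_comm]
    refine Finset.sum_congr rfl fun n _ => ?_
    rw [map_smul, ← evP_polySnd, evP_polySnd_extend s n hΓ]
  rw [e1, e2]

/-- Homotopy of Maurer-Cartan elements in terms of polynomials with coefficients in `T ⊗ A`. -/
theorem homotopic_iff_exists (γ₀ γ₁ : T.MC A) : T.Homotopic A γ₀ γ₁ ↔
    ∃ P ∈ partP (coeffPart A A.m (T.gr 1)), ∃ Q ∈ partP (coeffPart A A.m (T.gr 0)),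
      (∀ s : K, T.curvature A (evP s P) = 0 ∧ evP s (derP P) + T.jet (evP s P) (evP s Q) = 0) ∧
      evP 0 P = γ₀.1 ∧ evP 1 P = γ₁.1 := by
  constructor
  · rintro ⟨⟨Γ, hΓ, hc⟩, h0, h1⟩
    have hQ := polySnd_mem hΓ
    rw [sub_self] at hQ
    rw [evalPath_eq] at h0 h1
    exact ⟨_, polyFst_mem hΓ, _, hQ, (path_curvature_iff hΓ).1 hc, h0, h1⟩
  · rintro ⟨P, hP, Q, hQ, hc, h0, h1⟩
    obtain ⟨Γ, hΓ, rfl, rfl⟩ := exists_path hP (by rwa [sub_self])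
    exact ⟨⟨Γ, hΓ, (path_curvature_iff hΓ).2 hc⟩, (evalPath_eq 0 Γ).trans h0,
      (evalPath_eq 1 Γ).trans h1⟩

end LInftyData

/-! ### Comparison of the two deformation problems -/

section Comparison

variable {K : Type u} [Field K] [CharZero K] {A : ArtAlg.{u, w} K} {L M N : DGLA.{u, v} K}
  (h : DGLAHom L M) (g : DGLAHom N M)

theorem jet_zero (T : LInftyData.{u, v} K) (p : A ⊗[K] T) : T.jet p 0 = 0 := by
  have h1 : ∀ n : ℕ, ((n + 2).factorial : K)⁻¹ •
      ∑ i, extend A (n + 2) (T.q n) (Function.update (fun _ => p) i 0) = 0 := fun n => by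
    rw [Finset.sum_eq_zero fun i _ => MultilinearMap.map_update_zero _ _ _, smul_zero]
  rw [LInftyData.jet, map_zero, zero_add, finsum_congr h1, finsum_zero]

theorem coneZero_zero : ConeZero (0 : A ⊗[K] (L × N × M)) :=
  coneZero_iff.1 (Submodule.zero_mem _)

/-- The Maurer-Cartan elements of the cone are those of the pair: the case `q = r = 0` of
`cone_curvature_iff`. -/
theorem cone_mc_iff (p : A ⊗[K] (L × N × M)) :
    p ∈ coeffPart A A.m ((cone h g).gr 1) ∧ (cone h g).curvature A p = 0 ↔
      L.IsMC A (coneL A p) ∧ N.IsMC A (coneN A p) ∧ coneM A p ∈ M.part A 0 ∧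
        g.mapA A (coneN A p) = M.gaugeA A (coneM A p) (h.mapA A (coneL A p)) := by
  have key : ∀ hp : ConeOne p, coneCurvature h g p = 0 ↔ (L.nil A).MC (coneL A p) ∧
      (N.nil A).MC (coneN A p) ∧
      g.mapA A (coneN A p) = M.gaugeA A (coneM A p) (h.mapA A (coneL A p)) := by
    intro hp
    have h1 := cone_curvature_iff h g hp coneZero_zero 0
    rw [show coneJet h g p 0 = 0 from jet_zero (cone h g) p] at h1
    have h2 := NilDGLA.nexp_affOp_pairOp_zero (D := M.nil A) hp.m (h.toLin.lTensor A (coneL A p))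
    simp only [map_zero, sub_zero, add_zero, conePair, LinearMap.zero_apply, true_and,
      and_true] at h1
    rw [h1, h2, DGLA.gaugeA_eq]
    simp only [Prod.mk.injEq, and_true]
    refine and_congr_right fun _ => and_congr_right fun _ => eq_comm
  rw [DGLA.isMC_iff, DGLA.isMC_iff]
  constructor
  · rintro ⟨hp, hc⟩
    have hp := coneOne_iff.1 hp
    obtain ⟨h1, h2, h3⟩ := (key hp).1 hc
    exact ⟨⟨hp.l, h1⟩, ⟨hp.n, h2⟩, hp.m, h3⟩
  · rintro ⟨⟨h1, h2⟩, ⟨h3, h4⟩, h5, h6⟩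
    have hp : ConeOne p := ⟨h1, h3, h5⟩
    exact ⟨coneOne_iff.2 hp, (key hp).2 ⟨h2, h4, h6⟩⟩

theorem lTensor_cone_mem {i : ℤ} {P : K[X] ⊗[K] (A ⊗[K] (L × N × M))}
    (hP : P ∈ partP (coeffPart A A.m ((L.gr i).prod ((N.gr i).prod (M.gr (i - 1)))))) :
    (coneL A).lTensor K[X] P ∈ partP (L.part A i) ∧
      (coneN A).lTensor K[X] P ∈ partP (N.part A i) ∧
      (coneM A).lTensor K[X] P ∈ partP (M.part A (i - 1)) := by
  have key : ∀ v ∈ coeffPart A A.m ((L.gr i).prod ((N.gr i).prod (M.gr (i - 1)))),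
      coneL A v ∈ L.part A i ∧ coneN A v ∈ N.part A i ∧ coneM A v ∈ M.part A (i - 1) :=
    fun v hv => mem_cone_iff.1 hv
  refine ⟨?_, ?_, ?_⟩
  · exact lTensor_mem (f := coneL A) (Q := L.part A i) (fun v hv => (key v hv).1) hP
  · exact lTensor_mem (f := coneN A) (Q := N.part A i) (fun v hv => (key v hv).2.1) hP
  · exact lTensor_mem (f := coneM A) (Q := M.part A (i - 1)) (fun v hv => (key v hv).2.2) hP

/-- The Maurer-Cartan equation in `C[s, ds]` in terms of components. -/
theorem pathMC_iff {P Q : K[X] ⊗[K] (A ⊗[K] (L × N × M))}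
    (hP : P ∈ partP (coeffPart A A.m ((L.gr 1).prod ((N.gr 1).prod (M.gr (1 - 1))))))
    (hQ : Q ∈ partP (coeffPart A A.m ((L.gr 0).prod ((N.gr 0).prod (M.gr (0 - 1)))))) :
    (∀ s : K, coneCurvature h g (evP s P) = 0 ∧
      evP s (derP P) + coneJet h g (evP s P) (evP s Q) = 0) ↔
    PathMC (h.nil A) (g.nil A) ((coneL A).lTensor K[X] P) ((coneL A).lTensor K[X] Q)
      ((coneN A).lTensor K[X] P) ((coneN A).lTensor K[X] Q)
      ((coneM A).lTensor K[X] P) ((coneM A).lTensor K[X] Q) := by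
  have hPs : ∀ s, ConeOne (evP s P) := fun s => coneOne_iff.1 (evP_mem hP s)
  have hQs : ∀ s, ConeZero (evP s Q) := fun s => coneZero_iff.1 (evP_mem hQ s)
  obtain ⟨hl, hn, hm⟩ := lTensor_cone_mem hP
  obtain ⟨hl', hn', hc⟩ := lTensor_cone_mem hQ
  rw [sub_self] at hm
  rw [zero_sub] at hc
  have hflat : ∀ (D : NilDGLA.{u, max v w} K) (x a : K[X] ⊗[K] D),
      derP x = D.d.lTensor K[X] a - brP D.br a x ↔
      ∀ s, evP s (derP x) = D.d (evP s a) - D.br (evP s a) (evP s x) := by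
    intro D x a
    have h1 : ∀ s, evP s (D.d.lTensor K[X] a - brP D.br a x) =
        D.d (evP s a) - D.br (evP s a) (evP s x) := fun s => by
      rw [map_sub, evP_lTensor, evP_brP]
    exact ⟨fun H s => by rw [H, h1], fun H => ext_evP fun s => by rw [h1, H]⟩
  have hgauge := NilDGLA.pexp_eq_iff (D := M.nil A)
    (x := (h.toLin.lTensor A).lTensor K[X] ((coneL A).lTensor K[X] P))
    (a := (h.toLin.lTensor A).lTensor K[X] ((coneL A).lTensor K[X] Q))
    (y := (g.toLin.lTensor A).lTensor K[X] ((coneN A).lTensor K[X] P))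
    (b := (g.toLin.lTensor A).lTensor K[X] ((coneN A).lTensor K[X] Q)) hm hc
  simp only [evP_lTensor (h.toLin.lTensor A), evP_lTensor (g.toLin.lTensor A)] at hgauge
  have key := fun s => cone_curvature_iff h g (hPs s) (hQs s) (evP s (derP P))
  simp only [conePair, ← evP_lTensor (coneL A), ← evP_lTensor (coneN A), ← evP_lTensor (coneM A),
    ← derP_lTensor] at key
  constructor
  · intro H
    have H := fun s => (key s).1 (H s)
    refine ⟨hl, hl', hn, hn', hm, hc, fun s => (H s).1,
      fun s => (H s).2.1, (hflat (L.nil A) _ _).2 fun s => (H s).2.2.1,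
      (hflat (N.nil A) _ _).2 fun s => (H s).2.2.2.1, hgauge.2 fun s => (H s).2.2.2.2⟩
  · intro H s
    exact (key s).2 ⟨H.mc_x s, H.mc_y s, (hflat (L.nil A) _ _).1 H.flat_x s,
      (hflat (N.nil A) _ _).1 H.flat_y s, hgauge.1 H.gauge s⟩

/-- The polynomial with coefficients in `C ⊗ A` with given components. -/
def coneMkP (x : K[X] ⊗[K] (A ⊗[K] L)) (y : K[X] ⊗[K] (A ⊗[K] N)) (m : K[X] ⊗[K] (A ⊗[K] M)) :
    K[X] ⊗[K] (A ⊗[K] (L × N × M)) :=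
  ((LinearMap.inl K L (N × M)).lTensor A).lTensor K[X] x +
    ((LinearMap.inr K L (N × M) ∘ₗ LinearMap.inl K N M).lTensor A).lTensor K[X] y +
    ((LinearMap.inr K L (N × M) ∘ₗ LinearMap.inr K N M).lTensor A).lTensor K[X] m

theorem evP_coneMkP (s : K) (x : K[X] ⊗[K] (A ⊗[K] L)) (y : K[X] ⊗[K] (A ⊗[K] N))
    (m : K[X] ⊗[K] (A ⊗[K] M)) :
    evP s (coneMkP x y m) = coneMk A (evP s x) (evP s y) (evP s m) := by
  rw [coneMkP, map_add, map_add, evP_lTensor, evP_lTensor, evP_lTensor, coneMk]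

section

variable (x : K[X] ⊗[K] (A ⊗[K] L)) (y : K[X] ⊗[K] (A ⊗[K] N)) (m : K[X] ⊗[K] (A ⊗[K] M))

theorem coneL_mkP : (coneL A).lTensor K[X] (coneMkP x y m) = x :=
  ext_evP fun s => by
    rw [evP_lTensor, evP_coneMkP, coneL_mk]

theorem coneN_mkP : (coneN A).lTensor K[X] (coneMkP x y m) = y :=
  ext_evP fun s => by
    rw [evP_lTensor, evP_coneMkP, coneN_mk]

theorem coneM_mkP : (coneM A).lTensor K[X] (coneMkP x y m) = m :=
  ext_evP fun s => by
    rw [evP_lTensor, evP_coneMkP, coneM_mk]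

variable {x y m} in
theorem coneMkP_mem {i : ℤ} (hx : x ∈ partP (L.part A i)) (hy : y ∈ partP (N.part A i))
    (hm : m ∈ partP (M.part A (i - 1))) : coneMkP x y m ∈
      partP (coeffPart A A.m ((L.gr i).prod ((N.gr i).prod (M.gr (i - 1))))) := by
  have e1 : ∀ z ∈ L.part A i, (LinearMap.inl K L (N × M)).lTensor A z ∈
      coeffPart A A.m ((L.gr i).prod ((N.gr i).prod (M.gr (i - 1)))) := fun z hz => by
    refine lTensor_mem_coeffPart ?_ hz
    exact fun x hx => ⟨hx, Submodule.zero_mem _, Submodule.zero_mem _⟩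
  have e2 : ∀ z ∈ N.part A i, (LinearMap.inr K L (N × M) ∘ₗ LinearMap.inl K N M).lTensor A z ∈
      coeffPart A A.m ((L.gr i).prod ((N.gr i).prod (M.gr (i - 1)))) := fun z hz => by
    refine lTensor_mem_coeffPart ?_ hz
    exact fun x hx => ⟨Submodule.zero_mem _, hx, Submodule.zero_mem _⟩
  have e3 : ∀ z ∈ M.part A (i - 1),
      (LinearMap.inr K L (N × M) ∘ₗ LinearMap.inr K N M).lTensor A z ∈
      coeffPart A A.m ((L.gr i).prod ((N.gr i).prod (M.gr (i - 1)))) := fun z hz => by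
    refine lTensor_mem_coeffPart ?_ hz
    exact fun x hx => ⟨Submodule.zero_mem _, Submodule.zero_mem _, hx⟩
  exact Submodule.add_mem _ (Submodule.add_mem _ (lTensor_mem e1 hx) (lTensor_mem e2 hy))
    (lTensor_mem e3 hm)

end

theorem exists_poly_iff (γ₀ γ₁ : A ⊗[K] (L × N × M)) :
    (∃ P ∈ partP (coeffPart A A.m ((L.gr 1).prod ((N.gr 1).prod (M.gr (1 - 1))))),
      ∃ Q ∈ partP (coeffPart A A.m ((L.gr 0).prod ((N.gr 0).prod (M.gr (0 - 1))))),
      (∀ s : K, coneCurvature h g (evP s P) = 0 ∧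
        evP s (derP P) + coneJet h g (evP s P) (evP s Q) = 0) ∧ evP 0 P = γ₀ ∧ evP 1 P = γ₁) ↔
    ∃ x a y b m c, PathMC (h.nil A) (g.nil A) x a y b m c ∧
      evP 0 x = coneL A γ₀ ∧ evP 0 y = coneN A γ₀ ∧ evP 0 m = coneM A γ₀ ∧
      evP 1 x = coneL A γ₁ ∧ evP 1 y = coneN A γ₁ ∧ evP 1 m = coneM A γ₁ := by
  constructor
  · rintro ⟨P, hP, Q, hQ, hc, rfl, rfl⟩
    exact ⟨_, _, _, _, _, _, (pathMC_iff h g hP hQ).1 hc, evP_lTensor _ _ _, evP_lTensor _ _ _,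
      evP_lTensor _ _ _, evP_lTensor _ _ _, evP_lTensor _ _ _, evP_lTensor _ _ _⟩
  · rintro ⟨x, a, y, b, m, c, H, h1, h2, h3, h4, h5, h6⟩
    have hP := coneMkP_mem (i := 1) H.mem_x H.mem_y H.mem_m
    have hQ := coneMkP_mem (i := 0) H.mem_a H.mem_b H.mem_c
    refine ⟨_, hP, _, hQ, (pathMC_iff h g hP hQ).2 ?_, ?_, ?_⟩
    · rwa [coneL_mkP, coneL_mkP, coneN_mkP, coneN_mkP, coneM_mkP, coneM_mkP]
    · rw [evP_coneMkP, h1, h2, h3, coneMk_components]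
    · rw [evP_coneMkP, h4, h5, h6, coneMk_components]

/-- Homotopy of Maurer-Cartan elements of the cone in terms of paths of components. -/
theorem homotopic_iff (γ₀ γ₁ : (cone h g).MC A) : (cone h g).Homotopic A γ₀ γ₁ ↔
    ∃ x a y b m c, PathMC (h.nil A) (g.nil A) x a y b m c ∧
      evP 0 x = coneL A γ₀.1 ∧ evP 0 y = coneN A γ₀.1 ∧ evP 0 m = coneM A γ₀.1 ∧
      evP 1 x = coneL A γ₁.1 ∧ evP 1 y = coneN A γ₁.1 ∧ evP 1 m = coneM A γ₁.1 :=
  (LInftyData.homotopic_iff_exists γ₀ γ₁).trans (exists_poly_iff h g γ₀.1 γ₁.1)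

/-- The bijection `(l, n, m) ↦ (l, n, e ^ m)`. -/
def mcEquiv (A : ArtAlg.{u, w} K) : (cone h g).MC A ≃ MCPair h g A where
  toFun γ := ⟨components h g A γ.1, (cone_mc_iff h g γ.1).1 γ.2⟩
  invFun z := ⟨coneMk A z.1.1 z.1.2.1 z.1.2.2, (cone_mc_iff h g _).2 (by
    rw [coneL_mk, coneN_mk, coneM_mk]; exact z.2)⟩
  left_inv γ := Subtype.ext (coneMk_components γ.1)
  right_inv z := Subtype.ext (Prod.ext (coneL_mk _ _ _) (Prod.ext (coneN_mk _ _ _)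
    (coneM_mk _ _ _)))

theorem homotopic_iff_gaugeEquiv (γ₀ γ₁ : (cone h g).MC A) :
    (cone h g).Homotopic A γ₀ γ₁ ↔ GaugeEquiv h g A (mcEquiv h g A γ₀) (mcEquiv h g A γ₁) := by
  rw [homotopic_iff]
  constructor
  · rintro ⟨x, a, y, b, m, c, H, h1, h2, h3, h4, h5, h6⟩
    obtain ⟨a₀, ha, b₀, hb, c₀, hc, e1, e2, e3⟩ := H.gaugeEquiv
    rw [h1, h4] at e1
    rw [h2, h5] at e2
    rw [h2, h3, h6] at e3
    refine ⟨a₀, ha, b₀, hb, c₀, hc, ?_, ?_, ?_⟩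
    · rw [DGLA.gaugeA_eq]; exact e1
    · rw [DGLA.gaugeA_eq]; exact e2
    · rw [DGLA.mulA_eq, DGLA.mulA_eq, DGLA.mulA_eq, DGLA.brA_eq]; exact e3
  · rintro ⟨a, ha, b, hb, c, hc, e1, e2, e3⟩
    rw [DGLA.gaugeA_eq] at e1 e2
    rw [DGLA.mulA_eq, DGLA.mulA_eq, DGLA.mulA_eq, DGLA.brA_eq] at e3
    obtain ⟨⟨h1, h2⟩, ⟨h3, h4⟩, h5, h6⟩ := (cone_mc_iff h g γ₀.1).1 γ₀.2
    rw [DGLA.gaugeA_eq] at h6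
    obtain ⟨X, A', Y, B, m, e, H, k1, k2, k3, k4, k5, k6⟩ :=
      exists_pathMC (h := h.nil A) (g := g.nil A) h1 h3 h5
        ((DGLA.isMC_iff A).1 ⟨h1, h2⟩).2 ((DGLA.isMC_iff A).1 ⟨h3, h4⟩).2 h6 ha hb hc
    exact ⟨X, A', Y, B, m, e, H, k1, k2, k3, k4.trans e1.symm, k5.trans e2.symm,
      k6.trans e3.symm⟩

/-- The isomorphism `(l, n, m) ↦ (l, n, e ^ m)` of Maurer-Cartan functors. -/
def mcIso : (cone h g).MCFunctor ≅ MCPairFunctor.{u, v, w} h g :=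
  NatIso.ofComponents (fun A => (mcEquiv h g A).toIso) fun {A B} f => by
    ext γ
    refine Subtype.ext (Prod.ext ?_ (Prod.ext ?_ ?_))
    exacts [(push_baseChange f _ γ.1).symm, (push_baseChange f _ γ.1).symm,
      (push_baseChange f _ γ.1).symm]

/-- The induced bijection of deformation functors. -/
def defEquiv (A : ArtAlg.{u, w} K) : Quot ((cone h g).Homotopic A) ≃ Quot (GaugeEquiv h g A) :=
  Quot.congr (mcEquiv h g A) (homotopic_iff_gaugeEquiv h g)

/-- The isomorphism of deformation functors induced by `mcIso`. -/
def defIso : (cone h g).Def ≅ DefPair.{u, v, w} h g :=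
  NatIso.ofComponents (fun A => (defEquiv h g A).toIso) fun {A B} f => by
    ext γ
    induction γ using Quot.ind with
    | mk γ =>
      refine congrArg (Quot.mk _) (Subtype.ext (Prod.ext ?_ (Prod.ext ?_ ?_)))
      exacts [(push_baseChange f _ γ.1).symm, (push_baseChange f _ γ.1).symm,
        (push_baseChange f _ γ.1).symm]

end Comparison

end ConeDef
end

theorem mainTheorem3 {L M N : ConeDef.DGLA.{0, v} ℂ} (h : ConeDef.DGLAHom L M)
    (g : ConeDef.DGLAHom N M) :
    ∃ (Ψ : (ConeDef.cone h g).MCFunctor ≅ ConeDef.MCPairFunctor.{0, v, w} h g)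
      (Φ : (ConeDef.cone h g).Def ≅ ConeDef.DefPair.{0, v, w} h g),
      (∀ (A : ConeDef.ArtAlg.{0, w} ℂ) (γ : (ConeDef.cone h g).MC A),
        (Ψ.hom.app A γ : ConeDef.MCPair h g A).1 = ConeDef.components h g A γ.1) ∧
      (∀ (A : ConeDef.ArtAlg.{0, w} ℂ) (γ : (ConeDef.cone h g).MC A),
        Φ.hom.app A (Quot.mk _ γ) = Quot.mk (ConeDef.GaugeEquiv h g A) (Ψ.hom.app A γ)) ∧
      (∀ (A : ConeDef.ArtAlg.{0, w} ℂ) (γ₀ γ₁ : (ConeDef.cone h g).MC A),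
        (ConeDef.cone h g).Homotopic A γ₀ γ₁ ↔
          ConeDef.GaugeEquiv h g A (Ψ.hom.app A γ₀) (Ψ.hom.app A γ₁)) :=
  ⟨ConeDef.mcIso h g, ConeDef.defIso h g, fun _ _ => rfl, fun _ _ => rfl,
    fun _ => ConeDef.homotopic_iff_gaugeEquiv h g⟩
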